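/- For a topological space $Z$ write $H_*(Z)=H_*(Z;\mathbb Z)$ for singular homology, let $C_Z=Z\times[0,1]/(Z\times\{0\})$ be the cone of $Z$, and let $i_Z:H_*(Z)\to H_*(C_Z)$ be the graded homomorphism induced by the inclusion $Z\to C_Z$, $z\mapsto[z,1]$, with degree $k$ part $(i_Z)_k$; thus $\mathrm{Ker}(i_Z)$ is the graded group with degree $k$ part $\mathrm{Ker}((i_Z)_k)$. For topological spaces $X,Y$ the join is the quotient space $$X\star Y=X\times Y\times[0,1]\big/\big((x,y,0)\sim(x',y,0),\ (x,y,1)\sim(x,y',1)\big).$$ Theorem 1.2. Let $X$ and $Y$ be topological spaces such that $\mathrm{Tor}_1^{\mathbb Z}(H_i(X),H_j(Y))=0$ for all $i,j\ge 0$. Then for every $n\geq 1$ the group $H_n(X\star Y)$ is isomorphic to the degree $n-1$ part $\bigoplus_{k+m=n-1}\mathrm{Ker}((i_X)_k)\otimes\mathrm{Ker}((i_Y)_m)$ of $\mathrm{Ker}(i_X)\otimes \mathrm{Ker}(i_Y)$. Moreover: 1) For $n>1$, the inclusions $\mathrm{Ker}((i_X)_k)\subseteq H_k(X)$ and $\mathrm{Ker}((i_Y)_m)\subseteq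 H_m(Y)$ for $k,m>0$ induce an isomorphism from the degree $n-1$ part of $\mathrm{Ker}(i_X)\otimes\mathrm{Ker}(i_Y)$ onto $$\bigoplus_{\substack{k+m=n-1\\ k,m>0}} H_k(X)\otimes H_m(Y)\ \oplus\ \mathrm{Ker}((i_X)_0)\otimes H_{n-1}(Y)\ \oplus\ H_{n-1}(X)\otimes \mathrm{Ker}((i_Y)_0).$$ 2) For $n=1$, the degree $n-1=0$ part of $\mathrm{Ker}(i_X)\otimes\mathrm{Ker}(i_Y)$ is $\mathrm{Ker}((i_X)_0)\otimes\mathrm{Ker}((i_Y)_0)$. -/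

import Mathlib

open CategoryTheory Limits
open scoped TensorProduct DirectSum

universe u

noncomputable section

/-! ### Cones and joins -/

/-- The relation on `Z × [0,1]` collapsing `Z × {0}`. -/
def coneRel (Z : Type u) (p q : Z × unitInterval) : Prop :=
  p.2 = 0 ∧ q.2 = 0

/-- The cone `C_Z = Z × [0,1] / Z × {0}`, with the quotient topology. -/
abbrev ConeSpace (Z : Type u) : Type u :=
  Quot (coneRel Z)

/-- The inclusion `Z → C_Z` of the base of the cone, `z ↦ [z, 1]`. -/
def coneInclusion (Z : Type u) [TopologicalSpace Z] : C(Z, ConeSpace Z) where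
  toFun z := Quot.mk _ (z, 1)
  continuous_toFun := continuous_quot_mk.comp (by fun_prop)

/-- The relation on `X × Y × [0,1]` with `(x, y, 0) ∼ (x', y, 0)` and `(x, y, 1) ∼ (x, y', 1)`. -/
inductive joinRel (X Y : Type u) : X × Y × unitInterval → X × Y × unitInterval → Prop
  | zero (x x' : X) (y : Y) : joinRel X Y (x, y, 0) (x', y, 0)
  | one (x : X) (y y' : Y) : joinRel X Y (x, y, 1) (x, y', 1)

/-- The join `X ⋆ Y`, the quotient of `X × Y × [0,1]` by the equivalence relation generated by
`joinRel`, with the quotient topology. -/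
abbrev JoinSpace (X Y : Type u) : Type u :=
  Quot (joinRel X Y)

/-! ### Singular homology -/

/-- The `n`-th singular homology functor with coefficients in a ring `R`. The copy of `R` in
universe `u` is needed only because the homology of a space in `Type u` lives in that universe. -/
abbrev homologyFunctor (R : Type) [Ring R] (n : ℕ) : TopCat.{u} ⥤ ModuleCat.{u} R :=
  (AlgebraicTopology.singularHomologyFunctor (ModuleCat.{u} R) n).obj
    (ModuleCat.of R (ULift.{u} R))

/-- The integral singular homology group `H_n(Z)`. -/
abbrev intHomology (n : ℕ) (Z : Type u) [TopologicalSpace Z] : ModuleCat.{u} ℤ :=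
  (homologyFunctor ℤ n).obj (TopCat.of Z)

/-- The degree `k` part `(i_Z)_k : H_k(Z) → H_k(C_Z)` of the map `i_Z` induced by the inclusion of
`Z` in its cone. -/
def coneMap (k : ℕ) (Z : Type u) [TopologicalSpace Z] :
    intHomology k Z ⟶ intHomology k (ConeSpace Z) :=
  (homologyFunctor ℤ k).map (TopCat.ofHom (coneInclusion Z))

/-- The kernel of a homomorphism of modules, as a module. -/
def kerObj {R : Type} [Ring R] {A B : ModuleCat.{u} R} (f : A ⟶ B) : ModuleCat.{u} R :=
  ModuleCat.of R (LinearMap.ker f.hom)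

/-- The inclusion of the kernel of a homomorphism `A ⟶ B` in `A`. -/
def kerIncl {R : Type} [Ring R] {A B : ModuleCat.{u} R} (f : A ⟶ B) : kerObj f ⟶ A :=
  ModuleCat.ofHom (LinearMap.ker f.hom).subtype

/-- The degree `k` part `Ker((i_Z)_k)` of the graded group `Ker(i_Z)`. -/
abbrev coneKer (k : ℕ) (Z : Type u) [TopologicalSpace Z] : ModuleCat.{u} ℤ :=
  kerObj (coneMap k Z)

/-- The inclusion `Ker((i_Z)_k) ⊆ H_k(Z)`. -/
abbrev coneKerIncl (k : ℕ) (Z : Type u) [TopologicalSpace Z] : coneKer k Z ⟶ intHomology k Z :=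
  kerIncl (coneMap k Z)

/-! ### Tor and graded tensor products -/

/-- The functor `A ⊗ -` on modules. (Mathlib's monoidal structure on `ModuleCat`, hence its `Tor`,
exists only when the ring and the modules are in the same universe.) -/
def tensorFunctor {R : Type} [CommRing R] (A : ModuleCat.{u} R) :
    ModuleCat.{u} R ⥤ ModuleCat.{u} R where
  obj B := ModuleCat.of R (A ⊗[R] B)
  map f := ModuleCat.ofHom (f.hom.lTensor A)
  map_id B := by
    ext : 1
    exact LinearMap.lTensor_id A B
  map_comp f g := by
    ext : 1
    exact LinearMap.lTensor_comp A g.hom f.hom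

instance {R : Type} [CommRing R] (A : ModuleCat.{u} R) : (tensorFunctor A).Additive where
  map_add {_ _ f g} := by
    ext : 1
    exact LinearMap.lTensor_add A f.hom g.hom

/-- `Tor₁(A, B)`: the first left derived functor of `A ⊗ -`, evaluated at `B`. -/
def torOne {R : Type} [CommRing R] (A B : ModuleCat.{u} R) : ModuleCat.{u} R :=
  ((tensorFunctor A).leftDerived 1).obj B

/-- The degree `d` part `⊕_{k + m = d} M_k ⊗ N_m` of the tensor product `M ⊗ N` of two graded
abelian groups. -/
abbrev gradedTensor (M N : ℕ → ModuleCat.{u} ℤ) (d : ℕ) : Type u :=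
  ⨁ p : {p : ℕ × ℕ // p.1 + p.2 = d}, M p.1.1 ⊗[ℤ] N p.1.2

/-- The degree `d` part of `Ker(i_X) ⊗ Ker(i_Y)`. -/
abbrev kerTensor (X Y : Type u) [TopologicalSpace X] [TopologicalSpace Y] (d : ℕ) : Type u :=
  gradedTensor (fun k => coneKer k X) (fun m => coneKer m Y) d

/-- The element `a ⊗ b` of degree `d = k + m` of `Ker(i_X) ⊗ Ker(i_Y)`, for `a ∈ Ker((i_X)_k)` and
`b ∈ Ker((i_Y)_m)`. -/
def kerTmul {X Y : Type u} [TopologicalSpace X] [TopologicalSpace Y] {d : ℕ} (k m : ℕ)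
    (h : k + m = d) (a : coneKer k X) (b : coneKer m Y) : kerTensor X Y d :=
  DirectSum.of (fun p : {p : ℕ × ℕ // p.1 + p.2 = d} => coneKer p.1.1 X ⊗[ℤ] coneKer p.1.2 Y)
    ⟨(k, m), h⟩ (a ⊗ₜ[ℤ] b)

/-- The group `⊕_{k + m = d, k, m > 0} H_k(X) ⊗ H_m(Y)`. -/
abbrev posTensor (X Y : Type u) [TopologicalSpace X] [TopologicalSpace Y] (d : ℕ) : Type u :=
  ⨁ p : {p : ℕ × ℕ // p.1 + p.2 = d ∧ 0 < p.1 ∧ 0 < p.2},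
    intHomology p.1.1 X ⊗[ℤ] intHomology p.1.2 Y

/-- The element `a ⊗ b` of `⊕_{k + m = d, k, m > 0} H_k(X) ⊗ H_m(Y)`, for `a ∈ H_k(X)` and
`b ∈ H_m(Y)`. -/
def posTmul {X Y : Type u} [TopologicalSpace X] [TopologicalSpace Y] {d : ℕ} (k m : ℕ)
    (h : k + m = d ∧ 0 < k ∧ 0 < m) (a : intHomology k X) (b : intHomology m Y) : posTensor X Y d :=
  DirectSum.of (fun p : {p : ℕ × ℕ // p.1 + p.2 = d ∧ 0 < p.1 ∧ 0 < p.2} =>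
    intHomology p.1.1 X ⊗[ℤ] intHomology p.1.2 Y) ⟨(k, m), h⟩ (a ⊗ₜ[ℤ] b)

end

/-! Let `U` and `V` be the open parts `t < 1` and `t > 0` of the join. Sliding the coordinate `t` to
the end where a factor is collapsed gives `U ≃ Y` and `V ≃ X`, whereas `U ∩ V ≃ X × Y`; under these
equivalences the inclusions of `U ∩ V` become the two projections. If both spaces are nonempty, base
points provide sections of the projections, so `H_{n+1}(U ∩ V) → H_{n+1}(U) ⊕ H_{n+1}(V)` is onto,
and the Mayer–Vietoris sequence identifies `H_{n+1}(X ⋆ Y)` with the common kernel of the two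
projections on `H_n(X × Y)` (`JoinSpace.nonempty_homology_equiv`).

That kernel is computed in `TopCat.nonempty_kerTensor_equiv`. The projection to `X` factors through
the homotopy equivalence `X × C_Y → X`, so its kernel is that of `H_n(X × Y) → H_n(X × C_Y)`. The
Künneth map is natural and always injective, hence this is the kernel of `id ⊗ i_Y` in every
bidegree; likewise on the other side. A map from a nonempty space to a contractible one is a split
surjection in homology, and for split surjections the kernels of `id ⊗ i_Y` and `i_X ⊗ id` meet
exactly in `Ker(i_X) ⊗ Ker(i_Y)`. The torsion hypothesis enters only through surjectivity of the
Künneth map for `X × Y`. If a factor is empty, both sides vanish. The two supplements hold because a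
cone has no homology in positive degrees, so there the kernels are everything.

Two classical theorems carry the argument. The Künneth formula (`TopCat.exists_kunneth`) combines an
algebraic part, in which a complex is handled as one differential module whose boundaries are
projective since the ring is hereditary (`crossSum_injective`, `crossSum_surjective`), with the
Eilenberg–Zilber theorem, obtained from acyclic models (`exists_eilenbergZilber`). Mayer–Vietoris
rests on `smallIncl_homology_bijective`: barycentric subdivision shrinks simplices, is natural, and
is naturally homotopic to the identity, again by acyclic models. -/

noncomputable section

/-! ### Differential modules -/

namespace DiffModule

open TensorProduct LinearMap

variable {R : Type*} [CommRing R]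

/-! ### Cycles, boundaries and homology of one differential module. -/

section Basic

variable {C : Type*} [AddCommGroup C] [Module R C] (d : C →ₗ[R] C)

/-- The boundaries, as a submodule of the cycles. -/
abbrev boundaries : Submodule R (ker d) := (range d).submoduleOf (ker d)

/-- The homology of a differential module. -/
abbrev Homology : Type _ := ker d ⧸ boundaries d

/-- The inclusion of the boundaries in the cycles. -/
def boundaryIncl (hd : d ∘ₗ d = 0) : range d →ₗ[R] ker d :=
  Submodule.inclusion (by rintro _ ⟨x, rfl⟩; exact LinearMap.congr_fun hd x)

lemma subtype_comp_boundaryIncl (hd : d ∘ₗ d = 0) :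
    (ker d).subtype ∘ₗ boundaryIncl d hd = (range d).subtype := rfl

lemma exact_boundaryIncl_mkQ (hd : d ∘ₗ d = 0) :
    Function.Exact (boundaryIncl d hd) (boundaries d).mkQ := by
  intro x
  rw [Submodule.mkQ_apply, Submodule.Quotient.mk_eq_zero]
  constructor
  · rintro h
    exact ⟨⟨x, h⟩, rfl⟩
  · rintro ⟨y, rfl⟩
    exact y.2

lemma exact_subtype_rangeRestrict : Function.Exact (ker d).subtype d.rangeRestrict := by
  intro x
  constructor
  · intro h
    exact ⟨⟨x, by simpa [Subtype.ext_iff] using h⟩, rfl⟩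
  · rintro ⟨y, rfl⟩
    exact Subtype.ext y.2

end Basic

/-! ### Künneth arguments for the tensor product of two differential modules. -/

section Tensor

variable {C D : Type*} [AddCommGroup C] [Module R C] [AddCommGroup D] [Module R D]

/-- Projectivity of the boundaries splits `0 → ker d → C → range d → 0`, and an inclusion with a
retraction stays injective after tensoring with any module, flat or not. -/
lemma rTensor_subtype_injective (M : Type*) [AddCommGroup M] [Module R M] (d : C →ₗ[R] C)
    [Module.Projective R (range d)] : Function.Injective ((ker d).subtype.rTensor M) := by
  obtain ⟨s, hs⟩ := Module.projective_lifting_property d.rangeRestrict LinearMap.id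
    d.surjective_rangeRestrict
  have hs' : ∀ x, d (s (d.rangeRestrict x)) = d x := fun x =>
    congr_arg Subtype.val (LinearMap.congr_fun hs (d.rangeRestrict x))
  -- The retraction is `x ↦ x - s (d x)`, with `s` a section of `d` onto its range.
  let r : C →ₗ[R] ker d := LinearMap.codRestrict (ker d) (LinearMap.id - s ∘ₗ d.rangeRestrict)
    (fun x => by simp [hs'])
  have hr : r ∘ₗ (ker d).subtype = LinearMap.id := by
    ext x
    have : d.rangeRestrict x.1 = 0 := Subtype.ext x.2
    simp [r, this]
  refine Function.HasLeftInverse.injective ⟨r.rTensor M, fun x => ?_⟩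
  rw [← LinearMap.comp_apply, ← LinearMap.rTensor_comp, hr,
    LinearMap.rTensor_id, LinearMap.id_apply]

lemma lTensor_subtype_injective (M : Type*) [AddCommGroup M] [Module R M] (d : C →ₗ[R] C)
    [Module.Projective R (range d)] : Function.Injective ((ker d).subtype.lTensor M) := by
  rw [LinearMap.lTensor_inj_iff_rTensor_inj]
  exact rTensor_subtype_injective M d

variable (d : C →ₗ[R] C) (ε : C →ₗ[R] C) (b : D →ₗ[R] D)

/-- The differential of the tensor product of two differential modules, where `ε` is a sign
involution of the first one. -/
def tensorDiff : C ⊗[R] D →ₗ[R] C ⊗[R] D := d.rTensor D + TensorProduct.map ε b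

variable {d ε b}

/-- The summand `ε ⊗ b` dies under `id ⊗ b`. In particular every cycle of the tensor product is
killed by `d ⊗ b`. -/
lemma lTensor_tensorDiff (hb : b ∘ₗ b = 0) (t : C ⊗[R] D) :
    b.lTensor C (tensorDiff d ε b t) = TensorProduct.map d b t := by
  induction t with
  | zero => simp
  | add x y hx hy => simp [hx, hy]
  | tmul x y =>
    have : b (b y) = 0 := LinearMap.congr_fun hb y
    simp [tensorDiff, this]

lemma rTensor_tensorDiff (hd : d ∘ₗ d = 0) (hde : d ∘ₗ ε = - ε ∘ₗ d) (t : C ⊗[R] D) :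
    d.rTensor D (tensorDiff d ε b t) = - TensorProduct.map (ε ∘ₗ d) b t := by
  induction t with
  | zero => simp
  | add x y hx hy => rw [map_add, map_add, hx, hy, map_add, neg_add]
  | tmul x y =>
    have h1 : d (d x) = 0 := LinearMap.congr_fun hd x
    have h2 : d (ε x) = - ε (d x) := LinearMap.congr_fun hde x
    simp [tensorDiff, h1, h2, TensorProduct.neg_tmul]

/-- Two homologous tensor products of cycles define the same class in the tensor product of the
homology modules. -/
theorem map_mkQ_eq_zero_of_eq_tensorDiff [Module.Flat R C] [Module.Flat R (range d)]
    [Module.Projective R (range d)] [Module.Flat R D]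
    (hd : d ∘ₗ d = 0) (hb : b ∘ₗ b = 0) (z : ker d ⊗[R] ker b) (t : C ⊗[R] D)
    (h : TensorProduct.map (ker d).subtype (ker b).subtype z = tensorDiff d ε b t) :
    TensorProduct.map (boundaries d).mkQ (boundaries b).mkQ z = 0 := by
  -- `p` is `(d ⊗ id) t`, kept in `range d ⊗ D`. Since `id ⊗ b` kills the cycle `z`, it kills `p`,
  -- so `p` comes from `range d ⊗ ker b`.
  set p := d.rangeRestrict.rTensor D t with hp
  have hpd : (range d).subtype.rTensor D p = d.rTensor D t := by
    rw [hp, ← LinearMap.comp_apply, ← LinearMap.rTensor_comp]; rfl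
  have h0 : b.lTensor (range d) p = 0 := by
    have inj := Module.Flat.rTensor_preserves_injective_linearMap (M := D) (range d).subtype
      (Submodule.injective_subtype _)
    apply inj
    rw [map_zero, ← LinearMap.comp_apply, LinearMap.rTensor_comp_lTensor,
      ← LinearMap.lTensor_comp_rTensor, LinearMap.comp_apply, hpd, ← LinearMap.comp_apply,
      LinearMap.lTensor_comp_rTensor, ← lTensor_tensorDiff (ε := ε) hb, ← h]
    have : b ∘ₗ (ker b).subtype = 0 := by ext x; exact x.2
    rw [← LinearMap.comp_apply, LinearMap.lTensor, ← TensorProduct.map_comp, this]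
    simp
  have ex1 : Function.Exact ((ker b).subtype.lTensor (range d)) (b.lTensor (range d)) :=
    Module.Flat.lTensor_exact _ (LinearMap.exact_subtype_ker_map b)
  obtain ⟨p', hp'⟩ := (ex1 p).1 h0
  -- Removing the `d ⊗ id` part of the boundary does not change the class, since `p'` has a boundary
  -- as its first factor; what remains is `(ε ⊗ b) t`.
  set y := z - (boundaryIncl d hd).rTensor (ker b) p' with hy
  have h1 : TensorProduct.map (ker d).subtype (ker b).subtype y = TensorProduct.map ε b t := by
    rw [hy, map_sub, h, ← LinearMap.comp_apply, LinearMap.rTensor, ← TensorProduct.map_comp,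
      subtype_comp_boundaryIncl, LinearMap.comp_id, ← LinearMap.rTensor_comp_lTensor,
      LinearMap.comp_apply, hp', hpd, tensorDiff]
    simp
  have h2 : (ker d).subtype.rTensor (ker b) y =
      TensorProduct.map ε (boundaryIncl b hb ∘ₗ b.rangeRestrict) t := by
    have inj := Module.Flat.lTensor_preserves_injective_linearMap (M := C) (ker b).subtype
      (Submodule.injective_subtype _)
    apply inj
    rw [← LinearMap.comp_apply, LinearMap.lTensor_comp_rTensor, h1, ← LinearMap.comp_apply,
      LinearMap.lTensor, ← TensorProduct.map_comp]
    rfl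
  -- The second factor of `y` is now a boundary, so `y` vanishes in `C ⊗ H(b)`. It vanishes in `ker
  -- d ⊗ H(b)` because `ker d` is a direct summand of `C`.
  have h3 : (boundaries b).mkQ.lTensor (ker d) y = 0 := by
    apply rTensor_subtype_injective (Homology b) d
    rw [← LinearMap.comp_apply, LinearMap.rTensor_comp_lTensor, ← LinearMap.lTensor_comp_rTensor,
      LinearMap.comp_apply, h2, ← LinearMap.comp_apply, LinearMap.lTensor,
      ← TensorProduct.map_comp, ← LinearMap.comp_assoc,
      (exact_boundaryIncl_mkQ b hb).linearMap_comp_eq_zero]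
    simp
  have h4 := congr_arg ((boundaries d).mkQ.rTensor (Homology b)) h3
  rw [← LinearMap.comp_apply, LinearMap.rTensor_comp_lTensor, map_zero, hy, map_sub,
    ← LinearMap.comp_apply, LinearMap.rTensor, ← TensorProduct.map_comp,
    (exact_boundaryIncl_mkQ d hd).linearMap_comp_eq_zero] at h4
  simpa using h4

/-- If the first homology module has no torsion with the second one, then each cycle of the tensor
product is homologous to a tensor product of cycles. -/
theorem exists_eq_map_subtype_add_tensorDiff [Module.Flat R C] [Module.Flat R (range d)]
    [Module.Flat R (ker d)]
    [Module.Projective R (range d)] [Module.Flat R D] [Module.Flat R (range b)]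
    [Module.Projective R (range b)]
    (hd : d ∘ₗ d = 0) (hb : b ∘ₗ b = 0) (hde : d ∘ₗ ε = - ε ∘ₗ d) (hee : ε ∘ₗ ε = LinearMap.id)
    (hTor : Function.Injective ((boundaryIncl b hb).lTensor (Homology d)))
    (t : C ⊗[R] D) (ht : tensorDiff d ε b t = 0) :
    ∃ (z : ker d ⊗[R] ker b) (w : C ⊗[R] D),
      t = TensorProduct.map (ker d).subtype (ker b).subtype z + tensorDiff d ε b w := by
  have hmap : TensorProduct.map d b t = 0 := by
    rw [← lTensor_tensorDiff (ε := ε) hb, ht, map_zero]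
  have hinjBB : Function.Injective
      (TensorProduct.map (range d).subtype (range b).subtype) := by
    rw [← LinearMap.lTensor_comp_rTensor]
    exact (Module.Flat.lTensor_preserves_injective_linearMap (M := C) _
      (Submodule.injective_subtype _)).comp
      (Module.Flat.rTensor_preserves_injective_linearMap (M := range b) _
      (Submodule.injective_subtype _))
  -- `q` is `(id ⊗ b) t` in `C ⊗ range b`. It is killed by `d`, hence comes from some `q'` in `ker d
  -- ⊗ range b`; the aim is to show that `q'` lies in `range d ⊗ range b`.
  set q := b.rangeRestrict.lTensor C t with hq
  have h0 : d.rangeRestrict.rTensor (range b) q = 0 := by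
    apply hinjBB
    rw [hq, ← LinearMap.comp_apply (LinearMap.rTensor _ _), LinearMap.rTensor_comp_lTensor,
      ← LinearMap.comp_apply, ← TensorProduct.map_comp, map_zero]
    exact hmap
  obtain ⟨q', hq'⟩ := (rTensor_exact (range b) (exact_subtype_rangeRestrict d)
    d.surjective_rangeRestrict q).1 h0
  -- Applying `ε ⊗ id` to the cycle condition gives `(id ⊗ b) t = -(ε d ⊗ id) t = (d ε ⊗ id) t`,
  -- which exhibits the first factor as a boundary.
  have h1 : (range b).subtype.lTensor (ker d) q' =
      TensorProduct.map (boundaryIncl d hd ∘ₗ d.rangeRestrict ∘ₗ ε) LinearMap.id t := by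
    apply rTensor_subtype_injective D d
    rw [← LinearMap.comp_apply, LinearMap.rTensor_comp_lTensor, ← LinearMap.lTensor_comp_rTensor,
      LinearMap.comp_apply, hq', hq, ← LinearMap.comp_apply, ← LinearMap.lTensor_comp,
      ← LinearMap.comp_apply, LinearMap.rTensor, ← TensorProduct.map_comp]
    have e1 : (range b).subtype ∘ₗ b.rangeRestrict = b := rfl
    have e2 : (ker d).subtype ∘ₗ boundaryIncl d hd ∘ₗ d.rangeRestrict ∘ₗ ε = d ∘ₗ ε := rfl
    rw [e1, e2, hde, LinearMap.comp_id]
    have := congr_arg (TensorProduct.map ε LinearMap.id) ht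
    rw [map_zero, tensorDiff, LinearMap.add_apply, map_add, LinearMap.rTensor,
      ← LinearMap.comp_apply, ← LinearMap.comp_apply, ← TensorProduct.map_comp,
      ← TensorProduct.map_comp, hee] at this
    simp only [LinearMap.comp_id, LinearMap.id_comp] at this
    rw [LinearMap.lTensor, eq_neg_of_add_eq_zero_right this]
    rw [← LinearMap.neg_apply]
    congr 1
    ext x y
    simp [TensorProduct.neg_tmul]
  -- By `h1` the image of `q'` in `H(d) ⊗ D` is zero. The passage back to `H(d) ⊗ range b` goes
  -- through `H(d) ⊗ ker b`, and its first stage is exactly the vanishing of torsion.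
  have h2 : (boundaries d).mkQ.rTensor (range b) q' = 0 := by
    apply hTor
    apply lTensor_subtype_injective (Homology d) b
    rw [← LinearMap.comp_apply (LinearMap.lTensor _ _) (LinearMap.lTensor _ _),
      ← LinearMap.lTensor_comp, subtype_comp_boundaryIncl, ← LinearMap.comp_apply,
      LinearMap.lTensor_comp_rTensor,
      ← LinearMap.rTensor_comp_lTensor, LinearMap.comp_apply, h1, ← LinearMap.comp_apply,
      LinearMap.rTensor, ← TensorProduct.map_comp, ← LinearMap.comp_assoc,
      (exact_boundaryIncl_mkQ d hd).linearMap_comp_eq_zero]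
    simp
  obtain ⟨q'', hq''⟩ := (rTensor_exact (range b) (exact_boundaryIncl_mkQ d hd)
    (Submodule.mkQ_surjective _) q').1 h2
  -- `w` satisfies `(d ⊗ b) w = (id ⊗ b) t`. As `id ⊗ b` of the boundary of `w` is `(d ⊗ b) w`,
  -- subtracting that boundary from `t` makes `id ⊗ b` vanish.
  obtain ⟨w, hw⟩ := TensorProduct.map_surjective d.surjective_rangeRestrict
    b.surjective_rangeRestrict q''
  have h3 : b.rangeRestrict.lTensor C (t - tensorDiff d ε b w) = 0 := by
    have inj := Module.Flat.lTensor_preserves_injective_linearMap (M := C) (range b).subtype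
      (Submodule.injective_subtype _)
    apply inj
    have e1 : ∀ x, (range b).subtype.lTensor C (b.rangeRestrict.lTensor C x) = b.lTensor C x := by
      intro x
      rw [← LinearMap.comp_apply, ← LinearMap.lTensor_comp]
      rfl
    rw [map_sub, ← hq, map_sub, e1, e1, lTensor_tensorDiff hb, ← e1 t, ← hq, ← hq',
      ← hq'', ← hw, map_zero]
    simp only [← LinearMap.comp_apply, LinearMap.rTensor, LinearMap.lTensor,
      ← TensorProduct.map_comp]
    rw [sub_eq_zero]
    rfl
  obtain ⟨s, hs⟩ := (lTensor_exact C (exact_subtype_rangeRestrict b)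
    b.surjective_rangeRestrict _).1 h3
  have h4 : d.rangeRestrict.rTensor (ker b) s = 0 := by
    have hinj : Function.Injective (TensorProduct.map (range d).subtype (ker b).subtype) := by
      rw [← LinearMap.rTensor_comp_lTensor]
      exact (Module.Flat.rTensor_preserves_injective_linearMap (M := D) _
        (Submodule.injective_subtype _)).comp
        (Module.Flat.lTensor_preserves_injective_linearMap (M := range d) _
        (Submodule.injective_subtype _))
    apply hinj
    -- The corrected element is still a cycle and its `ε ⊗ b` part vanishes, so the other part `d ⊗
    -- id` of the differential vanishes too. It is thus a cycle in each factor separately.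
    have e1 : d.rTensor D (t - tensorDiff d ε b w) = 0 := by
      have e2 : TensorProduct.map ε b (t - tensorDiff d ε b w) = 0 := by
        have e3 : TensorProduct.map ε b =
            TensorProduct.map ε (range b).subtype ∘ₗ b.rangeRestrict.lTensor C := by
          rw [LinearMap.lTensor, ← TensorProduct.map_comp]; rfl
        rw [e3, LinearMap.comp_apply, h3, map_zero]
      have e4 : tensorDiff d ε b (t - tensorDiff d ε b w) = 0 := by
        rw [map_sub, ht, zero_sub, neg_eq_zero]
        rw [tensorDiff, LinearMap.add_apply, ← tensorDiff, rTensor_tensorDiff hd hde]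
        have : TensorProduct.map ε b = ε.rTensor D ∘ₗ b.lTensor C := by
          rw [LinearMap.rTensor_comp_lTensor]
        rw [this, LinearMap.comp_apply, lTensor_tensorDiff hb, ← LinearMap.comp_apply,
          LinearMap.rTensor, ← TensorProduct.map_comp]
        simp
      rwa [tensorDiff, LinearMap.add_apply, ← tensorDiff, e2, add_zero] at e4
    rw [← hs, ← LinearMap.comp_apply, LinearMap.rTensor_comp_lTensor] at e1
    rw [map_zero, ← e1, ← LinearMap.comp_apply, LinearMap.rTensor, ← TensorProduct.map_comp]
    rfl
  obtain ⟨z, hz⟩ := (rTensor_exact (ker b) (exact_subtype_rangeRestrict d)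
    d.surjective_rangeRestrict s).1 h4
  refine ⟨z, w, ?_⟩
  rw [← LinearMap.lTensor_comp_rTensor, LinearMap.comp_apply, hz, hs, sub_add_cancel]

end Tensor

end DiffModule
end

open scoped ZeroObject

noncomputable section

/-! ### The first derived functor and projective presentations -/

namespace CategoryTheory.ShortComplex

variable {C : Type*} [Category* C] [Abelian C] (S : ShortComplex C)

/-- The objects of the complex `0 ⟶ S.X₁ ⟶ S.X₂`. -/
def twoTermX : ℕ → C
  | 0 => S.X₂
  | 1 => S.X₁
  | _ + 2 => 0

/-- The differentials of the complex `0 ⟶ S.X₁ ⟶ S.X₂`. -/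
def twoTermD : ∀ n : ℕ, S.twoTermX (n + 1) ⟶ S.twoTermX n
  | 0 => S.f
  | 1 => 0
  | _ + 2 => 0

/-- The complex `0 ⟶ S.X₁ ⟶ S.X₂`. -/
def twoTerm : ChainComplex C ℕ :=
  ChainComplex.of S.twoTermX S.twoTermD (by rintro (_ | _ | n) <;> exact zero_comp)

lemma twoTerm_d_one_zero : S.twoTerm.d 1 0 = S.f :=
  ChainComplex.of_d S.twoTermX S.twoTermD 0

lemma twoTerm_exactAt_succ (hS : S.ShortExact) (n : ℕ) : S.twoTerm.ExactAt (n + 1) := by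
  rw [HomologicalComplex.exactAt_iff' _ (n + 2) (n + 1) n (by simp) (by simp)]
  cases n with
  | zero =>
    have := hS.mono_f
    have hm : Mono (S.twoTerm.d 1 0) := by rw [twoTerm_d_one_zero]; exact hS.mono_f
    refine (ShortComplex.exact_iff_mono _ ?_).2 hm
    exact IsZero.eq_of_src (X := S.twoTerm.X 2) (isZero_zero C) _ _
  | succ n => exact ShortComplex.exact_of_isZero_X₂ _ (by exact isZero_zero C)

/-- A short exact sequence with projective first terms, as a projective resolution of the last
term. -/
def ShortExact.projectiveResolution {S : ShortComplex C} (hS : S.ShortExact) [h₁ : Projective S.X₁]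
    [h₂ : Projective S.X₂] : ProjectiveResolution S.X₃ where
  complex := S.twoTerm
  projective := by
    rintro (_ | _ | n)
    · exact h₂
    · exact h₁
    · exact inferInstanceAs (Projective (0 : C))
  π := (ChainComplex.toSingle₀Equiv _ _).symm ⟨S.g, by rw [twoTerm_d_one_zero]; exact S.zero⟩
  quasiIso := ⟨fun n => by
    cases n
    · rw [ChainComplex.quasiIsoAt₀_iff, ShortComplex.quasiIso_iff_of_zeros']
      · refine (ShortComplex.exact_and_epi_g_iff_of_iso ?_).2 ⟨hS.exact, hS.epi_g⟩
        exact ShortComplex.isoMk (Iso.refl _) (Iso.refl _) (Iso.refl _)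
          ((Category.id_comp S.f).trans
            (S.twoTerm_d_one_zero.symm.trans (Category.comp_id (S.twoTerm.d 1 0)).symm))
          ((Category.id_comp S.g).trans ((ChainComplex.toSingle₀Equiv_symm_apply_f_zero
            (C := S.twoTerm) S.g _).symm.trans (Category.comp_id _).symm))
      all_goals rfl
    · rw [quasiIsoAt_iff_exactAt']
      · exact S.twoTerm_exactAt_succ hS _
      · apply ChainComplex.exactAt_succ_single_obj⟩

/-- Computed with the resolution `0 → S.X₁ → S.X₂`, the first derived functor at `S.X₃` is the
homology in degree one of `0 → F S.X₁ → F S.X₂`, that is, the kernel of `F.map S.f`. -/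
lemma ShortExact.mono_map_f_of_isZero_leftDerived {D : Type*} [Category* D] [Abelian D]
    [HasProjectiveResolutions C]
    {S : ShortComplex C} (hS : S.ShortExact) [Projective S.X₁] [Projective S.X₂]
    (F : C ⥤ D) [F.Additive] (h : IsZero ((F.leftDerived 1).obj S.X₃)) : Mono (F.map S.f) := by
  have h1 := h.of_iso (hS.projectiveResolution.isoLeftDerivedObj F 1).symm
  let K := (F.mapHomologicalComplex (ComplexShape.down ℕ)).obj S.twoTerm
  have h2 : K.ExactAt 1 := (HomologicalComplex.exactAt_iff_isZero_homology _ _).2 h1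
  rw [HomologicalComplex.exactAt_iff' _ 2 1 0 (by simp) (by simp)] at h2
  have h3 : Mono (K.d 1 0) := (ShortComplex.exact_iff_mono _
    (IsZero.eq_of_src (X := K.X 2) (F.map_isZero (isZero_zero C)) _ _)).1 h2
  have h4 : K.d 1 0 = F.map S.f := by
    change F.map (S.twoTerm.d 1 0) = _
    rw [twoTerm_d_one_zero]
    rfl
  rwa [h4] at h3

end CategoryTheory.ShortComplex

/-- The form in which vanishing torsion is consumed: later `K` and `P` are the boundaries and cycles
of a complex of projectives and `B` is its homology. -/
lemma lTensor_injective_of_isZero_torOne {R : Type} [CommRing R] {A B : ModuleCat.{u} R}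
    (h : IsZero (torOne A B)) {K P : Type u} [AddCommGroup K] [Module R K] [AddCommGroup P]
    [Module R P] [Module.Projective R K] [Module.Projective R P] (f : K →ₗ[R] P) (g : P →ₗ[R] B)
    (hf : Function.Injective f) (hfg : Function.Exact f g) (hg : Function.Surjective g) :
    Function.Injective (f.lTensor A) := by
  let S : ShortComplex (ModuleCat.{u} R) :=
    ShortComplex.mk (ModuleCat.ofHom f) (ModuleCat.ofHom g)
      (by ext x; exact hfg.apply_apply_eq_zero x)
  have hS : S.ShortExact :=
    { exact := (ShortComplex.ShortExact.moduleCat_exact_iff_function_exact S).2 hfg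
      mono_f := (ModuleCat.mono_iff_injective _).2 hf
      epi_g := (ModuleCat.epi_iff_surjective _).2 hg }
  have : Projective S.X₁ := (IsProjective.iff_projective (R := R) K).1 inferInstance
  have : Projective S.X₂ := (IsProjective.iff_projective (R := R) P).1 inferInstance
  exact (ModuleCat.mono_iff_injective _).1
    (hS.mono_map_f_of_isZero_leftDerived (tensorFunctor A) h)

end

noncomputable section

/-! ### Tensor products of chain complexes -/

namespace ChainComplex

open DiffModule TensorProduct LinearMap

variable {R : Type} [CommRing R]

section Total

variable (K : ChainComplex (ModuleCat.{u} R) ℕ)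

/-- The direct sum of the terms of a chain complex. -/
abbrev Total : Type u := ⨁ n, K.X n

/-- The inclusion of a term in the direct sum. -/
abbrev inTotal (n : ℕ) : K.X n →ₗ[R] Total K := DirectSum.lof R ℕ (fun n => K.X n) n

/-- The differential on the direct sum of the terms of a chain complex. -/
def totalD : Total K →ₗ[R] Total K :=
  DirectSum.toModule R ℕ _ fun n => inTotal K (n - 1) ∘ₗ (K.d n (n - 1)).hom

/-- The sign involution on the direct sum of the terms of a chain complex. -/
def totalSign : Total K →ₗ[R] Total K :=
  DirectSum.toModule R ℕ _ fun n => (-1 : R) ^ n • inTotal K n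

variable {K}

@[simp]
lemma totalD_inTotal (n : ℕ) (x : K.X n) :
    totalD K (inTotal K n x) = inTotal K (n - 1) ((K.d n (n - 1)).hom x) := by
  simp [totalD, DirectSum.toModule_lof]

@[simp]
lemma totalSign_inTotal (n : ℕ) (x : K.X n) :
    totalSign K (inTotal K n x) = (-1 : R) ^ n • inTotal K n x := by
  simp [totalSign, DirectSum.toModule_lof]

/-- Nothing lies below degree zero. This makes the truncated index `n - 1` in `totalD` harmless at
`n = 0`, where it is `0` again. -/
lemma d_zero_apply (x : K.X 0) (j : ℕ) : (K.d 0 j).hom x = 0 := by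
  rw [K.shape 0 j (by simp)]; rfl

lemma d_d_apply (i j k : ℕ) (x : K.X i) : (K.d j k).hom ((K.d i j).hom x) = 0 := by
  rw [← LinearMap.comp_apply, ← ModuleCat.hom_comp, K.d_comp_d]; rfl

variable (K)

lemma totalD_comp_totalD : totalD K ∘ₗ totalD K = 0 := by
  refine DirectSum.linearMap_ext R fun n => LinearMap.ext fun x => ?_
  simp only [LinearMap.comp_apply, totalD_inTotal, d_d_apply, map_zero, LinearMap.zero_apply]

/-- The differential changes the degree by one, hence the parity. This is the hypothesis on `ε` in
the Künneth argument for differential modules. -/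
lemma totalD_comp_totalSign : totalD K ∘ₗ totalSign K = - totalSign K ∘ₗ totalD K := by
  refine DirectSum.linearMap_ext R fun n => LinearMap.ext fun x => ?_
  simp only [LinearMap.comp_apply, totalD_inTotal, totalSign_inTotal, map_smul,
    LinearMap.neg_apply]
  cases n with
  | zero => simp
  | succ n => simp [pow_succ]

lemma totalSign_comp_totalSign : totalSign K ∘ₗ totalSign K = LinearMap.id := by
  refine DirectSum.linearMap_ext R fun n => LinearMap.ext fun x => ?_
  simp only [LinearMap.comp_apply, totalSign_inTotal, map_smul, smul_smul, LinearMap.id_apply,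
    ← mul_pow]
  simp

lemma component_totalD (n : ℕ) (x : Total K) :
    DirectSum.component R ℕ (fun n => K.X n) n (totalD K x) =
      (K.d (n + 1) n).hom (DirectSum.component R ℕ (fun n => K.X n) (n + 1) x) := by
  suffices h : DirectSum.component R ℕ (fun n => K.X n) n ∘ₗ totalD K =
      (K.d (n + 1) n).hom ∘ₗ DirectSum.component R ℕ (fun n => K.X n) (n + 1) from
    LinearMap.congr_fun h x
  refine DirectSum.linearMap_ext R fun m => LinearMap.ext fun x => ?_
  simp only [LinearMap.comp_apply, totalD_inTotal]
  cases m with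
  | zero =>
    rw [d_zero_apply, map_zero, map_zero, DirectSum.component.of, dif_neg (by simp), map_zero]
  | succ m =>
    rw [DirectSum.component.of, DirectSum.component.of]
    by_cases h : m = n
    · subst h; simp
    · rw [dif_neg (by simpa using h), dif_neg (by simpa using h), map_zero]

end Total

section Tensor

variable (K L : ChainComplex (ModuleCat.{u} R) ℕ)

/-- The terms of the tensor product of two chain complexes. -/
abbrev TensorX (n : ℕ) : Type u :=
  ⨁ p : {p : ℕ × ℕ // p.1 + p.2 = n}, K.X p.1.1 ⊗[R] L.X p.1.2

/-- The inclusion of a summand of a term of the tensor product. -/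
abbrev inTensor {n : ℕ} (a b : ℕ) (h : a + b = n) : K.X a ⊗[R] L.X b →ₗ[R] TensorX K L n :=
  DirectSum.lof R {p : ℕ × ℕ // p.1 + p.2 = n} (fun p => K.X p.1.1 ⊗[R] L.X p.1.2) ⟨(a, b), h⟩

/-- The inclusion of a term of the tensor product complex in the tensor product of the totals. -/
def tensorIncl (n : ℕ) : TensorX K L n →ₗ[R] Total K ⊗[R] Total L :=
  DirectSum.toModule R _ _ fun p => TensorProduct.map (inTotal K p.1.1) (inTotal L p.1.2)

/-- The projection of the tensor product of the totals to a term of the tensor product complex. -/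
def tensorProj (n : ℕ) : Total K ⊗[R] Total L →ₗ[R] TensorX K L n :=
  TensorProduct.lift (DirectSum.toModule R ℕ _ fun a => LinearMap.flip
    (DirectSum.toModule R ℕ _ fun b => LinearMap.flip
      (if h : a + b = n then (TensorProduct.mk R (K.X a) (L.X b)).compr₂ (inTensor K L a b h)
        else 0)))

variable {K L}

lemma tensorIncl_inTensor {n : ℕ} (a b : ℕ) (h : a + b = n) (t : K.X a ⊗[R] L.X b) :
    tensorIncl K L n (inTensor K L a b h t) =
      TensorProduct.map (inTotal K a) (inTotal L b) t := by
  simp [tensorIncl, DirectSum.toModule_lof]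

lemma tensorProj_tmul (n a b : ℕ) (x : K.X a) (y : L.X b) :
    tensorProj K L n (inTotal K a x ⊗ₜ inTotal L b y) =
      if h : a + b = n then inTensor K L a b h (x ⊗ₜ y) else 0 := by
  simp only [tensorProj, TensorProduct.lift.tmul, DirectSum.toModule_lof, LinearMap.flip_apply]
  split_ifs <;> rfl

lemma total_tensor_ext {M : Type*} [AddCommGroup M] [Module R M]
    {f g : Total K ⊗[R] Total L →ₗ[R] M}
    (h : ∀ a b (x : K.X a) (y : L.X b),
      f (inTotal K a x ⊗ₜ inTotal L b y) = g (inTotal K a x ⊗ₜ inTotal L b y)) : f = g := by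
  refine TensorProduct.ext (DirectSum.linearMap_ext R fun a => LinearMap.ext fun x =>
    DirectSum.linearMap_ext R fun b => LinearMap.ext fun y => h a b x y)

lemma tensorX_ext {n : ℕ} {M : Type*} [AddCommGroup M] [Module R M] {f g : TensorX K L n →ₗ[R] M}
    (h : ∀ a b (hab : a + b = n) (x : K.X a) (y : L.X b),
      f (inTensor K L a b hab (x ⊗ₜ y)) = g (inTensor K L a b hab (x ⊗ₜ y))) : f = g := by
  refine DirectSum.linearMap_ext R fun p => TensorProduct.ext' fun x y => ?_
  exact h p.1.1 p.1.2 p.2 x y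

lemma tensorIncl_tensorProj_tmul (n a b : ℕ) (x : K.X a) (y : L.X b) :
    tensorIncl K L n (tensorProj K L n (inTotal K a x ⊗ₜ inTotal L b y)) =
      if a + b = n then inTotal K a x ⊗ₜ inTotal L b y else 0 := by
  rw [tensorProj_tmul]
  split_ifs
  · rw [tensorIncl_inTensor, TensorProduct.map_tmul]
  · rw [map_zero]

lemma tensorProj_tensorIncl (n : ℕ) (t : TensorX K L n) :
    tensorProj K L n (tensorIncl K L n t) = t := by
  suffices h : tensorProj K L n ∘ₗ tensorIncl K L n = LinearMap.id from LinearMap.congr_fun h t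
  refine tensorX_ext fun a b hab x y => ?_
  simp only [LinearMap.comp_apply]
  rw [tensorIncl_inTensor, TensorProduct.map_tmul, tensorProj_tmul, dif_pos hab]
  rfl

variable (K L) in
/-- The differential of the tensor product of the totals. -/
abbrev totalTensorD : Total K ⊗[R] Total L →ₗ[R] Total K ⊗[R] Total L :=
  tensorDiff (totalD K) (totalSign K) (totalD L)

lemma totalTensorD_tmul (a b : ℕ) (x : K.X a) (y : L.X b) :
    totalTensorD K L (inTotal K a x ⊗ₜ inTotal L b y) =
      inTotal K (a - 1) ((K.d a (a - 1)).hom x) ⊗ₜ inTotal L b y +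
        (-1 : R) ^ a • (inTotal K a x ⊗ₜ inTotal L (b - 1) ((L.d b (b - 1)).hom y)) := by
  simp only [totalTensorD, tensorDiff, LinearMap.add_apply, LinearMap.rTensor_tmul,
    TensorProduct.map_tmul, totalD_inTotal, totalSign_inTotal, TensorProduct.smul_tmul']

lemma totalTensorD_comp_self (t : Total K ⊗[R] Total L) :
    totalTensorD K L (totalTensorD K L t) = 0 := by
  suffices h : totalTensorD K L ∘ₗ totalTensorD K L = 0 from LinearMap.congr_fun h t
  refine total_tensor_ext fun a b x y => ?_
  simp only [LinearMap.comp_apply, totalTensorD_tmul, map_add, map_smul, d_d_apply, map_zero,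
    TensorProduct.zero_tmul, TensorProduct.tmul_zero, smul_zero, add_zero, zero_add,
    LinearMap.zero_apply]
  cases a with
  | zero => simp
  | succ a =>
    rw [Nat.add_sub_cancel, ← add_smul, pow_succ]
    simp

/-- The differential lowers total degree by one, so it intertwines the projections on homogeneous
parts. Computations in the tensor product complex can therefore be done in the tensor product of the
totals. -/
lemma tensorIncl_tensorProj_totalTensorD (n : ℕ) (t : Total K ⊗[R] Total L) :
    tensorIncl K L n (tensorProj K L n (totalTensorD K L t)) =
      totalTensorD K L (tensorIncl K L (n + 1) (tensorProj K L (n + 1) t)) := by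
  suffices h : tensorIncl K L n ∘ₗ tensorProj K L n ∘ₗ totalTensorD K L =
      totalTensorD K L ∘ₗ tensorIncl K L (n + 1) ∘ₗ tensorProj K L (n + 1) from
    LinearMap.congr_fun h t
  refine total_tensor_ext fun a b x y => ?_
  simp only [LinearMap.comp_apply]
  rw [tensorIncl_tensorProj_tmul, totalTensorD_tmul, map_add, map_add, map_smul, map_smul,
    tensorIncl_tensorProj_tmul, tensorIncl_tensorProj_tmul, apply_ite (totalTensorD K L),
    map_zero, totalTensorD_tmul]
  -- For `a = 0` the two conditions differ because of truncated subtraction, but the differential is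
  -- then zero.
  have h1 : (if a - 1 + b = n then
      inTotal K (a - 1) ((K.d a (a - 1)).hom x) ⊗ₜ[R] inTotal L b y else 0) =
      if a + b = n + 1 then
      inTotal K (a - 1) ((K.d a (a - 1)).hom x) ⊗ₜ[R] inTotal L b y else 0 := by
    cases a with
    | zero => simp
    | succ a => exact if_congr (by omega) rfl rfl
  have h2 : (if a + (b - 1) = n then
      inTotal K a x ⊗ₜ[R] inTotal L (b - 1) ((L.d b (b - 1)).hom y) else 0) =
      if a + b = n + 1 then
      inTotal K a x ⊗ₜ[R] inTotal L (b - 1) ((L.d b (b - 1)).hom y) else 0 := by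
    cases b with
    | zero => simp
    | succ b => exact if_congr (by omega) rfl rfl
  rw [h1, h2]
  split_ifs <;> simp

variable (K L) in
/-- The differential of the tensor product complex. -/
def tensorXD (n : ℕ) : TensorX K L (n + 1) →ₗ[R] TensorX K L n :=
  tensorProj K L n ∘ₗ totalTensorD K L ∘ₗ tensorIncl K L (n + 1)

lemma tensorIncl_tensorXD (n : ℕ) (t : TensorX K L (n + 1)) :
    tensorIncl K L n (tensorXD K L n t) = totalTensorD K L (tensorIncl K L (n + 1) t) := by
  simp only [tensorXD, LinearMap.comp_apply]
  rw [tensorIncl_tensorProj_totalTensorD, tensorProj_tensorIncl]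

lemma tensorXD_tensorProj (n : ℕ) (t : Total K ⊗[R] Total L) :
    tensorXD K L n (tensorProj K L (n + 1) t) = tensorProj K L n (totalTensorD K L t) := by
  simp only [tensorXD, LinearMap.comp_apply]
  rw [← tensorIncl_tensorProj_totalTensorD, tensorProj_tensorIncl]

lemma tensorIncl_injective (n : ℕ) : Function.Injective (tensorIncl K L n) :=
  Function.LeftInverse.injective (tensorProj_tensorIncl n)

variable (K L) in
/-- The tensor product of two chain complexes. -/
def tensorComplex : ChainComplex (ModuleCat.{u} R) ℕ :=
  ChainComplex.of (fun n => ModuleCat.of R (TensorX K L n))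
    (fun n => ModuleCat.ofHom (tensorXD K L n)) (fun n => by
      refine ModuleCat.hom_ext (LinearMap.ext fun (t : TensorX K L (n + 2)) => ?_)
      apply tensorIncl_injective (K := K) (L := L) n
      change tensorIncl K L n (tensorXD K L n (tensorXD K L (n + 1) t)) = tensorIncl K L n 0
      rw [tensorIncl_tensorXD, tensorIncl_tensorXD, totalTensorD_comp_self, map_zero])

lemma tensorComplex_d (n : ℕ) :
    (tensorComplex K L).d (n + 1) n = ModuleCat.ofHom (tensorXD K L n) :=
  ChainComplex.of_d (fun n => ModuleCat.of R (TensorX K L n))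
    (fun n => ModuleCat.ofHom (tensorXD K L n)) n

section Map

variable {K' L' : ChainComplex (ModuleCat.{u} R) ℕ} (f : K ⟶ K') (g : L ⟶ L')

/-- The map induced on the totals by a morphism of chain complexes. -/
def totalMap : Total K →ₗ[R] Total K' := DirectSum.lmap fun n => (f.f n).hom

@[simp]
lemma totalMap_inTotal (n : ℕ) (x : K.X n) :
    totalMap f (inTotal K n x) = inTotal K' n ((f.f n).hom x) :=
  DirectSum.lmap_lof _ _ _

lemma comm_apply (i j : ℕ) (x : K.X i) :
    (f.f j).hom ((K.d i j).hom x) = (K'.d i j).hom ((f.f i).hom x) := by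
  rw [← LinearMap.comp_apply, ← ModuleCat.hom_comp, ← f.comm, ModuleCat.hom_comp,
    LinearMap.comp_apply]

/-- The map induced on the terms of the tensor product by morphisms of chain complexes. -/
def tensorXMap (n : ℕ) : TensorX K L n →ₗ[R] TensorX K' L' n :=
  DirectSum.lmap fun p => TensorProduct.map (f.f p.1.1).hom (g.f p.1.2).hom

@[simp]
lemma tensorXMap_inTensor {n : ℕ} (a b : ℕ) (h : a + b = n) (t : K.X a ⊗[R] L.X b) :
    tensorXMap f g n (inTensor K L a b h t) =
      inTensor K' L' a b h (TensorProduct.map (f.f a).hom (g.f b).hom t) :=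
  DirectSum.lmap_lof _ _ _

lemma tensorIncl_tensorXMap (n : ℕ) (t : TensorX K L n) :
    tensorIncl K' L' n (tensorXMap f g n t) =
      TensorProduct.map (totalMap f) (totalMap g) (tensorIncl K L n t) := by
  suffices h : tensorIncl K' L' n ∘ₗ tensorXMap f g n =
    TensorProduct.map (totalMap f) (totalMap g) ∘ₗ tensorIncl K L n from LinearMap.congr_fun h t
  refine tensorX_ext fun a b hab x y => ?_
  simp only [LinearMap.comp_apply]
  rw [tensorXMap_inTensor, tensorIncl_inTensor, tensorIncl_inTensor]
  simp only [TensorProduct.map_tmul, totalMap_inTotal]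

lemma totalTensorD_map (t : Total K ⊗[R] Total L) :
    totalTensorD K' L' (TensorProduct.map (totalMap f) (totalMap g) t) =
      TensorProduct.map (totalMap f) (totalMap g) (totalTensorD K L t) := by
  suffices h : totalTensorD K' L' ∘ₗ TensorProduct.map (totalMap f) (totalMap g) =
    TensorProduct.map (totalMap f) (totalMap g) ∘ₗ totalTensorD K L from LinearMap.congr_fun h t
  refine total_tensor_ext fun a b x y => ?_
  simp only [LinearMap.comp_apply, TensorProduct.map_tmul, totalMap_inTotal, totalTensorD_tmul,
    map_add, map_smul, comm_apply]

/-- The morphism of tensor product complexes induced by morphisms of chain complexes. -/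
def tensorComplexMap : tensorComplex K L ⟶ tensorComplex K' L' where
  f n := ModuleCat.ofHom (tensorXMap f g n)
  comm' i j hij := by
    obtain rfl : j + 1 = i := hij
    rw [tensorComplex_d, tensorComplex_d]
    refine ModuleCat.hom_ext (LinearMap.ext fun (t : TensorX K L (j + 1)) => ?_)
    apply tensorIncl_injective (K := K') (L := L') j
    change tensorIncl K' L' j (tensorXD K' L' j (tensorXMap f g (j + 1) t)) =
      tensorIncl K' L' j (tensorXMap f g j (tensorXD K L j t))
    rw [tensorIncl_tensorXD, tensorIncl_tensorXMap, tensorIncl_tensorXMap, tensorIncl_tensorXD,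
      totalTensorD_map]

end Map

end Tensor

end ChainComplex

end

noncomputable section

/-! ### Künneth formula -/

section Descend

variable {R : Type*} [CommRing R] {A B C : Type*} [AddCommGroup A] [Module R A] [AddCommGroup B]
  [Module R B] [AddCommGroup C] [Module R C]

/-- The map induced on the target of a surjective map by a map vanishing on its kernel. -/
def LinearMap.descend (p : A →ₗ[R] B) (hp : Function.Surjective p) (f : A →ₗ[R] C)
    (h : ∀ a, p a = 0 → f a = 0) : B →ₗ[R] C :=
  (LinearMap.ker p).liftQ f h ∘ₗ (p.quotKerEquivOfSurjective hp).symm.toLinearMap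

@[simp]
lemma LinearMap.descend_apply (p : A →ₗ[R] B) (hp : Function.Surjective p) (f : A →ₗ[R] C)
    (h : ∀ a, p a = 0 → f a = 0) (a : A) : p.descend hp f h (p a) = f a := by
  have : (p.quotKerEquivOfSurjective hp).symm (p a) = (LinearMap.ker p).mkQ a := by
    rw [LinearEquiv.symm_apply_eq]; rfl
  rw [LinearMap.descend, LinearMap.comp_apply, LinearEquiv.coe_coe, this]
  rfl

/-- Both families are locally finite decompositions of the identity, so `x` is a finite sum of its
images under `φ i ⊗ ψ j`. This allows degreewise arguments on the homology of a total without an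
explicit direct sum decomposition. -/
lemma TensorProduct.eq_zero_of_forall_map_eq_zero {M N : Type*} [AddCommGroup M] [Module R M]
    [AddCommGroup N] [Module R N] (φ : ℕ → M →ₗ[R] M) (ψ : ℕ → N →ₗ[R] N)
    (hφ : ∀ m, ∃ N₀, ∀ n ≥ N₀, (∑ i ∈ Finset.range n, φ i) m = m)
    (hψ : ∀ m, ∃ N₀, ∀ n ≥ N₀, (∑ i ∈ Finset.range n, ψ i) m = m) (x : M ⊗[R] N)
    (hx : ∀ i j, TensorProduct.map (φ i) (ψ j) x = 0) : x = 0 := by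
  have key : ∀ x : M ⊗[R] N, ∃ N₀, ∀ n ≥ N₀, TensorProduct.map (∑ i ∈ Finset.range n, φ i)
      (∑ i ∈ Finset.range n, ψ i) x = x := by
    intro x
    induction x with
    | zero => exact ⟨0, fun n _ => map_zero _⟩
    | add x y hx hy =>
      obtain ⟨a, ha⟩ := hx
      obtain ⟨b, hb⟩ := hy
      refine ⟨max a b, fun n hn => ?_⟩
      rw [map_add, ha n (le_trans (le_max_left _ _) hn), hb n (le_trans (le_max_right _ _) hn)]
    | tmul m y =>
      obtain ⟨a, ha⟩ := hφ m
      obtain ⟨b, hb⟩ := hψ y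
      refine ⟨max a b, fun n hn => ?_⟩
      rw [TensorProduct.map_tmul, ha n (le_trans (le_max_left _ _) hn),
        hb n (le_trans (le_max_right _ _) hn)]
  obtain ⟨N₀, hN⟩ := key x
  rw [← hN N₀ le_rfl, ← TensorProduct.mapBilinear_apply]
  simp only [map_sum, LinearMap.sum_apply, TensorProduct.mapBilinear_apply, hx,
    Finset.sum_const_zero]

end Descend

namespace ChainComplex

open DiffModule TensorProduct LinearMap

variable {R : Type} [CommRing R]

section Classes

variable (K : ChainComplex (ModuleCat.{u} R) ℕ)

/-- The cycles of degree `n`, as a submodule of the chains. -/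
abbrev cyc (n : ℕ) : Submodule R (K.X n) := ker (K.d n (n - 1)).hom

/-- The homology class of a cycle. -/
def cls (n : ℕ) : cyc K n →ₗ[R] K.homology n :=
  (K.liftCycles (ModuleCat.ofHom (cyc K n).subtype) (n - 1)
    (by cases n <;> simp) (by ext x; exact x.2) ≫ K.homologyπ n).hom

variable {K}

lemma cls_surjective (n : ℕ) : Function.Surjective (cls K n) := by
  intro h
  obtain ⟨c, rfl⟩ := (ModuleCat.epi_iff_surjective (K.homologyπ n)).1 inferInstance h
  have hc : K.iCycles n c ∈ cyc K n := by
    change (K.iCycles n ≫ K.d n (n - 1)).hom c = 0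
    rw [K.iCycles_d]; rfl
  refine ⟨⟨K.iCycles n c, hc⟩, ?_⟩
  rw [cls, ModuleCat.hom_comp, LinearMap.comp_apply]
  congr 1
  apply (ModuleCat.mono_iff_injective (K.iCycles n)).1 inferInstance
  change (K.liftCycles _ _ _ _ ≫ K.iCycles n).hom _ = _
  rw [K.liftCycles_i]
  rfl

lemma iCycles_liftCycles_apply {n : ℕ} (z : cyc K n) (h h') :
    (K.iCycles n).hom ((K.liftCycles (ModuleCat.ofHom (cyc K n).subtype) (n - 1) h h').hom z) =
      z.1 := by
  change (K.liftCycles _ _ _ _ ≫ K.iCycles n).hom _ = _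
  rw [K.liftCycles_i]
  rfl

/-- Together with `cls_surjective` this presents homology as cycles modulo boundaries; the arguments
on elements below use only this presentation. -/
lemma cls_eq_zero_iff {n : ℕ} (z : cyc K n) :
    cls K n z = 0 ↔ ∃ w : K.X (n + 1), (K.d (n + 1) n).hom w = z.1 := by
  have hex := (ShortComplex.ShortExact.moduleCat_exact_iff_function_exact
    (ShortComplex.mk (K.toCycles (n + 1) n) (K.homologyπ n) (by simp))).1
    (ShortComplex.exact_of_g_is_cokernel _ (K.homologyIsCokernel (n + 1) n (by simp)))
  rw [cls, ModuleCat.hom_comp, LinearMap.comp_apply]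
  constructor
  · intro h
    obtain ⟨w, hw⟩ := (hex _).1 h
    refine ⟨w, ?_⟩
    rw [← iCycles_liftCycles_apply z (by cases n <;> simp) (by ext x; exact x.2)]
    erw [← hw]
    change _ = (K.toCycles (n + 1) n ≫ K.iCycles n).hom w
    rw [K.toCycles_i]
  · rintro ⟨w, hw⟩
    refine (hex _).2 ⟨w, ?_⟩
    apply (ModuleCat.mono_iff_injective (K.iCycles n)).1 inferInstance
    erw [iCycles_liftCycles_apply]
    rw [← hw]
    change (K.toCycles (n + 1) n ≫ K.iCycles n).hom w = _
    rw [K.toCycles_i]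

variable {L : ChainComplex (ModuleCat.{u} R) ℕ} (f : K ⟶ L)

/-- The map on cycles induced by a morphism of chain complexes. -/
def cycMap (n : ℕ) : cyc K n →ₗ[R] cyc L n :=
  (f.f n).hom.restrict fun x hx => by
    rw [LinearMap.mem_ker, ← comm_apply, LinearMap.mem_ker.1 hx, map_zero]

lemma homologyMap_cls {n : ℕ} (z : cyc K n) :
    (HomologicalComplex.homologyMap f n).hom (cls K n z) = cls L n (cycMap f n z) := by
  rw [cls, cls, ModuleCat.hom_comp, ModuleCat.hom_comp, LinearMap.comp_apply, LinearMap.comp_apply,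
    ← LinearMap.comp_apply, ← ModuleCat.hom_comp, HomologicalComplex.homologyπ_naturality,
    ModuleCat.hom_comp, LinearMap.comp_apply]
  congr 1
  apply (ModuleCat.mono_iff_injective (L.iCycles n)).1 inferInstance
  erw [iCycles_liftCycles_apply]
  change (K.liftCycles _ _ _ _ ≫ HomologicalComplex.cyclesMap f n ≫ L.iCycles n).hom _ = _
  rw [HomologicalComplex.cyclesMap_i, K.liftCycles_i_assoc]
  rfl

end Classes

end ChainComplex

end

/-! ### Hereditary rings, and projectivity of subgroups of projective abelian groups. -/

noncomputable section

/-- A ring is hereditary if submodules of projective modules are projective. -/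
class IsHereditaryRing (R : Type*) [Ring R] : Prop where
  projective_submodule {F : Type u} [AddCommGroup F] [Module R F] [Module.Projective R F]
    (N : Submodule R F) : Module.Projective R N

attribute [instance] IsHereditaryRing.projective_submodule

/-- Quotients of divisible groups are divisible, hence injective, and this dualizes to subgroups of
projectives. A free cover `p` of `N` is embedded in a divisible group `Q`; the resulting map from
`N` to a quotient of `Q` extends to `F` by injectivity and lifts to `Q` by projectivity of `F`. -/
lemma Submodule.projective_int {F : Type*} [AddCommGroup F] [Module.Projective ℤ F]
    (N : Submodule ℤ F) : Module.Projective ℤ N := by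
  refine Module.Projective.of_lifting_property'' fun p hp => ?_
  -- A product of copies of `ℚ/ℤ`, one for each character; characters separate points, so the
  -- evaluation `i` is an embedding.
  let Q := CharacterModule (N →₀ ℤ) → AddCircle (1 : ℚ)
  let i : (N →₀ ℤ) →ₗ[ℤ] Q :=
    LinearMap.pi fun c : CharacterModule (N →₀ ℤ) =>
      (c : (N →₀ ℤ) →+ AddCircle (1 : ℚ)).toIntLinearMap
  have hi : Function.Injective i := by
    rw [injective_iff_map_eq_zero]
    intro x hx
    exact CharacterModule.eq_zero_of_character_apply fun c => congr_fun hx c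
  let S : Submodule ℤ Q := (LinearMap.ker p).map i
  have : DivisibleBy (Q ⧸ S) ℤ :=
    Function.Surjective.divisibleBy (α := ℤ) S.mkQ S.mkQ_surjective (fun a n => map_zsmul S.mkQ n a)
  have hb : Module.Baer ℤ (Q ⧸ S) := Module.Baer.of_divisible _
  let g : N →ₗ[ℤ] Q ⧸ S := p.descend hp (S.mkQ ∘ₗ i) fun a ha => by
    rw [LinearMap.comp_apply, Submodule.mkQ_apply, Submodule.Quotient.mk_eq_zero]
    exact ⟨a, ha, rfl⟩
  obtain ⟨g', hg'⟩ := hb.extension_property N.subtype N.injective_subtype g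
  obtain ⟨l, hl⟩ := Module.projective_lifting_property S.mkQ g' S.mkQ_surjective
  -- On `N` the lift `l` agrees with `i a` modulo `i (ker p)` for any preimage `a` of `n`. Hence it
  -- takes values in the image of the free cover and defines a section of `p`.
  have hmem : ∀ n : N, ∃ a, i a = l n ∧ p a = n := by
    intro n
    obtain ⟨a, ha⟩ := hp n
    have h1 : S.mkQ (l n) = S.mkQ (i a) := by
      rw [← LinearMap.comp_apply, hl]
      have h2 : g' n = g n := LinearMap.congr_fun hg' n
      rw [h2, ← ha]
      exact LinearMap.descend_apply _ _ _ _ _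
    obtain ⟨k, hk, hk'⟩ := (Submodule.Quotient.eq S).1 h1
    refine ⟨k + a, ?_, ?_⟩
    · rw [map_add, hk', sub_add_cancel]
    · rw [map_add, LinearMap.mem_ker.1 hk, zero_add, ha]
  choose s hs hs' using hmem
  refine ⟨⟨⟨s, fun x y => hi ?_⟩, fun r x => hi ?_⟩, LinearMap.ext hs'⟩
  · rw [map_add, hs, hs, hs, Submodule.coe_add, map_add]
  · change i (s (r • x)) = i (r • s x)
    rw [map_smul, hs, hs, Submodule.coe_smul, map_smul]

instance : IsHereditaryRing.{u} ℤ where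
  projective_submodule {F} _ hF hP N := by
    obtain rfl := Subsingleton.elim hF (AddCommGroup.toIntModule F)
    convert Submodule.projective_int N

/-! ### Homogeneous components of the homology of a total. -/

namespace ChainComplex

open DiffModule TensorProduct LinearMap

variable {R : Type} [CommRing R]

section TotalHomology

variable (K : ChainComplex (ModuleCat.{u} R) ℕ)

/-- A component of an element of the total of a chain complex. -/
abbrev compTotal (n : ℕ) : Total K →ₗ[R] K.X n := DirectSum.component R ℕ (fun n => K.X n) n

lemma compTotal_inTotal_self (n : ℕ) (x : K.X n) : compTotal K n (inTotal K n x) = x :=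
  DirectSum.component.lof_self R _ _

lemma compTotal_inTotal_of_ne {m n : ℕ} (h : m ≠ n) (x : K.X m) :
    compTotal K n (inTotal K m x) = 0 := by
  rw [compTotal, inTotal, DirectSum.component.of, dif_neg h]

lemma exists_sum_inTotal_compTotal (x : Total K) : ∃ N₀, ∀ N ≥ N₀,
    ∑ i ∈ Finset.range N, inTotal K i (compTotal K i x) = x := by
  induction x using DirectSum.induction_on with
  | zero => exact ⟨0, fun N _ => by simp only [map_zero, Finset.sum_const_zero]⟩
  | of i x =>
    refine ⟨i + 1, fun N hN => ?_⟩
    rw [Finset.sum_eq_single i]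
    · exact congr_arg _ (compTotal_inTotal_self K i x)
    · intro j _ hj
      have : compTotal K j (inTotal K i x) = 0 := compTotal_inTotal_of_ne K hj.symm x
      exact (congr_arg _ this).trans (map_zero _)
    · intro h; exact absurd (Finset.mem_range.2 hN) h
  | add x y hx hy =>
    obtain ⟨a, ha⟩ := hx
    obtain ⟨b, hb⟩ := hy
    refine ⟨max a b, fun n hn => ?_⟩
    simp only [map_add, Finset.sum_add_distrib]
    rw [ha n (le_trans (le_max_left _ _) hn), hb n (le_trans (le_max_right _ _) hn)]

/-- The inclusion of the cycles of degree `n` in the cycles of the total. -/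
def inCyc (n : ℕ) : cyc K n →ₗ[R] ker (totalD K) :=
  (inTotal K n).restrict fun x hx => by
    rw [LinearMap.mem_ker, totalD_inTotal, LinearMap.mem_ker.1 hx, map_zero]

/-- The component of degree `n` of a cycle of the total. -/
def compCyc (n : ℕ) : ker (totalD K) →ₗ[R] cyc K n :=
  (compTotal K n).restrict fun x hx => by
    cases n with
    | zero => exact d_zero_apply _ _
    | succ n =>
      rw [LinearMap.mem_ker, Nat.add_sub_cancel, ← component_totalD, LinearMap.mem_ker.1 hx,
        map_zero]

lemma compCyc_inCyc_self (n : ℕ) (x : cyc K n) : compCyc K n (inCyc K n x) = x :=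
  Subtype.ext (compTotal_inTotal_self K n x.1)

lemma compCyc_inCyc_of_ne {m n : ℕ} (h : m ≠ n) (x : cyc K m) : compCyc K n (inCyc K m x) = 0 :=
  Subtype.ext (compTotal_inTotal_of_ne K h x.1)

lemma cls_compCyc_eq_zero (n : ℕ) (z : ker (totalD K)) (hz : z ∈ boundaries (totalD K)) :
    cls K n (compCyc K n z) = 0 := by
  obtain ⟨w, hw⟩ := hz
  refine (cls_eq_zero_iff _).2 ⟨compTotal K (n + 1) w, ?_⟩
  rw [← component_totalD, hw]
  rfl

/-- The component of degree `n` of a homology class of the total. -/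
def compHomology (n : ℕ) : Homology (totalD K) →ₗ[R] K.homology n :=
  (boundaries (totalD K)).liftQ (cls K n ∘ₗ compCyc K n) (cls_compCyc_eq_zero K n)

@[simp]
lemma compHomology_mkQ (n : ℕ) (z : ker (totalD K)) :
    compHomology K n ((boundaries (totalD K)).mkQ z) = cls K n (compCyc K n z) := rfl

/-- The inclusion of the homology of degree `n` in the homology of the total. -/
def inHomology (n : ℕ) : K.homology n →ₗ[R] Homology (totalD K) :=
  (cls K n).descend (cls_surjective n) ((boundaries (totalD K)).mkQ ∘ₗ inCyc K n) fun z hz => by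
    obtain ⟨w, hw⟩ := (cls_eq_zero_iff z).1 hz
    rw [LinearMap.comp_apply, Submodule.mkQ_apply, Submodule.Quotient.mk_eq_zero]
    refine ⟨inTotal K (n + 1) w, ?_⟩
    rw [totalD_inTotal]
    exact congr_arg _ hw

lemma exists_sum_inHomology_compHomology (x : Homology (totalD K)) : ∃ N₀, ∀ N ≥ N₀,
    (∑ i ∈ Finset.range N, inHomology K i ∘ₗ compHomology K i) x = x := by
  obtain ⟨z, rfl⟩ := (boundaries (totalD K)).mkQ_surjective x
  obtain ⟨N₀, h⟩ := exists_sum_inTotal_compTotal K z.1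
  refine ⟨N₀, fun N hN => ?_⟩
  simp only [LinearMap.sum_apply, LinearMap.comp_apply, compHomology_mkQ, inHomology,
    LinearMap.descend_apply]
  rw [← map_sum]
  congr 1
  apply Subtype.ext
  rw [AddSubmonoidClass.coe_finsetSum]
  exact h N hN

/-- The component of degree `n` of a boundary of the total. -/
def compBoundary (n : ℕ) : range (totalD K) →ₗ[R] range (K.d (n + 1) n).hom :=
  (compTotal K n).restrict <| by
    rintro _ ⟨w, rfl⟩
    exact ⟨_, (component_totalD K n w).symm⟩

/-- The inclusion of the boundaries of degree `n` in those of the total. -/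
def inBoundary (n : ℕ) : range (K.d (n + 1) n).hom →ₗ[R] range (totalD K) :=
  (inTotal K n).restrict <| by
    rintro _ ⟨w, rfl⟩
    exact ⟨inTotal K (n + 1) w, totalD_inTotal _ _⟩

lemma exists_sum_inBoundary_compBoundary (x : range (totalD K)) : ∃ N₀, ∀ N ≥ N₀,
    (∑ i ∈ Finset.range N, inBoundary K i ∘ₗ compBoundary K i) x = x := by
  obtain ⟨N₀, h⟩ := exists_sum_inTotal_compTotal K x.1
  refine ⟨N₀, fun N hN => ?_⟩
  apply Subtype.ext
  rw [LinearMap.sum_apply, AddSubmonoidClass.coe_finsetSum]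
  exact h N hN

/-- The inclusion of boundaries in cycles. -/
def boundaryToCyc (n : ℕ) : range (K.d (n + 1) n).hom →ₗ[R] cyc K n :=
  Submodule.inclusion (by rintro _ ⟨x, rfl⟩; exact d_d_apply _ _ _ _)

lemma boundaryToCyc_compBoundary (n : ℕ) :
    boundaryToCyc K n ∘ₗ compBoundary K n =
      compCyc K n ∘ₗ boundaryIncl (totalD K) (totalD_comp_totalD K) := rfl

/-- Over a hereditary ring and for projective chains, this gives the projective presentation of the
homology that computes `torOne`. -/
lemma exact_boundaryToCyc_cls (n : ℕ) : Function.Exact (boundaryToCyc K n) (cls K n) := by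
  intro z
  rw [cls_eq_zero_iff]
  constructor
  · rintro ⟨w, hw⟩
    exact ⟨⟨z.1, w, hw⟩, rfl⟩
  · rintro ⟨⟨_, w, rfl⟩, rfl⟩
    exact ⟨w, rfl⟩

end TotalHomology

/-! ### The homology cross product and the algebraic Künneth formula. -/

section Kuenneth

variable (K L : ChainComplex (ModuleCat.{u} R) ℕ)

/-- Vanishing torsion in all pairs of degrees assembles to vanishing for the totals: taking
components commutes with including boundaries in cycles, so the component of an element of the
kernel in bidegree `(i, j)` lies in the kernel for that bidegree. -/
lemma lTensor_boundaryIncl_injective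
    (h : ∀ i j, Function.Injective ((boundaryToCyc L j).lTensor (K.homology i))) :
    Function.Injective ((boundaryIncl (totalD L) (totalD_comp_totalD L)).lTensor
      (Homology (totalD K))) := by
  rw [injective_iff_map_eq_zero]
  intro x hx
  refine TensorProduct.eq_zero_of_forall_map_eq_zero _ _ (exists_sum_inHomology_compHomology K)
    (exists_sum_inBoundary_compBoundary L) x fun i j => ?_
  rw [TensorProduct.map_comp, LinearMap.comp_apply]
  suffices h' : TensorProduct.map (compHomology K i) (compBoundary L j) x = 0 by
    rw [h', map_zero]
  apply h i j
  rw [map_zero, ← LinearMap.comp_apply, LinearMap.lTensor, ← TensorProduct.map_comp,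
    boundaryToCyc_compBoundary]
  have := congr_arg (TensorProduct.map (compHomology K i) (compCyc L j)) hx
  rwa [map_zero, ← LinearMap.comp_apply, LinearMap.lTensor, ← TensorProduct.map_comp] at this

variable {K L}

lemma tensorIncl_comp_inTensor_tmul_cyc {n : ℕ} (a b : ℕ) (h : a + b = n) (x : cyc K a)
    (y : cyc L b) :
    totalTensorD K L (tensorIncl K L n (inTensor K L a b h (x.1 ⊗ₜ y.1))) = 0 := by
  rw [tensorIncl_inTensor, TensorProduct.map_tmul, totalTensorD_tmul, LinearMap.mem_ker.1 x.2,
    LinearMap.mem_ker.1 y.2]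
  simp

variable (K L) in
/-- The cycles of degree `n` of the tensor product of two chain complexes. -/
abbrev tensorCyc (n : ℕ) : Submodule R (TensorX K L n) := ker (totalTensorD K L ∘ₗ tensorIncl K L n)

/-- Describing cycles by the differential of the totals treats degree zero like the others. In
degree zero both conditions hold for every element. -/
lemma mem_cyc_tensorComplex_iff {n : ℕ} (t : (tensorComplex K L).X n) :
    t ∈ cyc (tensorComplex K L) n ↔ totalTensorD K L (tensorIncl K L n t) = 0 := by
  cases n with
  | zero =>
    refine ⟨fun _ => ?_, fun _ => d_zero_apply (K := tensorComplex K L) t _⟩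
    suffices h : totalTensorD K L ∘ₗ tensorIncl K L 0 = 0 from LinearMap.congr_fun h t
    refine tensorX_ext fun a b hab x y => ?_
    obtain ⟨rfl, rfl⟩ : a = 0 ∧ b = 0 := by omega
    rw [LinearMap.comp_apply]
    exact tensorIncl_comp_inTensor_tmul_cyc 0 0 hab ⟨x, d_zero_apply _ _⟩ ⟨y, d_zero_apply _ _⟩
  | succ n =>
    rw [← tensorIncl_tensorXD (K := K) (L := L) n t, map_eq_zero_iff _ (tensorIncl_injective n),
      LinearMap.mem_ker,
      Nat.add_sub_cancel, tensorComplex_d]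
    rfl

variable (K L) in
/-- The homology class of a cycle of the tensor product of two chain complexes. -/
def tensorCls (n : ℕ) : tensorCyc K L n →ₗ[R] (tensorComplex K L).homology n :=
  cls (tensorComplex K L) n ∘ₗ
    { toFun := fun t => ⟨t.1, (mem_cyc_tensorComplex_iff t.1).2 t.2⟩
      map_add' := fun _ _ => rfl
      map_smul' := fun _ _ => rfl }

lemma tensorCls_surjective (n : ℕ) : Function.Surjective (tensorCls K L n) := by
  intro x
  obtain ⟨c, rfl⟩ := cls_surjective n x
  exact ⟨⟨c.1, (mem_cyc_tensorComplex_iff c.1).1 c.2⟩, rfl⟩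

lemma tensorCls_eq_zero_iff {n : ℕ} (z : tensorCyc K L n) :
    tensorCls K L n z = 0 ↔ ∃ w : TensorX K L (n + 1), tensorXD K L n w = z.1 := by
  refine (cls_eq_zero_iff _).trans ?_
  rw [tensorComplex_d]
  rfl

/-- The tensor product of two cycles, as a cycle. -/
def cycTensor {n : ℕ} (a b : ℕ) (h : a + b = n) :
    cyc K a ⊗[R] cyc L b →ₗ[R] tensorCyc K L n :=
  LinearMap.codRestrict (tensorCyc K L n)
    (inTensor K L a b h ∘ₗ TensorProduct.map (cyc K a).subtype (cyc L b).subtype) (fun t => by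
      rw [LinearMap.mem_ker]
      induction t with
      | zero => simp
      | add x y hx hy => rw [map_add, map_add, hx, hy, add_zero]
      | tmul x y => exact tensorIncl_comp_inTensor_tmul_cyc a b h x y)

/-- If `x = d w` and `y` is a cycle, then `x ⊗ y = d (w ⊗ y)`. With the lemma for the right factor
this makes the cross product well defined on homology. -/
lemma cls_cycTensor_left {n : ℕ} (a b : ℕ) (h : a + b = n) (x : cyc K a) (y : cyc L b)
    (hx : cls K a x = 0) : tensorCls K L n (cycTensor a b h (x ⊗ₜ y)) = 0 := by
  obtain ⟨w, hw⟩ := (cls_eq_zero_iff _).1 hx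
  refine (tensorCls_eq_zero_iff _).2
    ⟨inTensor K L (n := n + 1) (a + 1) b (by omega) (w ⊗ₜ y.1), ?_⟩
  apply tensorIncl_injective (K := K) (L := L) n
  change _ = tensorIncl K L n (inTensor K L a b h (x.1 ⊗ₜ y.1))
  rw [tensorIncl_tensorXD, tensorIncl_inTensor, tensorIncl_inTensor, TensorProduct.map_tmul,
    totalTensorD_tmul, LinearMap.mem_ker.1 y.2, Nat.add_sub_cancel, hw]
  simp

lemma cls_cycTensor_right {n : ℕ} (a b : ℕ) (h : a + b = n) (x : cyc K a) (y : cyc L b)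
    (hy : cls L b y = 0) : tensorCls K L n (cycTensor a b h (x ⊗ₜ y)) = 0 := by
  obtain ⟨w, hw⟩ := (cls_eq_zero_iff _).1 hy
  refine (tensorCls_eq_zero_iff _).2
    -- The factor `(-1) ^ a` cancels the sign in `d (x ⊗ w) = (-1) ^ a x ⊗ d w`.
    ⟨inTensor K L (n := n + 1) a (b + 1) (by omega) ((-1 : R) ^ a • (x.1 ⊗ₜ w)), ?_⟩
  apply tensorIncl_injective (K := K) (L := L) n
  change _ = tensorIncl K L n (inTensor K L a b h (x.1 ⊗ₜ y.1))
  rw [tensorIncl_tensorXD, tensorIncl_inTensor, tensorIncl_inTensor, map_smul, map_smul,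
    TensorProduct.map_tmul,
    totalTensorD_tmul, LinearMap.mem_ker.1 x.2, Nat.add_sub_cancel, hw, smul_add, smul_smul,
    ← mul_pow]
  simp

/-- The homology cross product. -/
def cross {n : ℕ} (a b : ℕ) (h : a + b = n) :
    K.homology a ⊗[R] L.homology b →ₗ[R] (tensorComplex K L).homology n :=
  TensorProduct.lift <| (cls K a).descend (cls_surjective a)
    (LinearMap.flip <| (cls L b).descend (cls_surjective b)
      (LinearMap.flip (TensorProduct.curry (tensorCls K L n ∘ₗ cycTensor a b h)))
      (fun y hy => LinearMap.ext fun x => cls_cycTensor_right a b h x y hy))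
    (fun x hx => LinearMap.ext fun y => by
      obtain ⟨y, rfl⟩ := cls_surjective b y
      rw [LinearMap.flip_apply, LinearMap.descend_apply]
      exact cls_cycTensor_left a b h x y hx)

lemma cross_cls {n : ℕ} (a b : ℕ) (h : a + b = n) (t : cyc K a ⊗[R] cyc L b) :
    cross a b h (TensorProduct.map (cls K a) (cls L b) t) =
      tensorCls K L n (cycTensor a b h t) := by
  induction t with
  | zero => simp
  | add x y hx hy => rw [map_add, map_add, map_add, map_add, hx, hy]
  | tmul x y =>
    rw [TensorProduct.map_tmul, cross, TensorProduct.lift.tmul, LinearMap.descend_apply,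
      LinearMap.flip_apply, LinearMap.descend_apply]
    rfl

variable (K L) in
/-- The degree `n` part of the tensor product of the homology modules of two chain complexes. -/
abbrev HomologyTensor (n : ℕ) : Type u :=
  ⨁ p : {p : ℕ × ℕ // p.1 + p.2 = n}, K.homology p.1.1 ⊗[R] L.homology p.1.2

variable (K L) in
/-- The degree `n` part of the homology cross product. -/
def crossSum (n : ℕ) : HomologyTensor K L n →ₗ[R] (tensorComplex K L).homology n :=
  DirectSum.toModule R _ _ fun p => cross p.1.1 p.1.2 p.2

variable (K L) in
/-- The degree `n` part of the tensor product of the cycles of two chain complexes. -/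
abbrev CycTensor (n : ℕ) : Type u :=
  ⨁ p : {p : ℕ × ℕ // p.1 + p.2 = n}, cyc K p.1.1 ⊗[R] cyc L p.1.2

variable (K L) in
/-- The map from tensor products of cycles to tensor products of homology classes. -/
def clsTensor (n : ℕ) : CycTensor K L n →ₗ[R] HomologyTensor K L n :=
  DirectSum.lmap fun p => TensorProduct.map (cls K p.1.1) (cls L p.1.2)

lemma clsTensor_surjective (n : ℕ) : Function.Surjective (clsTensor K L n) :=
  (DirectSum.lmap_surjective _).2 fun _ =>
    TensorProduct.map_surjective (cls_surjective _) (cls_surjective _)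

variable (K L) in
/-- The map from tensor products of cycles to cycles of the tensor product. -/
def cycTensorSum (n : ℕ) : CycTensor K L n →ₗ[R] tensorCyc K L n :=
  DirectSum.toModule R _ _ fun p => cycTensor p.1.1 p.1.2 p.2

lemma crossSum_clsTensor (n : ℕ) (z : CycTensor K L n) :
    crossSum K L n (clsTensor K L n z) =
      tensorCls K L n (cycTensorSum K L n z) := by
  suffices h : crossSum K L n ∘ₗ clsTensor K L n = tensorCls K L n ∘ₗ
    cycTensorSum K L n from LinearMap.congr_fun h z
  refine DirectSum.linearMap_ext R fun p => LinearMap.ext fun t => ?_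
  simp only [LinearMap.comp_apply, clsTensor, cycTensorSum, crossSum, DirectSum.lmap_lof,
    DirectSum.toModule_lof, cross_cls]

variable (K L) in
/-- The map from tensor products of cycles to the tensor product of the cycles of the totals. -/
def cycTensorTotal (n : ℕ) : CycTensor K L n →ₗ[R] ker (totalD K) ⊗[R] ker (totalD L) :=
  DirectSum.toModule R _ _ fun p => TensorProduct.map (inCyc K p.1.1) (inCyc L p.1.2)

lemma map_subtype_cycTensorTotal (n : ℕ) (z : CycTensor K L n) :
    TensorProduct.map (ker (totalD K)).subtype (ker (totalD L)).subtype (cycTensorTotal K L n z) =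
      tensorIncl K L n (cycTensorSum K L n z).1 := by
  suffices h : TensorProduct.map (ker (totalD K)).subtype (ker (totalD L)).subtype ∘ₗ
      cycTensorTotal K L n = tensorIncl K L n ∘ₗ (tensorCyc K L n).subtype ∘ₗ
      cycTensorSum K L n from LinearMap.congr_fun h z
  refine DirectSum.linearMap_ext R fun p => TensorProduct.ext' fun x y => ?_
  simp only [LinearMap.comp_apply, cycTensorTotal, cycTensorSum, DirectSum.toModule_lof,
    TensorProduct.map_tmul]
  exact (tensorIncl_inTensor p.1.1 p.1.2 p.2 (x.1 ⊗ₜ y.1)).symm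

/-- Each homogeneous component of a tensor of classes can be read off in the tensor product of the
homologies of the totals, so vanishing there forces vanishing in every bidegree. -/
lemma component_clsTensor (n : ℕ) (p : {p : ℕ × ℕ // p.1 + p.2 = n}) (z : CycTensor K L n) :
    TensorProduct.map (compHomology K p.1.1) (compHomology L p.1.2)
      (TensorProduct.map (boundaries (totalD K)).mkQ (boundaries (totalD L)).mkQ
        (cycTensorTotal K L n z)) =
      DirectSum.component R _ (fun p : {p : ℕ × ℕ // p.1 + p.2 = n} =>
        K.homology p.1.1 ⊗[R] L.homology p.1.2) p (clsTensor K L n z) := by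
  suffices h : TensorProduct.map (compHomology K p.1.1) (compHomology L p.1.2) ∘ₗ
      TensorProduct.map (boundaries (totalD K)).mkQ (boundaries (totalD L)).mkQ ∘ₗ
        cycTensorTotal K L n =
      DirectSum.component R _ (fun p : {p : ℕ × ℕ // p.1 + p.2 = n} =>
        K.homology p.1.1 ⊗[R] L.homology p.1.2) p ∘ₗ clsTensor K L n from LinearMap.congr_fun h z
  refine DirectSum.linearMap_ext R fun q => TensorProduct.ext' fun x y => ?_
  simp only [LinearMap.comp_apply, cycTensorTotal, clsTensor, DirectSum.toModule_lof,
    TensorProduct.map_tmul, compHomology_mkQ, DirectSum.lmap_lof]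
  by_cases hpq : q = p
  · subst hpq
    rw [compCyc_inCyc_self, compCyc_inCyc_self, DirectSum.component.lof_self]
  · rw [DirectSum.component.of, dif_neg hpq]
    by_cases h1 : q.1.1 = p.1.1
    · have h2 : q.1.2 ≠ p.1.2 := fun h => hpq (Subtype.ext (Prod.ext h1 h))
      rw [compCyc_inCyc_of_ne L h2, map_zero, TensorProduct.tmul_zero]
    · rw [compCyc_inCyc_of_ne K h1, map_zero, TensorProduct.zero_tmul]

/-- The homogeneous components of a cycle of the total are themselves cycles, so the part of total
degree `n` of a tensor of cycles is a finite sum of tensors of homogeneous cycles. -/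
lemma exists_cycTensorSum_eq (n : ℕ) (z : ker (totalD K) ⊗[R] ker (totalD L)) :
    ∃ y : CycTensor K L n, (cycTensorSum K L n y).1 = tensorProj K L n
      (TensorProduct.map (ker (totalD K)).subtype (ker (totalD L)).subtype z) := by
  induction z with
  | zero => exact ⟨0, by rw [map_zero, map_zero, map_zero]; rfl⟩
  | add x y hx hy =>
    obtain ⟨a, ha⟩ := hx
    obtain ⟨b, hb⟩ := hy
    exact ⟨a + b, by rw [map_add, map_add, map_add, ← ha, ← hb]; rfl⟩
  | tmul x y =>
    obtain ⟨N, hN⟩ := exists_sum_inTotal_compTotal K x.1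
    obtain ⟨M, hM⟩ := exists_sum_inTotal_compTotal L y.1
    refine ⟨∑ i ∈ Finset.range N, ∑ j ∈ Finset.range M, if h : i + j = n then
      DirectSum.lof R _ (fun p : {p : ℕ × ℕ // p.1 + p.2 = n} => cyc K p.1.1 ⊗[R] cyc L p.1.2)
        ⟨(i, j), h⟩ (compCyc K i x ⊗ₜ compCyc L j y) else 0, ?_⟩
    have e : x.1 ⊗ₜ[R] y.1 = ∑ i ∈ Finset.range N, ∑ j ∈ Finset.range M,
        inTotal K i (compTotal K i x.1) ⊗ₜ[R] inTotal L j (compTotal L j y.1) := by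
      conv_lhs => rw [← hN N le_rfl, ← hM M le_rfl]
      rw [TensorProduct.sum_tmul]
      exact Finset.sum_congr rfl fun i _ => TensorProduct.tmul_sum _ _ _
    rw [TensorProduct.map_tmul, Submodule.subtype_apply, Submodule.subtype_apply, e]
    simp only [map_sum, AddSubmonoidClass.coe_finsetSum]
    refine Finset.sum_congr rfl fun i _ => Finset.sum_congr rfl fun j _ => ?_
    rw [tensorProj_tmul]
    split_ifs with h
    · rw [cycTensorSum, DirectSum.toModule_lof]
      rfl
    · rw [map_zero]; rfl

section Hereditary

variable [IsHereditaryRing.{u} R] [∀ n, Module.Projective R (K.X n)]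
  [∀ n, Module.Projective R (L.X n)]

/-- No torsion hypothesis is needed here. This matters later, where only injectivity is used for the
product of a space with a contractible one. -/
theorem crossSum_injective (n : ℕ) : Function.Injective (crossSum K L n) := by
  rw [injective_iff_map_eq_zero]
  intro x hx
  obtain ⟨z, rfl⟩ := clsTensor_surjective n x
  rw [crossSum_clsTensor, tensorCls_eq_zero_iff] at hx
  obtain ⟨w, hw⟩ := hx
  have h := map_mkQ_eq_zero_of_eq_tensorDiff (totalD_comp_totalD K) (totalD_comp_totalD L)
    (cycTensorTotal K L n z) (tensorIncl K L (n + 1) w) (ε := totalSign K) (by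
      rw [map_subtype_cycTensorTotal, ← hw, ← totalTensorD, ← tensorIncl_tensorXD])
  refine DirectSum.ext_component R fun p => ?_
  rw [← component_clsTensor, h, map_zero, map_zero]

/-- A cycle of degree `n` differs from a tensor of cycles of the totals by a boundary; projecting
this relation to total degree `n` keeps both terms of the required kind. -/
theorem crossSum_surjective
    (hTor : ∀ i j, IsZero (torOne (K.homology i) (L.homology j))) (n : ℕ) :
    Function.Surjective (crossSum K L n) := by
  intro x
  obtain ⟨c, rfl⟩ := tensorCls_surjective n x
  obtain ⟨z, w, hzw⟩ := exists_eq_map_subtype_add_tensorDiff (totalD_comp_totalD K)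
    (totalD_comp_totalD L) (totalD_comp_totalSign K) (totalSign_comp_totalSign K)
    (lTensor_boundaryIncl_injective K L fun i j =>
      lTensor_injective_of_isZero_torOne (hTor i j) (boundaryToCyc L j) (cls L j)
      (Submodule.inclusion_injective _) (exact_boundaryToCyc_cls L j) (cls_surjective j))
    (tensorIncl K L n c.1) c.2
  obtain ⟨y, hy⟩ := exists_cycTensorSum_eq n z
  refine ⟨clsTensor K L n y, ?_⟩
  rw [crossSum_clsTensor, eq_comm, ← sub_eq_zero, ← map_sub, tensorCls_eq_zero_iff]
  refine ⟨tensorProj K L (n + 1) w, ?_⟩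
  rw [Submodule.coe_sub, tensorXD_tensorProj, hy, ← tensorProj_tensorIncl n c.1, hzw, map_add,
    add_sub_cancel_left]

end Hereditary

section Naturality

variable {K' L' : ChainComplex (ModuleCat.{u} R) ℕ} (f : K ⟶ K') (g : L ⟶ L')

/-- The map on tensor products of homology modules induced by morphisms of chain complexes. -/
def homologyTensorMap (n : ℕ) : HomologyTensor K L n →ₗ[R] HomologyTensor K' L' n :=
  DirectSum.lmap fun p => TensorProduct.map (HomologicalComplex.homologyMap f p.1.1).hom
    (HomologicalComplex.homologyMap g p.1.2).hom

lemma homologyMap_crossSum (n : ℕ) (x : HomologyTensor K L n) :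
    (HomologicalComplex.homologyMap (tensorComplexMap f g) n).hom (crossSum K L n x) =
      crossSum K' L' n (homologyTensorMap f g n x) := by
  suffices h : (HomologicalComplex.homologyMap (tensorComplexMap f g) n).hom ∘ₗ crossSum K L n =
      crossSum K' L' n ∘ₗ homologyTensorMap f g n from LinearMap.congr_fun h x
  refine DirectSum.linearMap_ext R fun p => TensorProduct.ext' fun x y => ?_
  obtain ⟨x, rfl⟩ := cls_surjective _ x
  obtain ⟨y, rfl⟩ := cls_surjective _ y
  simp only [LinearMap.comp_apply, crossSum, homologyTensorMap, DirectSum.toModule_lof,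
    DirectSum.lmap_lof, TensorProduct.map_tmul, homologyMap_cls]
  have h1 := cross_cls (K := K) (L := L) p.1.1 p.1.2 p.2 (x ⊗ₜ y)
  have h2 := cross_cls (K := K') (L := L') p.1.1 p.1.2 p.2 (cycMap f _ x ⊗ₜ cycMap g _ y)
  rw [TensorProduct.map_tmul] at h1 h2
  rw [h1, h2]
  refine (homologyMap_cls _ _).trans (congr_arg _ ?_)
  apply Subtype.ext
  exact tensorXMap_inTensor f g p.1.1 p.1.2 p.2 (x.1 ⊗ₜ y.1)

end Naturality

end Kuenneth

end ChainComplex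

end

noncomputable section

/-! ### Chains of simplicial sets -/

namespace SSet

open Simplicial

variable (R : Type) [CommRing R]

/-- The coefficient module. -/
abbrev coeffObj : ModuleCat.{u} R := ModuleCat.of R (ULift.{u} R)

variable {R}

/-- The chain given by a simplex. -/
def chainOf {X : SSet.{u}} {n : ℕ} (x : X _⦋n⦌) : (X.chainComplex (coeffObj.{u} R)).X n :=
  (X.ιChainComplex (R := coeffObj.{u} R) x).hom (ULift.up 1)

/-- The linear map on chains given by its values on simplices. -/
def chainLift {X : SSet.{u}} {n : ℕ} {M : Type u} [AddCommGroup M] [Module R M]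
    (f : X _⦋n⦌ → M) : (X.chainComplex (coeffObj.{u} R)).X n →ₗ[R] M :=
  (Cofan.IsColimit.desc (X.isColimitChainComplexXCofan (coeffObj.{u} R) n) (A := ModuleCat.of R M)
    fun x => ModuleCat.ofHom (LinearMap.toSpanSingleton R M (f x) ∘ₗ
      ULift.moduleEquiv.toLinearMap)).hom

@[simp]
lemma chainLift_chainOf {X : SSet.{u}} {n : ℕ} {M : Type u} [AddCommGroup M] [Module R M]
    (f : X _⦋n⦌ → M) (x : X _⦋n⦌) : chainLift (R := R) f (chainOf x) = f x := by
  have h := Cofan.IsColimit.fac (X.isColimitChainComplexXCofan (coeffObj.{u} R) n)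
    (A := ModuleCat.of R M) (fun x => ModuleCat.ofHom (LinearMap.toSpanSingleton R M (f x) ∘ₗ
      ULift.moduleEquiv.toLinearMap)) x
  refine (congr_arg (fun g => ModuleCat.Hom.hom g (ULift.up 1)) h).trans ?_
  simp

/-- The universal property of the coproduct tests only maps to modules in universe `u`. It is
applied to the quotient by the span of the simplices, which shows that they span; then `M` may live
anywhere. -/
lemma chain_ext {X : SSet.{u}} {n : ℕ} {M : Type*} [AddCommGroup M] [Module R M]
    {f g : (X.chainComplex (coeffObj.{u} R)).X n →ₗ[R] M}
    (h : ∀ x : X _⦋n⦌, f (chainOf x) = g (chainOf x)) : f = g := by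
  have hs : ∀ z : (X.chainComplex (coeffObj.{u} R)).X n,
      z ∈ Submodule.span R (Set.range (chainOf (R := R) (X := X) (n := n))) := by
    intro z
    let S := Submodule.span R (Set.range (chainOf (R := R) (X := X) (n := n)))
    have h0 : S.mkQ = 0 := by
      have : ModuleCat.ofHom S.mkQ = 0 := by
        refine chainComplex_hom_ext fun x => ?_
        ext r
        change S.mkQ ((X.ιChainComplex (R := coeffObj.{u} R) x).hom r) = 0
        have hr : r = r.down • (ULift.up 1 : ULift.{u} R) := by
          apply ULift.down_injective
          simp
        rw [hr, map_smul, map_smul]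
        have : S.mkQ ((X.ιChainComplex (R := coeffObj.{u} R) x).hom (ULift.up 1)) = 0 := by
          rw [Submodule.mkQ_apply, Submodule.Quotient.mk_eq_zero]
          exact Submodule.subset_span ⟨x, rfl⟩
        rw [this, smul_zero]
      exact congr_arg ModuleCat.Hom.hom this
    rw [← Submodule.Quotient.mk_eq_zero, ← Submodule.mkQ_apply]
    exact LinearMap.congr_fun h0 z
  ext z
  induction hs z using Submodule.span_induction with
  | mem _ hx => obtain ⟨x, rfl⟩ := hx; exact h x
  | zero => simp
  | add _ _ _ _ hx hy => rw [map_add, map_add, hx, hy]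
  | smul r _ _ hx => rw [map_smul, map_smul, hx]

lemma chain_induction {X : SSet.{u}} {n : ℕ} {p : (X.chainComplex (coeffObj.{u} R)).X n → Prop}
    (of : ∀ x, p (chainOf x)) (zero : p 0) (add : ∀ a b, p a → p b → p (a + b))
    (smul : ∀ (r : R) a, p a → p (r • a)) (z : (X.chainComplex (coeffObj.{u} R)).X n) : p z := by
  let S : Submodule R ((X.chainComplex (coeffObj.{u} R)).X n) :=
    { carrier := {z | p z}
      add_mem' := fun {a b} => add a b
      zero_mem' := zero
      smul_mem' := smul }
  have : S.mkQ = 0 := chain_ext fun x => by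
    rw [Submodule.mkQ_apply, LinearMap.zero_apply, Submodule.Quotient.mk_eq_zero]
    exact of x
  have h := LinearMap.congr_fun this z
  rwa [Submodule.mkQ_apply, LinearMap.zero_apply, Submodule.Quotient.mk_eq_zero] at h

lemma d_chainOf {X : SSet.{u}} {n : ℕ} (x : X _⦋n + 1⦌) :
    ((X.chainComplex (coeffObj.{u} R)).d (n + 1) n).hom (chainOf x) =
      ∑ i : Fin (n + 2), (-1 : R) ^ i.val • chainOf (X.δ i x) := by
  have h := congr_arg (fun g => ModuleCat.Hom.hom g (ULift.up 1))
    (X.ιChainComplex_d (R := coeffObj.{u} R) x)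
  refine Eq.trans h ?_
  rw [ModuleCat.hom_sum, LinearMap.sum_apply]
  refine Finset.sum_congr rfl fun i _ => ?_
  rcases neg_one_pow_eq_or ℤ i.val with h | h
  · have h' : (-1 : R) ^ i.val = 1 := by exact_mod_cast congr_arg (Int.cast : ℤ → R) h
    rw [h, h', one_smul, one_smul]; rfl
  · have h' : (-1 : R) ^ i.val = -1 := by exact_mod_cast congr_arg (Int.cast : ℤ → R) h
    rw [h, h', neg_one_smul, neg_one_smul]; rfl

lemma map_chainOf {X Y : SSet.{u}} (f : X ⟶ Y) {n : ℕ} (x : X _⦋n⦌) :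
    ((chainComplexMap f (coeffObj.{u} R)).f n).hom (chainOf x) = chainOf (f.app _ x) :=
  congr_arg (fun g => ModuleCat.Hom.hom g (ULift.up 1)) (ι_chainComplexMap_f X Y f
    (coeffObj.{u} R) x)

instance projective_chains (X : SSet.{u}) (n : ℕ) :
    Module.Projective R ((X.chainComplex (coeffObj.{u} R)).X n) := by
  have : Projective (coeffObj.{u} R : ModuleCat.{u} R) :=
    (IsProjective.iff_projective (R := R) (ULift.{u} R)).1
      (Module.Projective.of_equiv ULift.moduleEquiv.symm)
  rw [IsProjective.iff_projective]
  exact inferInstanceAs (Projective (∐ fun _ : X _⦋n⦌ => coeffObj.{u} R))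

section Cone

variable {X : SSet.{u}}

/-- The map on chains induced by a map on simplices. -/
def chainShift {n m : ℕ} (s : X _⦋n⦌ → X _⦋m⦌) :
    (X.chainComplex (coeffObj.{u} R)).X n →ₗ[R] (X.chainComplex (coeffObj.{u} R)).X m :=
  chainLift fun x => chainOf (s x)

@[simp]
lemma chainShift_chainOf {n m : ℕ} (s : X _⦋n⦌ → X _⦋m⦌) (x : X _⦋n⦌) :
    chainShift (R := R) s (chainOf x) = chainOf (s x) :=
  chainLift_chainOf _ _

/-- The boundary of a cone. -/
lemma d_chainShift (s : ∀ n : ℕ, X _⦋n⦌ → X _⦋n + 1⦌) (h₀ : ∀ n x, X.δ 0 (s n x) = x)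
    (h : ∀ n (i : Fin (n + 2)) (x : X _⦋n + 1⦌), X.δ i.succ (s (n + 1) x) = s n (X.δ i x))
    {n : ℕ} (z : (X.chainComplex (coeffObj.{u} R)).X (n + 1)) :
    ((X.chainComplex (coeffObj.{u} R)).d (n + 2) (n + 1)).hom (chainShift (s (n + 1)) z) =
      z - chainShift (s n) (((X.chainComplex (coeffObj.{u} R)).d (n + 1) n).hom z) := by
  suffices H : ((X.chainComplex (coeffObj.{u} R)).d (n + 2) (n + 1)).hom ∘ₗ
      chainShift (s (n + 1)) = LinearMap.id -
        chainShift (s n) ∘ₗ ((X.chainComplex (coeffObj.{u} R)).d (n + 1) n).hom from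
    LinearMap.congr_fun H z
  refine chain_ext fun x => ?_
  rw [LinearMap.comp_apply, chainShift_chainOf, d_chainOf, Fin.sum_univ_succ, LinearMap.sub_apply,
    LinearMap.comp_apply, d_chainOf, map_sum, h₀, sub_eq_add_neg, ← Finset.sum_neg_distrib]
  congr 1
  · simp
  · refine Finset.sum_congr rfl fun i _ => ?_
    rw [map_smul, chainShift_chainOf, h, Fin.val_succ, pow_succ, mul_neg_one, neg_smul]

/-- The cone operator is a contracting homotopy in positive degrees: `d s z = z - s d z`, so a cycle
bounds its cone. -/
lemma exists_d_eq_of_cone (s : ∀ n : ℕ, X _⦋n⦌ → X _⦋n + 1⦌) (h₀ : ∀ n x, X.δ 0 (s n x) = x)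
    (h : ∀ n (i : Fin (n + 2)) (x : X _⦋n + 1⦌), X.δ i.succ (s (n + 1) x) = s n (X.δ i x))
    {n : ℕ} (z : (X.chainComplex (coeffObj.{u} R)).X (n + 1))
    (hz : ((X.chainComplex (coeffObj.{u} R)).d (n + 1) n).hom z = 0) :
    ∃ w, ((X.chainComplex (coeffObj.{u} R)).d (n + 2) (n + 1)).hom w = z :=
  ⟨chainShift (s (n + 1)) z, by rw [d_chainShift s h₀ h, hz, map_zero, sub_zero]⟩

end Cone

/-- The extra degeneracy of the standard simplex. -/
def stdSimplexCone (a n : ℕ) : (Δ[a] : SSet.{u}) _⦋n⦌ → (Δ[a] : SSet.{u}) _⦋n + 1⦌ :=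
  (Augmented.StandardSimplex.extraDegeneracy.{u} ⦋a⦌).s n

lemma δ_zero_stdSimplexCone (a n : ℕ) (x : (Δ[a] : SSet.{u}) _⦋n⦌) :
    (Δ[a] : SSet.{u}).δ 0 (stdSimplexCone a n x) = x :=
  ConcreteCategory.congr_hom ((Augmented.StandardSimplex.extraDegeneracy.{u} ⦋a⦌).s_comp_δ₀ n) x

lemma δ_succ_stdSimplexCone (a n : ℕ) (i : Fin (n + 2)) (x : (Δ[a] : SSet.{u}) _⦋n + 1⦌) :
    (Δ[a] : SSet.{u}).δ i.succ (stdSimplexCone a (n + 1) x) =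
      stdSimplexCone a n ((Δ[a] : SSet.{u}).δ i x) :=
  ConcreteCategory.congr_hom ((Augmented.StandardSimplex.extraDegeneracy.{u} ⦋a⦌).s_comp_δ n i) x

lemma exists_d_eq_stdSimplex (a n : ℕ)
    (z : ((Δ[a] : SSet.{u}).chainComplex (coeffObj.{u} R)).X (n + 1))
    (hz : (((Δ[a] : SSet.{u}).chainComplex (coeffObj.{u} R)).d (n + 1) n).hom z = 0) :
    ∃ w, (((Δ[a] : SSet.{u}).chainComplex (coeffObj.{u} R)).d (n + 2) (n + 1)).hom w = z :=
  exists_d_eq_of_cone (stdSimplexCone a) (δ_zero_stdSimplexCone a) (δ_succ_stdSimplexCone a) z hz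

-- Faces of a product are taken componentwise, so the extra degeneracies of the two factors together
-- form one for the product.
open MonoidalCategory in
lemma exists_d_eq_stdSimplex_tensor (a b n : ℕ)
    (z : ((Δ[a] ⊗ Δ[b] : SSet.{u}).chainComplex (coeffObj.{u} R)).X (n + 1))
    (hz : (((Δ[a] ⊗ Δ[b] : SSet.{u}).chainComplex (coeffObj.{u} R)).d (n + 1) n).hom z = 0) :
    ∃ w, (((Δ[a] ⊗ Δ[b] : SSet.{u}).chainComplex (coeffObj.{u} R)).d (n + 2) (n + 1)).hom w = z :=
  exists_d_eq_of_cone (X := (Δ[a] ⊗ Δ[b] : SSet.{u}))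
    (fun n (x : (Δ[a] : SSet.{u}) _⦋n⦌ × (Δ[b] : SSet.{u}) _⦋n⦌) =>
      (stdSimplexCone a n x.1, stdSimplexCone b n x.2))
    (fun n (x : (Δ[a] : SSet.{u}) _⦋n⦌ × (Δ[b] : SSet.{u}) _⦋n⦌) =>
      Prod.ext (δ_zero_stdSimplexCone a n x.1) (δ_zero_stdSimplexCone b n x.2))
    (fun n i (x : (Δ[a] : SSet.{u}) _⦋n + 1⦌ × (Δ[b] : SSet.{u}) _⦋n + 1⦌) =>
      Prod.ext (δ_succ_stdSimplexCone a n i x.1) (δ_succ_stdSimplexCone b n i x.2)) z hz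

end SSet
end

noncomputable section

/-! ### Acyclic models -/

namespace AcyclicModels

open CategoryTheory

variable {R : Type} [CommRing R] {C : Type*} [Category* C]

/-- A functor to modules which is free on universal elements of given models. -/
structure ModelBasis (F : C ⥤ ModuleCat.{u} R) where
  /-- The index type of the basis. -/
  index : Type
  /-- The models. -/
  model : index → C
  /-- The universal elements. -/
  elt : ∀ i, F.obj (model i)
  /-- The natural transformation given by its values on the universal elements. -/
  desc : ∀ {H : C ⥤ ModuleCat.{u} R}, (∀ i, H.obj (model i)) → (F ⟶ H)
  desc_elt : ∀ {H : C ⥤ ModuleCat.{u} R} (y : ∀ i, H.obj (model i)) (i : index),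
    ((desc y).app (model i)).hom (elt i) = y i
  hom_ext : ∀ {H : C ⥤ ModuleCat.{u} R} {f g : F ⟶ H},
    (∀ i, (f.app (model i)).hom (elt i) = (g.app (model i)).hom (elt i)) → f = g

lemma ModelBasis.exists_lift {F A B : C ⥤ ModuleCat.{u} R} (b : ModelBasis F) (φ : F ⟶ B)
    (d : A ⟶ B) (h : ∀ i, ∃ a : A.obj (b.model i),
      (d.app (b.model i)).hom a = (φ.app (b.model i)).hom (b.elt i)) : ∃ ψ : F ⟶ A, ψ ≫ d = φ := by
  choose a ha using h
  refine ⟨b.desc a, b.hom_ext fun i => ?_⟩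
  rw [NatTrans.comp_app, ModuleCat.hom_comp, LinearMap.comp_apply, b.desc_elt, ha]

/-- The terms of a functor to chain complexes. -/
abbrev term (F : C ⥤ ChainComplex (ModuleCat.{u} R) ℕ) (n : ℕ) : C ⥤ ModuleCat.{u} R :=
  F ⋙ HomologicalComplex.eval _ _ n

/-- The differentials of a functor to chain complexes. -/
def termD (F : C ⥤ ChainComplex (ModuleCat.{u} R) ℕ) (i j : ℕ) : term F i ⟶ term F j where
  app X := (F.obj X).d i j
  naturality _ _ f := (F.map f).comm i j

/-- A functor to chain complexes as a chain complex of functors. -/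
def flip (F : C ⥤ ChainComplex (ModuleCat.{u} R) ℕ) :
    ChainComplex (C ⥤ ModuleCat.{u} R) ℕ where
  X n := term F n
  d i j := termD F i j
  shape i j h := by
    ext X : 2
    exact (F.obj X).shape i j h
  d_comp_d' i j k _ _ := by
    ext X : 2
    exact (F.obj X).d_comp_d i j k

variable {F G : C ⥤ ChainComplex (ModuleCat.{u} R) ℕ}

/-- A natural transformation as a morphism of chain complexes of functors. -/
def flipMap (f : F ⟶ G) : flip F ⟶ flip G where
  f n := Functor.whiskerRight f (HomologicalComplex.eval _ _ n)
  comm' i j _ := by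
    ext X : 2
    exact (f.app X).comm i j

/-- The natural transformation given by a morphism of chain complexes of functors. -/
def unflipMap (f : flip F ⟶ flip G) : F ⟶ G where
  app X :=
    { f n := (f.f n).app X
      comm' i j _ := congr_app (f.comm i j) X }
  naturality X Y φ := by
    ext n : 1
    exact (f.f n).naturality φ

/-- The vanishing of the homology in positive degrees of a chain complex. -/
def PosAcyclic (K : ChainComplex (ModuleCat.{u} R) ℕ) : Prop :=
  ∀ (n : ℕ) (z : K.X (n + 1)), (K.d (n + 1) n).hom z = 0 → ∃ w, (K.d (n + 2) (n + 1)).hom w = z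

/-- A functor which is free on models extends transformations in degree zero to functors which are
acyclic on these models. -/
theorem exists_natTrans (b : ∀ n, ModelBasis (term F n))
    (hG : ∀ n i, PosAcyclic (G.obj ((b n).model i))) (f₀ : term F 0 ⟶ term G 0)
    (h₁ : ∀ i, ∃ y : (G.obj ((b 1).model i)).X 1,
      ((G.obj ((b 1).model i)).d 1 0).hom y =
        (f₀.app _).hom (((F.obj ((b 1).model i)).d 1 0).hom ((b 1).elt i))) :
    ∃ f : F ⟶ G, ∀ X, (f.app X).f 0 = f₀.app X := by
  obtain ⟨f₁, hf₁⟩ := (b 1).exists_lift (termD F 1 0 ≫ f₀) (termD G 1 0) h₁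
  have succ : ∀ (n : ℕ) (p : Σ' (f : (flip F).X n ⟶ (flip G).X n)
      (f' : (flip F).X (n + 1) ⟶ (flip G).X (n + 1)),
      f' ≫ (flip G).d (n + 1) n = (flip F).d (n + 1) n ≫ f),
      ∃ f'' : (flip F).X (n + 2) ⟶ (flip G).X (n + 2),
        f'' ≫ (flip G).d (n + 2) (n + 1) = (flip F).d (n + 2) (n + 1) ≫ p.2.1 := by
    intro n p
    -- On the universal elements the prescribed value is a cycle, by the chain map relation one
    -- degree lower, so acyclicity of the models supplies a preimage.
    refine (b (n + 2)).exists_lift ((flip F).d (n + 2) (n + 1) ≫ p.2.1)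
      (termD G (n + 2) (n + 1)) fun i => hG _ i n _ ?_
    have h : ((flip F).d (n + 2) (n + 1) ≫ p.2.1) ≫ (flip G).d (n + 1) n = 0 := by
      rw [Category.assoc, p.2.2, ← Category.assoc, HomologicalComplex.d_comp_d, zero_comp]
    exact LinearMap.congr_fun (congr_arg ModuleCat.Hom.hom
      (congr_app h ((b (n + 2)).model i))) ((b (n + 2)).elt i)
  refine ⟨unflipMap (ChainComplex.mkHom (flip F) (flip G) f₀ f₁ hf₁
    fun n p => ⟨(succ n p).choose, (succ n p).choose_spec⟩), fun X => rfl⟩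

/-- Two transformations from a functor which is free on models to a functor which is acyclic on
these models are naturally homotopic if they agree in degree zero. -/
theorem nonempty_homotopy (b : ∀ n, ModelBasis (term F n))
    (hG : ∀ n i, PosAcyclic (G.obj ((b n).model i))) (f g : F ⟶ G)
    (h₀ : ∀ X, (f.app X).f 0 = (g.app X).f 0) :
    Nonempty (Homotopy (flipMap f) (flipMap g)) := by
  -- The difference vanishes in degree zero, so a null homotopy may start with zero and be continued
  -- degree by degree.
  let e : flip F ⟶ flip G := flipMap f - flipMap g
  have e₀ : e.f 0 = 0 := by
    ext X : 2
    change (f.app X).f 0 - (g.app X).f 0 = 0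
    rw [h₀, sub_self]
  have h₁ : ∃ h : (flip F).X 1 ⟶ (flip G).X 2, h ≫ (flip G).d 2 1 = e.f 1 := by
    refine (b 1).exists_lift (e.f 1) (termD G 2 1) fun i => hG _ i 0 _ ?_
    have h : e.f 1 ≫ (flip G).d 1 0 = 0 := by
      rw [e.comm, e₀, comp_zero]
    exact LinearMap.congr_fun (congr_arg ModuleCat.Hom.hom
      (congr_app h ((b 1).model i))) ((b 1).elt i)
  have succ : ∀ (n : ℕ) (p : Σ' (f : (flip F).X n ⟶ (flip G).X (n + 1))
      (f' : (flip F).X (n + 1) ⟶ (flip G).X (n + 2)),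
      e.f (n + 1) = (flip F).d (n + 1) n ≫ f + f' ≫ (flip G).d (n + 2) (n + 1)),
      ∃ f'' : (flip F).X (n + 2) ⟶ (flip G).X (n + 3),
        e.f (n + 2) = (flip F).d (n + 2) (n + 1) ≫ p.2.1 +
          f'' ≫ (flip G).d (n + 3) (n + 2) := by
    rintro n ⟨p₁, p₂, hp⟩
    have h : ∃ h : (flip F).X (n + 2) ⟶ (flip G).X (n + 3), h ≫ (flip G).d (n + 3) (n + 2) =
        e.f (n + 2) - (flip F).d (n + 2) (n + 1) ≫ p₂ := by
      refine (b (n + 2)).exists_lift (e.f (n + 2) - (flip F).d (n + 2) (n + 1) ≫ p₂)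
        (termD G (n + 3) (n + 2)) fun i => hG _ i (n + 1) _ ?_
      have h : (e.f (n + 2) - (flip F).d (n + 2) (n + 1) ≫ p₂) ≫
          (flip G).d (n + 2) (n + 1) = 0 := by
        rw [Preadditive.sub_comp, e.comm, hp, Preadditive.comp_add, Category.assoc,
          ← Category.assoc _ _ p₁, HomologicalComplex.d_comp_d, zero_comp, zero_add, sub_self]
      exact LinearMap.congr_fun (congr_arg ModuleCat.Hom.hom
        (congr_app h ((b (n + 2)).model i))) ((b (n + 2)).elt i)
    obtain ⟨h, hh⟩ := h
    exact ⟨h, by rw [hh]; abel⟩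
  let H : Homotopy e 0 := Homotopy.mkInductive e 0 (by rw [e₀, zero_comp]) h₁.choose
    (by rw [h₁.choose_spec, comp_zero, zero_add])
    fun n p => ⟨(succ n p).choose, (succ n p).choose_spec⟩
  exact ⟨Homotopy.equivSubZero.symm H⟩

/-- Two transformations from a functor which is free on models to a functor which is acyclic on
these models induce the same maps in homology if they agree in degree zero. -/
theorem homologyMap_eq (b : ∀ n, ModelBasis (term F n))
    (hG : ∀ n i, PosAcyclic (G.obj ((b n).model i))) (f g : F ⟶ G)
    (h₀ : ∀ X, (f.app X).f 0 = (g.app X).f 0) (X : C) (n : ℕ) :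
    HomologicalComplex.homologyMap (f.app X) n = HomologicalComplex.homologyMap (g.app X) n := by
  obtain ⟨H'⟩ := nonempty_homotopy b hG f g h₀
  exact (((evaluation C (ModuleCat.{u} R)).obj X).mapHomotopy H').homologyMap_eq n

end AcyclicModels

end

noncomputable section

/-! ### The Eilenberg–Zilber theorem -/

namespace SSet

open Simplicial AcyclicModels MonoidalCategory ChainComplex

variable (R : Type) [CommRing R]

/-- The functor of chains. -/
abbrev chains : SSet.{u} ⥤ ChainComplex (ModuleCat.{u} R) ℕ :=
  (SSet.chainComplexFunctor (ModuleCat.{u} R)).obj (coeffObj.{u} R)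

variable {R}

/-- Chains of a corepresentable set of simplices are free on one model. -/
def corepBasis {C : Type*} [Category* C] (S : C ⥤ SSet.{u}) (n : ℕ) (m : C)
    (e : (S.obj m) _⦋n⦌)
    (he : ∀ X, Function.Bijective fun f : m ⟶ X => (S.map f).app (Opposite.op ⦋n⦌) e) :
    ModelBasis (term (S ⋙ chains R) n) where
  index := Unit
  model _ := m
  elt _ := chainOf e
  desc {H} y :=
    { app X := ModuleCat.ofHom (chainLift fun x : (S.obj X) _⦋n⦌ =>
        (H.map ((Equiv.ofBijective _ (he X)).symm x)).hom (y ()))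
      naturality X Y f := by
        refine ModuleCat.hom_ext (chain_ext fun x => ?_)
        obtain ⟨g, rfl⟩ := (he X).2 x
        have h₁ : ∀ X (g : m ⟶ X), (Equiv.ofBijective _ (he X)).symm
            ((S.map g).app (Opposite.op ⦋n⦌) e) = g := fun X g =>
          (Equiv.ofBijective _ (he X)).symm_apply_apply g
        have h₂ : (S.map f).app (Opposite.op ⦋n⦌) ((S.map g).app (Opposite.op ⦋n⦌) e) =
            (S.map (g ≫ f)).app (Opposite.op ⦋n⦌) e := by
          rw [S.map_comp]; rfl
        refine (congr_arg _ (map_chainOf (S.map f) _)).trans ?_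
        refine (chainLift_chainOf _ _).trans ?_
        refine Eq.trans ?_ (congr_arg (H.map f).hom (chainLift_chainOf _ _).symm)
        rw [h₂, h₁, h₁, H.map_comp]
        rfl }
  desc_elt {H} y i := by
    refine (chainLift_chainOf _ _).trans ?_
    have h₁ : (Equiv.ofBijective _ (he m)).symm e = 𝟙 m := by
      rw [Equiv.symm_apply_eq]
      simp
    rw [h₁, H.map_id]
    rfl
  hom_ext {H f g} h := by
    ext X : 2
    refine ModuleCat.hom_ext (chain_ext fun x => ?_)
    obtain ⟨φ, rfl⟩ := (he X).2 x
    have h₁ : ∀ k : term (S ⋙ chains R) n ⟶ H,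
        (k.app X).hom (chainOf ((S.map φ).app (Opposite.op ⦋n⦌) e)) =
          (H.map φ).hom ((k.app m).hom (chainOf e)) := fun k =>
      (congr_arg (k.app X).hom (map_chainOf (S.map φ) e).symm).trans
        (LinearMap.congr_fun (congr_arg ModuleCat.Hom.hom (k.naturality φ)) (chainOf e))
    exact (h₁ f).trans ((congr_arg (H.map φ).hom (h ())).trans (h₁ g).symm)

/-- The universal simplex. -/
abbrev universalSimplex (n : ℕ) : (Δ[n] : SSet.{u}) _⦋n⦌ := yonedaEquiv (𝟙 (Δ[n] : SSet.{u}))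

lemma app_universalSimplex {X : SSet.{u}} {n : ℕ} (f : Δ[n] ⟶ X) :
    f.app (Opposite.op ⦋n⦌) (universalSimplex n) = yonedaEquiv f := by
  rw [universalSimplex, ← yonedaEquiv_comp, Category.id_comp]

variable (R) in
/-- The chains of a product, as a functor. -/
abbrev prodChains : SSet.{u} × SSet.{u} ⥤ ChainComplex (ModuleCat.{u} R) ℕ :=
  tensor SSet.{u} ⋙ chains R

variable (R) in
/-- The tensor product of the chains, as a functor. -/
@[simps]
def tensorChains : SSet.{u} × SSet.{u} ⥤ ChainComplex (ModuleCat.{u} R) ℕ where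
  obj P := tensorComplex ((chains R).obj P.1) ((chains R).obj P.2)
  map f := tensorComplexMap ((chains R).map f.1) ((chains R).map f.2)
  map_id P := by
    ext n : 1
    refine ModuleCat.hom_ext (tensorX_ext fun a b hab x y => ?_)
    refine (tensorXMap_inTensor _ _ _ _ _ _).trans ?_
    rw [TensorProduct.map_tmul, prod_id_fst, prod_id_snd, CategoryTheory.Functor.map_id,
      CategoryTheory.Functor.map_id]
    rfl
  map_comp {P Q S} f g := by
    ext n : 1
    refine ModuleCat.hom_ext (tensorX_ext fun a b hab x y => ?_)
    refine (tensorXMap_inTensor _ _ _ _ _ _).trans ?_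
    refine Eq.trans ?_ (congr_arg (tensorXMap _ _ _) (tensorXMap_inTensor _ _ _ _ _ _).symm)
    refine Eq.trans ?_ (tensorXMap_inTensor _ _ _ _ _ _).symm
    rw [TensorProduct.map_tmul, TensorProduct.map_tmul, TensorProduct.map_tmul,
      prod_comp_fst, prod_comp_snd, Functor.map_comp, Functor.map_comp]
    rfl

/-- The chains of a product are free on products of simplices. -/
def prodChainsBasis (n : ℕ) : ModelBasis (term (prodChains.{u} R) n) :=
  corepBasis (tensor SSet.{u}) n (Δ[n], Δ[n]) (universalSimplex n, universalSimplex n) fun X => by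
    constructor
    · intro f g h
      refine Prod.ext (yonedaEquiv.injective ?_) (yonedaEquiv.injective ?_)
      · rw [← app_universalSimplex, ← app_universalSimplex]
        exact congr_arg Prod.fst h
      · rw [← app_universalSimplex, ← app_universalSimplex]
        exact congr_arg Prod.snd h
    · rintro ⟨x, y⟩
      refine ⟨(yonedaEquiv.symm x, yonedaEquiv.symm y), Prod.ext ?_ ?_⟩
      · exact (app_universalSimplex _).trans (yonedaEquiv.apply_symm_apply x)
      · exact (app_universalSimplex _).trans (yonedaEquiv.apply_symm_apply y)

lemma tensorChains_ext {X Y : SSet.{u}} {n : ℕ} {M : Type u} [AddCommGroup M] [Module R M]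
    {f g : TensorX ((chains R).obj X) ((chains R).obj Y) n →ₗ[R] M}
    (h : ∀ a b (hab : a + b = n) (x : X _⦋a⦌) (y : Y _⦋b⦌),
      f (inTensor _ _ a b hab (chainOf x ⊗ₜ chainOf y)) =
        g (inTensor _ _ a b hab (chainOf x ⊗ₜ chainOf y))) : f = g := by
  refine DirectSum.linearMap_ext R fun p => TensorProduct.ext ?_
  refine chain_ext fun x => chain_ext fun y => ?_
  exact h p.1.1 p.1.2 p.2 x y

/-- The map on tensor products of chains given by its values on pairs of simplices. -/
def tensorChainsLift {X Y : SSet.{u}} {n : ℕ} {M : Type u} [AddCommGroup M] [Module R M]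
    (f : ∀ p : {p : ℕ × ℕ // p.1 + p.2 = n}, X _⦋p.1.1⦌ → Y _⦋p.1.2⦌ → M) :
    TensorX ((chains R).obj X) ((chains R).obj Y) n →ₗ[R] M :=
  DirectSum.toModule R _ _ fun p => TensorProduct.lift
    (chainLift fun x => (chainLift fun y => f p x y :
      ((chains R).obj Y).X p.1.2 →ₗ[R] M))

lemma tensorChainsLift_inTensor {X Y : SSet.{u}} {n : ℕ} {M : Type u} [AddCommGroup M]
    [Module R M] (f : ∀ p : {p : ℕ × ℕ // p.1 + p.2 = n}, X _⦋p.1.1⦌ → Y _⦋p.1.2⦌ → M) (a b : ℕ)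
    (hab : a + b = n) (x : X _⦋a⦌) (y : Y _⦋b⦌) :
    tensorChainsLift (R := R) f (inTensor _ _ a b hab (chainOf x ⊗ₜ chainOf y)) =
      f ⟨(a, b), hab⟩ x y := by
  rw [tensorChainsLift, DirectSum.toModule_lof, TensorProduct.lift.tmul]
  exact (LinearMap.congr_fun (chainLift_chainOf _ _) _).trans (chainLift_chainOf _ _)

lemma tensorChains_map_chainOf {P Q : SSet.{u} × SSet.{u}} (f : P ⟶ Q) {n : ℕ} (a b : ℕ)
    (hab : a + b = n) (x : P.1 _⦋a⦌) (y : P.2 _⦋b⦌) :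
    tensorXMap ((chains R).map f.1) ((chains R).map f.2) n
      (inTensor _ _ a b hab (chainOf x ⊗ₜ chainOf y)) =
    inTensor _ _ a b hab (chainOf (f.1.app _ x) ⊗ₜ chainOf (f.2.app _ y)) := by
  refine (tensorXMap_inTensor _ _ _ _ _ _).trans ?_
  rw [TensorProduct.map_tmul]
  exact congr_arg _ (congr_arg₂ (· ⊗ₜ ·) (map_chainOf _ _) (map_chainOf _ _))

/-- The morphism from a pair of standard simplices given by a pair of simplices. -/
def simplexPair {P : SSet.{u} × SSet.{u}} {a b : ℕ} (x : P.1 _⦋a⦌) (y : P.2 _⦋b⦌) :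
    ((Δ[a], Δ[b]) : SSet.{u} × SSet.{u}) ⟶ P :=
  (yonedaEquiv.symm x, yonedaEquiv.symm y)

lemma simplexPair_comp {P Q : SSet.{u} × SSet.{u}} {a b : ℕ} (x : P.1 _⦋a⦌) (y : P.2 _⦋b⦌)
    (f : P ⟶ Q) : simplexPair x y ≫ f = simplexPair (f.1.app _ x) (f.2.app _ y) :=
  Prod.ext (yonedaEquiv_symm_comp x f.1) (yonedaEquiv_symm_comp y f.2)

lemma simplexPair_universalSimplex (a b : ℕ) :
    simplexPair (P := (Δ[a], Δ[b])) (universalSimplex.{u} a) (universalSimplex.{u} b) = 𝟙 _ :=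
  Prod.ext (yonedaEquiv.symm_apply_apply (𝟙 (Δ[a] : SSet.{u})))
    (yonedaEquiv.symm_apply_apply (𝟙 (Δ[b] : SSet.{u})))

variable (R) in
/-- The tensor product of universal simplices. -/
def universalTensor (a b n : ℕ) (hab : a + b = n) :
    TensorX ((chains.{u} R).obj Δ[a]) ((chains R).obj Δ[b]) n :=
  inTensor _ _ a b hab (chainOf (universalSimplex a) ⊗ₜ chainOf (universalSimplex b))

lemma map_simplexPair_universalTensor {P : SSet.{u} × SSet.{u}} {n : ℕ} (a b : ℕ)
    (hab : a + b = n) (x : P.1 _⦋a⦌) (y : P.2 _⦋b⦌) :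
    tensorXMap ((chains R).map (simplexPair x y).1) ((chains R).map (simplexPair x y).2) n
      (universalTensor R a b n hab) = inTensor _ _ a b hab (chainOf x ⊗ₜ chainOf y) := by
  refine (tensorChains_map_chainOf (simplexPair x y) a b hab _ _).trans ?_
  rw [app_universalSimplex, app_universalSimplex, simplexPair, Equiv.apply_symm_apply,
    Equiv.apply_symm_apply]

/-- The tensor products of chains are free on pairs of simplices. -/
def tensorChainsBasis (n : ℕ) : ModelBasis (term (tensorChains.{u} R) n) where
  index := {p : ℕ × ℕ // p.1 + p.2 = n}
  model p := (Δ[p.1.1], Δ[p.1.2])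
  elt p := universalTensor R p.1.1 p.1.2 n p.2
  desc {H} t :=
    let T (P : SSet.{u} × SSet.{u}) : TensorX ((chains R).obj P.1) ((chains R).obj P.2) n →ₗ[R]
        H.obj P := tensorChainsLift fun p x y => (H.map (simplexPair x y)).hom (t p)
    { app P := ModuleCat.ofHom (T P)
      naturality P Q f := by
        refine ModuleCat.hom_ext (tensorChains_ext fun a b hab x y => ?_)
        change T Q (tensorXMap ((chains R).map f.1) ((chains R).map f.2) n
          (inTensor ((chains R).obj P.1) ((chains R).obj P.2) a b hab
            (chainOf x ⊗ₜ chainOf y))) = (H.map f).hom (T P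
          (inTensor ((chains R).obj P.1) ((chains R).obj P.2) a b hab (chainOf x ⊗ₜ chainOf y)))
        rw [tensorChains_map_chainOf, tensorChainsLift_inTensor, tensorChainsLift_inTensor,
          ← simplexPair_comp, H.map_comp]
        rfl }
  desc_elt {H} t p := by
    refine (tensorChainsLift_inTensor _ _ _ _ _ _).trans ?_
    rw [simplexPair_universalSimplex, H.map_id]
    rfl
  hom_ext {H f g} h := by
    ext P : 2
    refine ModuleCat.hom_ext (tensorChains_ext fun a b hab x y => ?_)
    have h₁ : ∀ k : term (tensorChains R) n ⟶ H,
        (k.app P).hom (inTensor ((chains R).obj P.1) ((chains R).obj P.2) a b hab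
          (chainOf x ⊗ₜ chainOf y)) =
          (H.map (simplexPair x y)).hom ((k.app (Δ[a], Δ[b])).hom
            (universalTensor R a b n hab)) := fun k =>
      (congr_arg (k.app P).hom (map_simplexPair_universalTensor a b hab x y).symm).trans
        (LinearMap.congr_fun (congr_arg ModuleCat.Hom.hom (k.naturality (simplexPair x y))) _)
    exact (h₁ f).trans ((congr_arg (H.map (simplexPair x y)).hom (h ⟨(a, b), hab⟩)).trans
      (h₁ g).symm)

/-- The map from chains of the product to tensor products of chains in degree zero. -/
def diagonalZeroMap (P : SSet.{u} × SSet.{u}) : ((chains R).obj (P.1 ⊗ P.2)).X 0 →ₗ[R]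
    TensorX ((chains R).obj P.1) ((chains R).obj P.2) 0 :=
  chainLift (X := P.1 ⊗ P.2) fun (x : P.1 _⦋0⦌ × P.2 _⦋0⦌) =>
    inTensor _ _ 0 0 rfl (chainOf x.1 ⊗ₜ chainOf x.2)

lemma diagonalZeroMap_chainOf (P : SSet.{u} × SSet.{u}) (x : P.1 _⦋0⦌) (y : P.2 _⦋0⦌) :
    diagonalZeroMap (R := R) P (chainOf (X := P.1 ⊗ P.2) (n := 0) (x, y)) =
      inTensor ((chains R).obj P.1) ((chains R).obj P.2) 0 0 rfl (chainOf x ⊗ₜ chainOf y) :=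
  chainLift_chainOf _ _

/-- The transformation from chains of the product to tensor products of chains in degree zero. -/
def diagonalZero : term (prodChains.{u} R) 0 ⟶ term (tensorChains R) 0 where
  app P := ModuleCat.ofHom (diagonalZeroMap P)
  naturality P Q f := by
    refine ModuleCat.hom_ext (chain_ext fun (x : P.1 _⦋0⦌ × P.2 _⦋0⦌) => ?_)
    change diagonalZeroMap Q _ = tensorXMap ((chains R).map f.1) ((chains R).map f.2) 0
      (diagonalZeroMap P (chainOf (X := P.1 ⊗ P.2) (n := 0) (x.1, x.2)))
    rw [diagonalZeroMap_chainOf, tensorChains_map_chainOf]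
    exact (congr_arg (diagonalZeroMap Q) (map_chainOf ((tensor SSet).map f) _)).trans
      (diagonalZeroMap_chainOf Q _ _)

/-- The initial vertex of a simplex. -/
def initialVertex {X : SSet.{u}} {n : ℕ} (x : X _⦋n⦌) : X _⦋0⦌ :=
  X.map (SimplexCategory.const ⦋0⦌ ⦋n⦌ 0).op x

lemma initialVertex_zero {X : SSet.{u}} (x : X _⦋0⦌) : initialVertex x = x := by
  have : SimplexCategory.const ⦋0⦌ ⦋0⦌ 0 = 𝟙 _ := by subsingleton
  rw [initialVertex, this, op_id, Functor.map_id_apply]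

/-- The map from tensor products of chains to chains of the product in degree zero. -/
def crossZeroMap (P : SSet.{u} × SSet.{u}) :
    TensorX ((chains R).obj P.1) ((chains R).obj P.2) 0 →ₗ[R]
      ((chains R).obj (P.1 ⊗ P.2)).X 0 :=
  -- The degrees of `x` and `y` are known to vanish only through their sum. The initial vertex gives
  -- a 0-simplex in any degree and is the identity in degree zero, which avoids transport along
  -- equalities.
  tensorChainsLift fun _ x y =>
      chainOf (X := P.1 ⊗ P.2) (n := 0) (initialVertex x, initialVertex y)

lemma crossZeroMap_inTensor (P : SSet.{u} × SSet.{u}) (x : P.1 _⦋0⦌) (y : P.2 _⦋0⦌) :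
    crossZeroMap P
      (inTensor ((chains R).obj P.1) ((chains R).obj P.2) 0 0 rfl (chainOf x ⊗ₜ chainOf y)) =
      chainOf (X := P.1 ⊗ P.2) (n := 0) (x, y) := by
  refine (tensorChainsLift_inTensor _ _ _ _ _ _).trans ?_
  rw [initialVertex_zero, initialVertex_zero]

/-- The transformation from tensor products of chains to chains of the product in degree zero. -/
def crossZero : term (tensorChains.{u} R) 0 ⟶ term (prodChains R) 0 where
  app P := ModuleCat.ofHom (crossZeroMap (R := R) P)
  naturality P Q f := by
    refine ModuleCat.hom_ext (tensorChains_ext fun a b hab x y => ?_)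
    obtain rfl : a = 0 := by omega
    obtain rfl : b = 0 := by omega
    change crossZeroMap (R := R) Q (tensorXMap ((chains R).map f.1) ((chains R).map f.2) 0
      (inTensor ((chains R).obj P.1) ((chains R).obj P.2) 0 0 rfl (chainOf x ⊗ₜ chainOf y))) =
      (((chains R).map ((tensor SSet).map f)).f 0).hom (crossZeroMap P
        (inTensor ((chains R).obj P.1) ((chains R).obj P.2) 0 0 rfl (chainOf x ⊗ₜ chainOf y)))
    rw [tensorChains_map_chainOf, crossZeroMap_inTensor, crossZeroMap_inTensor]
    exact (map_chainOf (R := R) (X := P.1 ⊗ P.2) (Y := Q.1 ⊗ Q.2) (n := 0) ((tensor SSet).map f)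
      ((x, y) : P.1 _⦋0⦌ × P.2 _⦋0⦌)).symm

/-- With the identity for the opposite composite, this is all that Eilenberg–Zilber needs
explicitly: acyclic models show that the extended composites then act as the identity on homology.
-/
lemma diagonalZero_crossZero (P : SSet.{u} × SSet.{u}) :
    diagonalZero.app P ≫ crossZero.app P = 𝟙 ((term (prodChains R) 0).obj P) := by
  refine ModuleCat.hom_ext (chain_ext fun (x : P.1 _⦋0⦌ × P.2 _⦋0⦌) => ?_)
  exact (congr_arg (crossZeroMap P) (diagonalZeroMap_chainOf P x.1 x.2)).trans
    (crossZeroMap_inTensor P x.1 x.2)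

lemma crossZero_diagonalZero (P : SSet.{u} × SSet.{u}) :
    crossZero.app P ≫ diagonalZero.app P = 𝟙 ((term (tensorChains R) 0).obj P) := by
  refine ModuleCat.hom_ext (tensorChains_ext fun a b hab x y => ?_)
  obtain rfl : a = 0 := by omega
  obtain rfl : b = 0 := by omega
  exact (congr_arg (diagonalZeroMap P) (crossZeroMap_inTensor P x y)).trans
    (diagonalZeroMap_chainOf P x y)

lemma tensorXD_one_zero {K L : ChainComplex (ModuleCat.{u} R) ℕ} (x : K.X 1) (y : L.X 0) :
    tensorXD K L 0 (inTensor K L 1 0 rfl (x ⊗ₜ y)) =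
      inTensor K L 0 0 rfl ((K.d 1 0).hom x ⊗ₜ y) := by
  apply tensorIncl_injective
  rw [tensorIncl_tensorXD, tensorIncl_inTensor, tensorIncl_inTensor, TensorProduct.map_tmul,
    TensorProduct.map_tmul, totalTensorD_tmul, d_zero_apply, map_zero, TensorProduct.tmul_zero,
    smul_zero, add_zero]

lemma tensorXD_zero_one {K L : ChainComplex (ModuleCat.{u} R) ℕ} (x : K.X 0) (y : L.X 1) :
    tensorXD K L 0 (inTensor K L 0 1 rfl (x ⊗ₜ y)) =
      inTensor K L 0 0 rfl (x ⊗ₜ (L.d 1 0).hom y) := by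
  apply tensorIncl_injective
  rw [tensorIncl_tensorXD, tensorIncl_inTensor, tensorIncl_inTensor, TensorProduct.map_tmul,
    TensorProduct.map_tmul, totalTensorD_tmul, d_zero_apply, map_zero, TensorProduct.zero_tmul,
    zero_add, pow_zero, one_smul]

lemma d_one_chainOf {X : SSet.{u}} (x : X _⦋1⦌) :
    (((chains R).obj X).d 1 0).hom (chainOf x) = chainOf (X.δ 0 x) - chainOf (X.δ 1 x) := by
  refine (d_chainOf x).trans ?_
  rw [Fin.sum_univ_two]
  simp [sub_eq_add_neg]

lemma exists_d_eq_diagonalZero (P : SSet.{u} × SSet.{u}) (x : P.1 _⦋1⦌) (y : P.2 _⦋1⦌) :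
    ∃ t : ((tensorChains R).obj P).X 1, (((tensorChains R).obj P).d 1 0).hom t =
      (diagonalZero.app P).hom
        ((((prodChains R).obj P).d 1 0).hom (chainOf (X := P.1 ⊗ P.2) (x, y))) := by
  let K := (chains R).obj P.1
  let L := (chains R).obj P.2
  -- The Alexander–Whitney formula in degree one: `x` with the last vertex of `y`, plus the first
  -- vertex of `x` with `y`. The mixed terms of its boundary cancel.
  let t : TensorX K L 1 := inTensor K L 1 0 rfl (chainOf x ⊗ₜ chainOf (P.2.δ 0 y)) +
    inTensor K L 0 1 rfl (chainOf (P.1.δ 1 x) ⊗ₜ chainOf y)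
  refine ⟨t, ?_⟩
  have h : tensorXD K L 0 t = inTensor K L 0 0 rfl (chainOf (P.1.δ 0 x) ⊗ₜ chainOf (P.2.δ 0 y)) -
      inTensor K L 0 0 rfl (chainOf (P.1.δ 1 x) ⊗ₜ chainOf (P.2.δ 1 y)) := by
    rw [map_add, tensorXD_one_zero, tensorXD_zero_one, d_one_chainOf, d_one_chainOf,
      TensorProduct.sub_tmul, TensorProduct.tmul_sub, map_sub, map_sub]
    abel
  refine (LinearMap.congr_fun (congr_arg ModuleCat.Hom.hom (tensorComplex_d 0)) t).trans
    (h.trans ?_)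
  refine Eq.trans ?_ (congr_arg _ (d_one_chainOf (X := P.1 ⊗ P.2) (x, y)).symm)
  refine Eq.trans ?_ (map_sub (diagonalZeroMap P) _ _).symm
  exact congr_arg₂ (· - ·) (diagonalZeroMap_chainOf P _ _).symm (diagonalZeroMap_chainOf P _ _).symm

/-- The bounding edge pairs the given edge with the degenerate edge on the given vertex, as in the
shuffle map. -/
lemma exists_d_eq_crossZero (P : SSet.{u} × SSet.{u}) (a b : ℕ) (hab : a + b = 1) (x : P.1 _⦋a⦌)
    (y : P.2 _⦋b⦌) :
    ∃ t : ((prodChains R).obj P).X 1, (((prodChains R).obj P).d 1 0).hom t =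
      (crossZero.app P).hom ((((tensorChains R).obj P).d 1 0).hom
        (inTensor ((chains R).obj P.1) ((chains R).obj P.2) a b hab (chainOf x ⊗ₜ chainOf y))) := by
  let K := (chains R).obj P.1
  let L := (chains R).obj P.2
  obtain ⟨rfl, rfl⟩ | ⟨rfl, rfl⟩ : (a = 1 ∧ b = 0) ∨ (a = 0 ∧ b = 1) := by omega
  · have h : ∀ i : Fin 2, P.2.δ i (P.2.σ 0 y) = y := fun i => by
      fin_cases i
      · exact ConcreteCategory.congr_hom (P.2.δ_comp_σ_self (i := 0)) y
      · exact ConcreteCategory.congr_hom (P.2.δ_comp_σ_succ (i := 0)) y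
    have h' : ∀ i : Fin 2, (P.1 ⊗ P.2).δ i (x, P.2.σ 0 y) = (P.1.δ i x, y) := fun i =>
      Prod.ext rfl (h i)
    refine ⟨chainOf (X := P.1 ⊗ P.2) (n := 1) (x, P.2.σ 0 y), ?_⟩
    refine (d_one_chainOf (X := P.1 ⊗ P.2) _).trans ?_
    refine Eq.trans ?_ (congr_arg (crossZeroMap P) (LinearMap.congr_fun (congr_arg
      ModuleCat.Hom.hom (tensorComplex_d 0)) _).symm)
    refine Eq.trans ?_ (congr_arg (crossZeroMap P) (tensorXD_one_zero _ _).symm)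
    rw [d_one_chainOf, TensorProduct.sub_tmul, map_sub, map_sub, crossZeroMap_inTensor,
      crossZeroMap_inTensor]
    exact congr_arg₂ (· - ·) (congr_arg chainOf (h' 0)) (congr_arg chainOf (h' 1))
  · have h : ∀ i : Fin 2, P.1.δ i (P.1.σ 0 x) = x := fun i => by
      fin_cases i
      · exact ConcreteCategory.congr_hom (P.1.δ_comp_σ_self (i := 0)) x
      · exact ConcreteCategory.congr_hom (P.1.δ_comp_σ_succ (i := 0)) x
    have h' : ∀ i : Fin 2, (P.1 ⊗ P.2).δ i (P.1.σ 0 x, y) = (x, P.2.δ i y) := fun i =>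
      Prod.ext (h i) rfl
    refine ⟨chainOf (X := P.1 ⊗ P.2) (n := 1) (P.1.σ 0 x, y), ?_⟩
    refine (d_one_chainOf (X := P.1 ⊗ P.2) _).trans ?_
    refine Eq.trans ?_ (congr_arg (crossZeroMap P) (LinearMap.congr_fun (congr_arg
      ModuleCat.Hom.hom (tensorComplex_d 0)) _).symm)
    refine Eq.trans ?_ (congr_arg (crossZeroMap P) (tensorXD_zero_one _ _).symm)
    rw [d_one_chainOf, TensorProduct.tmul_sub, map_sub, map_sub, crossZeroMap_inTensor,
      crossZeroMap_inTensor]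
    exact congr_arg₂ (· - ·) (congr_arg chainOf (h' 0)) (congr_arg chainOf (h' 1))

section Acyclic

lemma posAcyclic_of_subsingleton_homology {K : ChainComplex (ModuleCat.{u} R) ℕ}
    (h : ∀ n, Subsingleton (K.homology (n + 1))) : PosAcyclic K := by
  intro n z hz
  have := h n
  exact (cls_eq_zero_iff (K := K) (n := n + 1) ⟨z, hz⟩).1 (Subsingleton.elim _ _)

lemma PosAcyclic.subsingleton_homology {K : ChainComplex (ModuleCat.{u} R) ℕ} (h : PosAcyclic K)
    (n : ℕ) : Subsingleton (K.homology (n + 1)) := by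
  refine subsingleton_of_forall_eq 0 fun x => ?_
  obtain ⟨z, rfl⟩ := cls_surjective _ x
  exact (cls_eq_zero_iff z).2 (h n z.1 z.2)

lemma projective_coeffObj : Projective (coeffObj.{u} R) :=
  (IsProjective.iff_projective (R := R) (ULift.{u} R)).1
    (Module.Projective.of_equiv ULift.moduleEquiv.symm)

lemma projective_homology_zero (X : SSet.{u}) :
    Projective (((chains R).obj X).homology 0) := by
  have := projective_coeffObj.{u} (R := R)
  exact Projective.of_iso (X.homology₀Iso (coeffObj.{u} R)).symm inferInstance

lemma isZero_torOne_of_projective (A B : ModuleCat.{u} R) [Projective B] : IsZero (torOne A B) :=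
  (tensorFunctor A).isZero_leftDerived_obj_projective_succ 0 B

/-- The algebraic Künneth formula applies to the models: the homology of `Δ[b]` is projective in
degree zero and vanishes above, so there is no torsion, and in positive total degree each summand
has a zero factor. -/
lemma posAcyclic_tensorChains_stdSimplex [IsHereditaryRing.{u} R] (a b : ℕ) :
    PosAcyclic ((tensorChains.{u} R).obj (Δ[a], Δ[b])) := by
  have hd : ∀ a : ℕ, PosAcyclic ((chains.{u} R).obj Δ[a]) := fun a n z hz =>
    exists_d_eq_stdSimplex a n z hz
  refine posAcyclic_of_subsingleton_homology fun n => ?_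
  have hs := crossSum_surjective (K := (chains.{u} R).obj Δ[a]) (L := (chains.{u} R).obj Δ[b])
    (fun i j => by
      have : Projective (((chains.{u} R).obj Δ[b]).homology j) := by
        cases j with
        | zero => exact projective_homology_zero _
        | succ j =>
          have := PosAcyclic.subsingleton_homology (hd b) j
          exact (ModuleCat.isZero_of_subsingleton _).projective
      exact isZero_torOne_of_projective _ _) (n + 1)
  have : Subsingleton (HomologyTensor ((chains.{u} R).obj Δ[a]) ((chains.{u} R).obj Δ[b])
      (n + 1)) := by
    have : ∀ p : {p : ℕ × ℕ // p.1 + p.2 = n + 1}, Subsingleton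
        (((chains.{u} R).obj Δ[a]).homology p.1.1 ⊗[R]
          ((chains.{u} R).obj Δ[b]).homology p.1.2) := by
      rintro ⟨⟨i, j⟩, hij⟩
      cases i with
      | succ i =>
        have := PosAcyclic.subsingleton_homology (hd a) i
        infer_instance
      | zero =>
        obtain rfl : j = n + 1 := by simpa using hij
        have := PosAcyclic.subsingleton_homology (hd b) n
        infer_instance
    infer_instance
  exact hs.subsingleton

end Acyclic

section EilenbergZilber

lemma posAcyclic_prodChains_model (a b : ℕ) :
    PosAcyclic ((prodChains.{u} R).obj (Δ[a], Δ[b])) := fun n z hz =>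
  exists_d_eq_stdSimplex_tensor a b n z hz

lemma exists_cross : ∃ f : tensorChains.{u} R ⟶ prodChains R,
    ∀ P, (f.app P).f 0 = crossZero.app P := by
  refine exists_natTrans (tensorChainsBasis (R := R)) ?_ crossZero ?_
  · intro n i
    exact posAcyclic_prodChains_model i.1.1 i.1.2
  · rintro i
    exact exists_d_eq_crossZero ((tensorChainsBasis (R := R) 1).model i) i.1.1 i.1.2 i.2
      (universalSimplex i.1.1) (universalSimplex i.1.2)

variable [IsHereditaryRing.{u} R]

lemma exists_diagonal : ∃ f : prodChains.{u} R ⟶ tensorChains R,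
    ∀ P, (f.app P).f 0 = diagonalZero.app P :=
  exists_natTrans (prodChainsBasis (R := R))
    (fun n _ => posAcyclic_tensorChains_stdSimplex n n) diagonalZero
    fun _ => exists_d_eq_diagonalZero (Δ[1], Δ[1]) (universalSimplex 1) (universalSimplex 1)

variable (R) in
/-- The Eilenberg–Zilber theorem in homology. -/
theorem exists_eilenbergZilber :
    ∃ f : prodChains.{u} R ⟶ tensorChains R,
      ∀ P n, IsIso (HomologicalComplex.homologyMap (f.app P) n) := by
  obtain ⟨f, hf⟩ := exists_diagonal.{u} (R := R)
  obtain ⟨g, hg⟩ := exists_cross.{u} (R := R)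
  -- Each composite agrees with the identity in degree zero, and its functor is both free and
  -- acyclic on its own models.
  have hfg := homologyMap_eq (prodChainsBasis (R := R))
    (fun n _ => posAcyclic_prodChains_model n n) (f ≫ g) (𝟙 _) fun X => by
      rw [NatTrans.comp_app, HomologicalComplex.comp_f, hf, hg]
      exact diagonalZero_crossZero X
  have hgf := homologyMap_eq (tensorChainsBasis (R := R))
    (fun _ i => posAcyclic_tensorChains_stdSimplex i.1.1 i.1.2) (g ≫ f) (𝟙 _) fun X => by
      rw [NatTrans.comp_app, HomologicalComplex.comp_f, hf, hg]
      exact crossZero_diagonalZero X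
  refine ⟨f, fun P n => ⟨HomologicalComplex.homologyMap (g.app P) n, ?_, ?_⟩⟩
  · rw [← HomologicalComplex.homologyMap_comp, ← NatTrans.comp_app, hfg, NatTrans.id_app,
      HomologicalComplex.homologyMap_id]
  · rw [← HomologicalComplex.homologyMap_comp, ← NatTrans.comp_app, hgf, NatTrans.id_app,
      HomologicalComplex.homologyMap_id]

end EilenbergZilber

end SSet

end

noncomputable section

/-! ### The Künneth formula for spaces -/

namespace TopCat

open MonoidalCategory ChainComplex SSet

variable (R : Type) [CommRing R]

/-- The singular chain complex of a space. -/
abbrev singularChains : TopCat.{u} ⥤ ChainComplex (ModuleCat.{u} R) ℕ :=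
  TopCat.toSSet ⋙ chains R

/-- The natural isomorphism between the chains of a product of spaces and the chains of the product
of the singular sets. -/
def chainsProdIso (X Y : TopCat.{u}) : (singularChains R).obj (X ⊗ Y) ≅
    (prodChains R).obj (toSSet.obj X, toSSet.obj Y) :=
  (chains R).mapIso (Functor.Monoidal.μIso toSSet X Y).symm

variable {R}

instance projective_singularChains (X : TopCat.{u}) (n : ℕ) :
    Module.Projective R (((singularChains R).obj X).X n) :=
  projective_chains (toSSet.obj X) n

lemma chainsProdIso_hom_naturality {X Y X' Y' : TopCat.{u}} (f : X ⟶ X') (g : Y ⟶ Y') :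
    (singularChains R).map (f ⊗ₘ g) ≫ (chainsProdIso R X' Y').hom =
      (chainsProdIso R X Y).hom ≫ (prodChains R).map (X := (toSSet.obj X, toSSet.obj Y))
        (Y := (toSSet.obj X', toSSet.obj Y')) (toSSet.map f, toSSet.map g) := by
  refine ((chains R).map_comp _ _).symm.trans (Eq.trans ?_ ((chains R).map_comp _ _))
  exact congr_arg (chains R).map (Functor.OplaxMonoidal.δ_natural toSSet f g).symm

variable (R) in
/-- The Künneth formula for singular homology. -/
theorem exists_kunneth [IsHereditaryRing.{u} R] :
    ∃ κ : ∀ (X Y : TopCat.{u}) (n : ℕ),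
      HomologyTensor ((singularChains R).obj X) ((singularChains R).obj Y) n →ₗ[R]
        (homologyFunctor R n).obj (X ⊗ Y),
      (∀ X Y n, Function.Injective (κ X Y n)) ∧
      (∀ X Y n, (∀ i j, IsZero (torOne ((homologyFunctor R i).obj X)
        ((homologyFunctor R j).obj Y))) → Function.Surjective (κ X Y n)) ∧
      ∀ (X Y X' Y' : TopCat.{u}) (f : X ⟶ X') (g : Y ⟶ Y') (n : ℕ) (t : HomologyTensor _ _ n),
        ((homologyFunctor R n).map (f ⊗ₘ g)).hom (κ X Y n t) =
          κ X' Y' n (homologyTensorMap ((singularChains R).map f)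
            ((singularChains R).map g) n t) := by
  obtain ⟨φ, hφ⟩ := exists_eilenbergZilber.{u} R
  let ψ (X Y : TopCat.{u}) (n : ℕ) : (homologyFunctor R n).obj (X ⊗ Y) ≅
      (tensorComplex ((singularChains R).obj X) ((singularChains R).obj Y)).homology n :=
    (HomologicalComplex.homologyFunctor _ _ n).mapIso (chainsProdIso R X Y) ≪≫
      @asIso _ _ _ _ (HomologicalComplex.homologyMap (φ.app (toSSet.obj X, toSSet.obj Y)) n)
        (hφ _ n)
  -- The Künneth map is the algebraic cross product followed by the inverse of the Eilenberg–Zilber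
  -- isomorphism; torsion affects only the surjectivity of the cross product.
  refine ⟨fun X Y n => (ψ X Y n).inv.hom ∘ₗ crossSum _ _ n, fun X Y n => ?_,
    fun X Y n hTor => ?_, fun X Y X' Y' f g n t => ?_⟩
  · exact ((ψ X Y n).symm.toLinearEquiv.injective).comp (crossSum_injective
      (K := (singularChains R).obj X) (L := (singularChains R).obj Y) n)
  · exact ((ψ X Y n).symm.toLinearEquiv.surjective).comp (crossSum_surjective
      (K := (singularChains R).obj X) (L := (singularChains R).obj Y) hTor n)
  · have h : (homologyFunctor R n).map (f ⊗ₘ g) ≫ (ψ X' Y' n).hom = (ψ X Y n).hom ≫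
        HomologicalComplex.homologyMap (tensorComplexMap ((singularChains R).map f)
          ((singularChains R).map g)) n := by
      have h₁ := congr_arg (fun k => HomologicalComplex.homologyMap k n)
        (chainsProdIso_hom_naturality (R := R) f g)
      have h₂ := congr_arg (fun k => HomologicalComplex.homologyMap k n)
        (φ.naturality (X := (toSSet.obj X, toSSet.obj Y))
        (Y := (toSSet.obj X', toSSet.obj Y')) (toSSet.map f, toSSet.map g))
      simp only [HomologicalComplex.homologyMap_comp] at h₁ h₂
      change HomologicalComplex.homologyMap ((singularChains R).map (f ⊗ₘ g)) n ≫
        HomologicalComplex.homologyMap (chainsProdIso R X' Y').hom n ≫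
        HomologicalComplex.homologyMap (φ.app (toSSet.obj X', toSSet.obj Y')) n =
        (HomologicalComplex.homologyMap (chainsProdIso R X Y).hom n ≫
        HomologicalComplex.homologyMap (φ.app (toSSet.obj X, toSSet.obj Y)) n) ≫ _
      rw [← Category.assoc, h₁, Category.assoc, h₂]
      exact (Category.assoc _ _ _).symm
    apply (ψ X' Y' n).toLinearEquiv.injective
    have h' := LinearMap.congr_fun (congr_arg ModuleCat.Hom.hom h)
      ((ψ X Y n).inv.hom (crossSum _ _ n t))
    refine h'.trans ?_
    have h₃ : (ψ X Y n).hom.hom ((ψ X Y n).inv.hom (crossSum _ _ n t)) = crossSum _ _ n t :=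
      (ψ X Y n).toLinearEquiv.apply_symm_apply _
    refine (congr_arg (HomologicalComplex.homologyMap (tensorComplexMap ((singularChains R).map f)
      ((singularChains R).map g)) n).hom h₃).trans ?_
    refine (homologyMap_crossSum _ _ n t).trans ?_
    exact ((ψ X' Y' n).toLinearEquiv.apply_symm_apply _).symm

end TopCat

end

noncomputable section

/-! ### Homotopy invariance -/

namespace TopCat

open MonoidalCategory ChainComplex SSet AcyclicModels

variable {R : Type} [CommRing R]

lemma homologyFunctor_map_eq {X Y : TopCat.{u}} {f g : X ⟶ Y}
    (h : ContinuousMap.Homotopic f.hom g.hom) (n : ℕ) :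
    (homologyFunctor R n).map f = (homologyFunctor R n).map g := by
  obtain ⟨H⟩ := h
  exact TopCat.Homotopy.congr_homologyMap_singularChainComplexFunctor (f := f) (g := g) H
    (ModuleCat.of R (ULift.{u} R)) n

/-- A homotopy equivalence induces isomorphisms in homology. -/
lemma isIso_homologyFunctor_map {X Y : TopCat.{u}} (f : X ⟶ Y) (g : Y ⟶ X)
    (h : ContinuousMap.Homotopic (f ≫ g).hom (.id X))
    (h' : ContinuousMap.Homotopic (g ≫ f).hom (.id Y)) (n : ℕ) :
    IsIso ((homologyFunctor R n).map f) := by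
  refine ⟨(homologyFunctor R n).map g, ?_, ?_⟩
  · rw [← Functor.map_comp, homologyFunctor_map_eq (g := 𝟙 X) h, CategoryTheory.Functor.map_id]
  · rw [← Functor.map_comp, homologyFunctor_map_eq (g := 𝟙 Y) h', CategoryTheory.Functor.map_id]

/-- The identity is homotopic to a map factoring through a point, whose homology vanishes in
positive degrees. -/
lemma isZero_homologyFunctor_of_contractible (X : TopCat.{u}) [ContractibleSpace X] (n : ℕ) :
    IsZero ((homologyFunctor R (n + 1)).obj X) := by
  obtain ⟨x, ⟨H⟩⟩ := id_nullhomotopic X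
  have h := homologyFunctor_map_eq (R := R) (f := 𝟙 X)
    (g := ofHom (.const X PUnit.unit) ≫ ofHom (.const PUnit.{u + 1} x)) ⟨H⟩ (n + 1)
  rw [Functor.map_comp, CategoryTheory.Functor.map_id] at h
  have hz : IsZero ((homologyFunctor.{u} R (n + 1)).obj (TopCat.of PUnit)) :=
    AlgebraicTopology.isZero_singularHomologyFunctor_of_totallyDisconnectedSpace _ (n + 1) _ _
      (Nat.succ_ne_zero n)
  rw [IsZero.iff_id_eq_zero, h, hz.eq_zero_of_tgt ((homologyFunctor R (n + 1)).map _), zero_comp]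

lemma posAcyclic_of_contractible (X : TopCat.{u}) [ContractibleSpace X] :
    PosAcyclic ((singularChains R).obj X) :=
  posAcyclic_of_subsingleton_homology fun n =>
    ModuleCat.subsingleton_of_isZero (isZero_homologyFunctor_of_contractible X n)

end TopCat

end

noncomputable section

/-! ### Convex combinations in standard simplices -/

namespace stdSimplex

variable {ι κ τ : Type} [Fintype ι] [Fintype κ] [Fintype τ]

/-- The convex combination of points of a simplex. -/
def comb (t : stdSimplex ℝ κ) (v : κ → stdSimplex ℝ ι) : stdSimplex ℝ ι :=
  ⟨fun x => ∑ i, t i * v i x, fun x => Finset.sum_nonneg fun i _ => mul_nonneg (t.2.1 i)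
    ((v i).2.1 x), by
    rw [Finset.sum_comm]
    simp only [← Finset.mul_sum]
    have h : ∀ i, ∑ x, v i x = 1 := fun i => (v i).2.2
    simp only [h, mul_one]
    exact t.2.2⟩

lemma comb_apply (t : stdSimplex ℝ κ) (v : κ → stdSimplex ℝ ι) (x : ι) :
    comb t v x = ∑ i, t i * v i x := rfl

lemma comb_coe (t : stdSimplex ℝ κ) (v : κ → stdSimplex ℝ ι) :
    (comb t v : ι → ℝ) = ∑ i, t i • (v i : ι → ℝ) := by
  ext x
  rw [comb_apply, Finset.sum_apply]
  rfl

lemma continuous_comb (v : κ → stdSimplex ℝ ι) : Continuous fun t => comb t v := by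
  refine Continuous.subtype_mk (continuous_pi fun x => continuous_finsetSum _ fun i _ => ?_) _
  exact ((continuous_apply i).comp continuous_subtype_val).mul continuous_const

lemma comb_vertex [DecidableEq κ] (i : κ) (v : κ → stdSimplex ℝ ι) :
    comb (vertex i) v = v i := by
  refine stdSimplex.ext (funext fun x => ?_)
  rw [comb_apply]
  rw [Finset.sum_eq_single i]
  · simp [vertex_coe]
  · intro j _ hj
    simp [vertex_coe, hj]
  · simp

lemma comb_map (f : κ → τ) (t : stdSimplex ℝ κ) (v : τ → stdSimplex ℝ ι) :
    comb (map f t) v = comb t (v ∘ f) := by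
  classical
  refine stdSimplex.ext (funext fun x => ?_)
  rw [comb_apply, comb_apply]
  simp only [map_coe, FunOnFinite.linearMap_apply_apply, Finset.sum_mul]
  rw [← Finset.sum_fiberwise Finset.univ f]
  refine Finset.sum_congr rfl fun j _ => Finset.sum_congr rfl fun i hi => ?_
  rw [Function.comp_apply, (Finset.mem_filter.1 hi).2]

lemma comb_vertex_right [DecidableEq ι] (t : stdSimplex ℝ ι) : comb t vertex = t := by
  refine stdSimplex.ext (funext fun x => ?_)
  rw [comb_apply, Finset.sum_eq_single x]
  · simp [vertex_coe]
  · intro j _ hj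
    simp [vertex_coe, hj.symm]
  · simp

lemma comb_comb (t : stdSimplex ℝ τ) (v : τ → stdSimplex ℝ κ) (w : κ → stdSimplex ℝ ι) :
    comb (comb t v) w = comb t fun i => comb (v i) w := by
  refine stdSimplex.ext (funext fun x => ?_)
  simp only [comb_apply, Finset.sum_mul, Finset.mul_sum]
  rw [Finset.sum_comm]
  simp only [mul_assoc]

lemma dist_comb_le_sum (t : stdSimplex ℝ κ) (v : κ → stdSimplex ℝ ι) (p : stdSimplex ℝ ι) :
    dist (comb t v) p ≤ ∑ i, t i * dist (v i) p := by
  have h : ((comb t v : stdSimplex ℝ ι) : ι → ℝ) - p =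
      ∑ i, t i • ((v i : ι → ℝ) - (p : ι → ℝ)) := by
    simp only [smul_sub, Finset.sum_sub_distrib, ← comb_coe, ← Finset.sum_smul]
    rw [sum_eq_one, one_smul]
  rw [Subtype.dist_eq, dist_eq_norm]
  refine (congr_arg norm h).le.trans ((norm_sum_le _ _).trans (Finset.sum_le_sum fun i _ => ?_))
  rw [norm_smul, Real.norm_of_nonneg (zero_le t i), ← dist_eq_norm, Subtype.dist_eq]
  rfl

lemma dist_comb_le (t : stdSimplex ℝ κ) (v : κ → stdSimplex ℝ ι) (p : stdSimplex ℝ ι) {ρ : ℝ}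
    (h : ∀ i, dist (v i) p ≤ ρ) : dist (comb t v) p ≤ ρ := by
  refine (dist_comb_le_sum t v p).trans ((Finset.sum_le_sum fun i _ =>
    mul_le_mul_of_nonneg_left (h i) (zero_le t i)).trans ?_)
  rw [← Finset.sum_mul, sum_eq_one, one_mul]

/-- The vertex `v j` contributes distance zero, and each of the other `n` vertices has weight `1 /
(n + 1)`. This gives the contraction factor of barycentric subdivision. -/
lemma dist_comb_barycenter_le {n : ℕ} (v : Fin (n + 1) → stdSimplex ℝ ι) {r : ℝ}
    (h : ∀ i j, dist (v i) (v j) ≤ r) (j : Fin (n + 1)) :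
    dist (comb barycenter v) (v j) ≤ n / (n + 1) * r := by
  refine (dist_comb_le_sum _ _ _).trans ?_
  rw [Fin.sum_univ_succAbove _ j, dist_self, mul_zero, zero_add]
  refine (Finset.sum_le_sum fun i _ => mul_le_mul_of_nonneg_left (h _ _)
    (zero_le barycenter _)).trans
    ?_
  have hb : ∀ i, (barycenter : stdSimplex ℝ (Fin (n + 1))) i = ((n : ℝ) + 1)⁻¹ := fun i => by
    change ((Fintype.card (Fin (n + 1)) : ℕ) : ℝ)⁻¹ = _
    simp
  simp only [hb, Finset.sum_const, Finset.card_univ, Fintype.card_fin, nsmul_eq_mul]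
  rw [← mul_assoc, ← div_eq_mul_inv]

end stdSimplex

end

noncomputable section

/-! ### Subdivision of linear simplices -/

/-- The geometric simplex with given vertices. -/
abbrev RealSimplex (ι : Type) [Fintype ι] : Type := stdSimplex ℝ ι

namespace SSet

open Simplicial _root_.stdSimplex

/-- The simplicial set of tuples of elements of a type. -/
def tuples (K : Type) : SSet.{u} where
  obj n := ULift.{u} (Fin (n.unop.len + 1) → K)
  map f := TypeCat.ofHom fun v => ⟨v.down ∘ f.unop.toOrderHom⟩

variable {K : Type}

/-- A tuple as a simplex. -/
abbrev tuple {n : ℕ} (v : Fin (n + 1) → K) : (tuples.{u} K) _⦋n⦌ := ULift.up v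

/-- The map of simplicial sets of tuples induced by a map. -/
def tuplesMap {L : Type} (f : K → L) : tuples.{u} K ⟶ tuples.{u} L where
  app n := TypeCat.ofHom fun v => ⟨f ∘ v.down⟩

/-- The cone over a tuple. -/
def tupleCone (p : K) (n : ℕ) (v : (tuples.{u} K) _⦋n⦌) : (tuples.{u} K) _⦋n + 1⦌ :=
  tuple (Fin.cons p v.down)

lemma δ_zero_tupleCone (p : K) (n : ℕ) (v : (tuples.{u} K) _⦋n⦌) :
    (tuples.{u} K).δ 0 (tupleCone p n v) = v := by
  refine ULift.down_injective (funext fun j => ?_)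
  exact Fin.cons_succ (α := fun _ => K) p v.down j

lemma δ_succ_tupleCone (p : K) (n : ℕ) (i : Fin (n + 2)) (v : (tuples.{u} K) _⦋n + 1⦌) :
    (tuples.{u} K).δ i.succ (tupleCone p (n + 1) v) =
      tupleCone p n ((tuples.{u} K).δ i v) := by
  refine ULift.down_injective (funext fun j => ?_)
  cases j using Fin.cases with
  | zero => rfl
  | succ j =>
    refine (congr_arg (Fin.cons p v.down : Fin (n + 3) → K) (Fin.succ_succAbove_succ i j)).trans ?_
    rfl

variable {R : Type} [CommRing R] {ι : Type} [Fintype ι]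

/-- The barycenter of a tuple. -/
abbrev tupleBarycenter {n : ℕ} (v : (tuples.{u} (RealSimplex ι)) _⦋n⦌) : RealSimplex ι :=
  comb (κ := Fin (n + 1)) barycenter v.down

variable (R ι) in
/-- The barycentric subdivision of linear chains in a standard simplex. -/
def linearSd (n : ℕ) : ((chains.{u} R).obj (tuples (RealSimplex ι))).X n →ₗ[R]
    ((chains.{u} R).obj (tuples (RealSimplex ι))).X n :=
  match n with
  | 0 => LinearMap.id
  | n + 1 => chainLift fun v => chainShift (tupleCone (tupleBarycenter v) n)
      (linearSd n ((((chains.{u} R).obj (tuples (RealSimplex ι))).d (n + 1) n).hom (chainOf v)))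

lemma linearSd_succ_chainOf {n : ℕ} (v : (tuples.{u} (RealSimplex ι)) _⦋n + 1⦌) :
    linearSd R ι (n + 1) (chainOf v) = chainShift (tupleCone (tupleBarycenter v) n)
      (linearSd R ι n
        ((((chains.{u} R).obj (tuples (RealSimplex ι))).d (n + 1) n).hom (chainOf v))) :=
  chainLift_chainOf _ _

/-- The boundary of the cone on `c` is `c` minus the cone on `d c`. Here `c` is the subdivided
boundary, which is a cycle by induction, so the second term vanishes. -/
lemma d_linearSd {n : ℕ} (z : ((chains.{u} R).obj (tuples (RealSimplex ι))).X (n + 1)) :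
    (((chains.{u} R).obj (tuples (RealSimplex ι))).d (n + 1) n).hom (linearSd R ι (n + 1) z) =
      linearSd R ι n ((((chains.{u} R).obj (tuples (RealSimplex ι))).d (n + 1) n).hom z) := by
  suffices h : (((chains.{u} R).obj (tuples (RealSimplex ι))).d (n + 1) n).hom ∘ₗ
      linearSd R ι (n + 1) =
      linearSd R ι n ∘ₗ (((chains.{u} R).obj (tuples (RealSimplex ι))).d (n + 1) n).hom from
    LinearMap.congr_fun h z
  clear z
  induction n with
  | zero =>
    refine chain_ext fun v => ?_
    rw [LinearMap.comp_apply, LinearMap.comp_apply, linearSd_succ_chainOf]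
    change (((chains.{u} R).obj (tuples (RealSimplex ι))).d 1 0).hom (chainShift _
      ((((chains.{u} R).obj (tuples (RealSimplex ι))).d 1 0).hom (chainOf v))) =
      (((chains.{u} R).obj (tuples (RealSimplex ι))).d 1 0).hom (chainOf v)
    rw [d_one_chainOf, map_sub, chainShift_chainOf, chainShift_chainOf, map_sub, d_one_chainOf,
      d_one_chainOf, δ_zero_tupleCone, δ_zero_tupleCone]
    -- In degree one the cone formula has a vertex term instead: each of the two cone edges also
    -- bounds the barycenter, and these contributions cancel.
    have h : ∀ w : (tuples.{u} (RealSimplex ι)) _⦋0⦌, (tuples.{u} (RealSimplex ι)).δ 1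
        (tupleCone (tupleBarycenter v) 0 w) = tuple fun _ => tupleBarycenter v := fun w => by
      refine ULift.down_injective (funext fun (j : Fin 1) => ?_)
      obtain rfl := Subsingleton.elim j 0
      rfl
    rw [h, h]
    abel
  | succ n ih =>
    refine chain_ext fun v => ?_
    rw [LinearMap.comp_apply, LinearMap.comp_apply, linearSd_succ_chainOf]
    refine (d_chainShift (tupleCone (tupleBarycenter v)) (δ_zero_tupleCone _)
      (δ_succ_tupleCone _) _).trans ?_
    have h := LinearMap.congr_fun ih
      ((((chains.{u} R).obj (tuples (RealSimplex ι))).d (n + 2) (n + 1)).hom (chainOf v))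
    rw [LinearMap.comp_apply, LinearMap.comp_apply, ChainComplex.d_d_apply, map_zero] at h
    refine (congr_arg (fun t => _ - chainShift _ t) h).trans ?_
    rw [map_zero, sub_zero]

lemma map_chainShift_tupleCone {L : Type} (f : K → L) (p : K) {n : ℕ}
    (z : ((chains.{u} R).obj (tuples K)).X n) :
    (((chains.{u} R).map (tuplesMap f)).f (n + 1)).hom (chainShift (tupleCone p n) z) =
      chainShift (tupleCone (f p) n) ((((chains.{u} R).map (tuplesMap f)).f n).hom z) := by
  suffices h : (((chains.{u} R).map (tuplesMap f)).f (n + 1)).hom ∘ₗ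
      chainShift (tupleCone p n) =
      chainShift (tupleCone (f p) n) ∘ₗ (((chains.{u} R).map (tuplesMap f)).f n).hom from
    LinearMap.congr_fun h z
  refine chain_ext fun v => ?_
  rw [LinearMap.comp_apply, LinearMap.comp_apply, chainShift_chainOf]
  refine (map_chainOf _ _).trans ?_
  refine Eq.trans ?_ (congr_arg (chainShift (tupleCone (f p) n)) (map_chainOf _ _).symm)
  rw [chainShift_chainOf]
  refine congr_arg chainOf (ULift.down_injective (funext fun j => ?_))
  cases j using Fin.cases <;> rfl

/-- Affine maps preserve convex combinations, in particular barycenters and cones over them. This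
naturality is what transports subdivision to singular simplices. -/
lemma map_linearSd {κ : Type} [Fintype κ] (u : κ → RealSimplex ι) {n : ℕ}
    (z : ((chains.{u} R).obj (tuples (RealSimplex κ))).X n) :
    (((chains.{u} R).map (tuplesMap (comb · u))).f n).hom (linearSd R κ n z) =
      linearSd R ι n ((((chains.{u} R).map (tuplesMap (comb · u))).f n).hom z) := by
  suffices h : (((chains.{u} R).map (tuplesMap (comb · u))).f n).hom ∘ₗ linearSd R κ n =
      linearSd R ι n ∘ₗ (((chains.{u} R).map (tuplesMap (comb · u))).f n).hom from
    LinearMap.congr_fun h z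
  clear z
  induction n with
  | zero => rfl
  | succ n ih =>
    refine chain_ext fun v => ?_
    rw [LinearMap.comp_apply, LinearMap.comp_apply, linearSd_succ_chainOf,
      map_chainShift_tupleCone]
    have h := LinearMap.congr_fun ih
      ((((chains.{u} R).obj (tuples (RealSimplex κ))).d (n + 1) n).hom (chainOf v))
    rw [LinearMap.comp_apply, LinearMap.comp_apply, ChainComplex.comm_apply] at h
    have hm := map_chainOf (R := R) (tuplesMap.{u} (comb · u)) v
    refine (congr_arg (chainShift _) h).trans ?_
    refine (congr_arg (fun t => chainShift _ (linearSd R ι n ((((chains.{u} R).obj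
      (tuples (RealSimplex ι))).d (n + 1) n).hom t))) hm).trans ?_
    refine Eq.trans ?_ (congr_arg (linearSd R ι (n + 1)) hm).symm
    rw [linearSd_succ_chainOf]
    rw [comb_comb]
    rfl

end SSet

end

noncomputable section

/-! ### The mesh of a subdivision -/

namespace SSet

open Simplicial _root_.stdSimplex

variable {R : Type} [CommRing R] {ι : Type} [Fintype ι]

variable (R) in
/-- The linear chains on simplices of bounded mesh. -/
def meshChains (n : ℕ) (r : ℝ) :
    Submodule R (((chains.{u} R).obj (tuples (RealSimplex ι))).X n) :=
  Submodule.span R {c | ∃ w : Fin (n + 1) → RealSimplex ι, c = chainOf (tuple w) ∧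
    ∀ i j, dist (w i) (w j) ≤ r}

variable (R) in
/-- The linear chains on simplices of bounded mesh in the intersection of all balls that contain
given points. -/
def meshChainsIn {m : ℕ} (v : Fin (m + 1) → RealSimplex ι) (n : ℕ) (r : ℝ) :
    Submodule R (((chains.{u} R).obj (tuples (RealSimplex ι))).X n) :=
  Submodule.span R {c | ∃ w : Fin (n + 1) → RealSimplex ι, c = chainOf (tuple w) ∧
    (∀ i j, dist (w i) (w j) ≤ r) ∧
    ∀ (p : RealSimplex ι) (ρ : ℝ), (∀ j, dist (v j) p ≤ ρ) → ∀ i, dist (w i) p ≤ ρ}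

/-- The induction must carry more than the mesh: the distance from the new cone point to the
vertices of a subdivided face is controlled because these vertices stay in every ball containing the
original ones. -/
lemma linearSd_mem_meshChainsIn {n : ℕ} (v : Fin (n + 1) → RealSimplex ι) {r : ℝ}
    (hv : ∀ i j, dist (v i) (v j) ≤ r) :
    linearSd.{u} R ι n (chainOf (tuple v)) ∈ meshChainsIn R v n (n / (n + 1) * r) := by
  induction n with
  | zero =>
    refine Submodule.subset_span ⟨v, rfl, fun i j => ?_, fun p ρ h => h⟩
    obtain rfl := Subsingleton.elim (α := Fin 1) i j
    simp
  | succ n ih =>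
    have hr : 0 ≤ r := dist_nonneg.trans (hv 0 0)
    rw [linearSd_succ_chainOf]
    have hd := d_chainOf (R := R) (tuple.{u} v)
    refine (congr_arg (fun t => chainShift (tupleCone (tupleBarycenter (tuple.{u} v)) n)
      (linearSd R ι n t) ∈ meshChainsIn R v (n + 1) (((n + 1 : ℕ) : ℝ) / ((n + 1 : ℕ) + 1) * r))
      hd).mpr ?_
    rw [map_sum, map_sum]
    refine Submodule.sum_mem _ fun i _ => ?_
    rw [map_smul, map_smul]
    refine Submodule.smul_mem _ _ ?_
    refine (Submodule.map_span_le _ _ _).2 ?_ (Submodule.mem_map_of_mem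
      (ih (v ∘ i.succAbove) fun _ _ => hv _ _))
    rintro _ ⟨w, rfl, hw, hw'⟩
    rw [chainShift_chainOf]
    -- The ball is centred at the barycenter; its radius is the bound on the distances from the
    -- barycenter to the original vertices.
    have hb : ∀ j, dist (tupleBarycenter (tuple.{u} v)) (w j) ≤
        ((n + 1 : ℕ) : ℝ) / ((n + 1 : ℕ) + 1) * r := fun j => by
      rw [dist_comm]
      refine hw' _ _ (fun k => ?_) j
      rw [dist_comm]
      exact dist_comb_barycenter_le v hv _
    refine Submodule.subset_span ⟨Fin.cons (tupleBarycenter (tuple.{u} v)) w, rfl, ?_, ?_⟩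
    · have h₀ : 0 ≤ ((n + 1 : ℕ) : ℝ) / ((n + 1 : ℕ) + 1) * r := by positivity
      intro i j
      cases i using Fin.cases with
      | zero =>
        cases j using Fin.cases with
        | zero => simpa using h₀
        | succ j => simpa using hb j
      | succ i =>
        cases j using Fin.cases with
        | zero => rw [dist_comm]; simpa using hb i
        | succ j =>
          simp only [Fin.cons_succ]
          -- The factor `n / (n + 1)` increases with `n`, so the bound for the faces implies the
          -- bound for the simplex.
          refine (hw i j).trans (mul_le_mul_of_nonneg_right ?_ hr)
          rw [div_le_div_iff₀ (by positivity) (by positivity)]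
          push_cast
          nlinarith
    · intro p ρ h i
      cases i using Fin.cases with
      | zero => exact dist_comb_le _ _ _ h
      | succ i => exact hw' p ρ (fun j => h _) i

lemma linearSd_mem_meshChains {n : ℕ} {r : ℝ}
    {c : ((chains.{u} R).obj (tuples (RealSimplex ι))).X n} (hc : c ∈ meshChains R n r) :
    linearSd R ι n c ∈ meshChains R n (n / (n + 1) * r) := by
  refine (Submodule.map_span_le _ _ _).2 ?_ (Submodule.mem_map_of_mem hc)
  rintro _ ⟨w, rfl, hw⟩
  refine Submodule.span_mono ?_ (linearSd_mem_meshChainsIn w hw)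
  rintro _ ⟨w', rfl, hw', -⟩
  exact ⟨w', rfl, hw'⟩

lemma linearSd_iterate_mem_meshChains {n : ℕ} {r : ℝ}
    {c : ((chains.{u} R).obj (tuples (RealSimplex ι))).X n} (hc : c ∈ meshChains R n r) (k : ℕ) :
    (linearSd R ι n)^[k] c ∈ meshChains R n ((n / (n + 1) : ℝ) ^ k * r) := by
  induction k with
  | zero => simpa using hc
  | succ k ih =>
    rw [Function.iterate_succ_apply', pow_succ', mul_assoc]
    exact linearSd_mem_meshChains ih

lemma exists_linearSd_iterate_mem_meshChains {n : ℕ} (v : Fin (n + 1) → RealSimplex ι) {ε : ℝ}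
    (hε : 0 < ε) : ∃ k, (linearSd.{u} R ι n)^[k] (chainOf (tuple v)) ∈ meshChains R n ε := by
  obtain ⟨r, hr⟩ : ∃ r : ℝ, ∀ i j, dist (v i) (v j) ≤ r := by
    obtain ⟨r, hr⟩ := (Set.finite_range fun p : Fin (n + 1) × Fin (n + 1) =>
      dist (v p.1) (v p.2)).bddAbove
    exact ⟨r, fun i j => hr ⟨(i, j), rfl⟩⟩
  have hlt : (n / (n + 1) : ℝ) < 1 := by
    rw [div_lt_one (by positivity)]
    linarith
  have hlim : Filter.Tendsto (fun k : ℕ => (n / (n + 1) : ℝ) ^ k * r) Filter.atTop (nhds 0) := by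
    simpa using (tendsto_pow_atTop_nhds_zero_of_lt_one (by positivity) hlt).mul_const r
  obtain ⟨k, hk⟩ := (hlim.eventually (gt_mem_nhds hε)).exists
  refine ⟨k, Submodule.span_mono ?_ (linearSd_iterate_mem_meshChains
    (Submodule.subset_span ⟨v, rfl, hr⟩) k)⟩
  rintro _ ⟨w, rfl, hw⟩
  exact ⟨w, rfl, fun i j => (hw i j).trans hk.le⟩

end SSet

end

noncomputable section

/-! ### Subdivision of singular chains -/

namespace TopCat

open Simplicial _root_.stdSimplex SSet AcyclicModels

/-- The affine map of simplices with given values on the vertices. -/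
def affineMap {n m : ℕ} (v : Fin (n + 1) → RealSimplex (Fin (m + 1))) :
    SimplexCategory.toTop.{u}.obj ⦋n⦌ ⟶ SimplexCategory.toTop.{u}.obj ⦋m⦌ :=
  TopCat.ofHom ⟨fun t => ⟨comb t.down v⟩,
    continuous_uliftUp.comp ((continuous_comb v).comp continuous_uliftDown)⟩

/-- The affine singular simplices. -/
def affineSimplices (m : ℕ) : tuples.{u} (RealSimplex (Fin (m + 1))) ⟶
    toSSet.obj (SimplexCategory.toTop.{u}.obj ⦋m⦌) where
  app n := TypeCat.ofHom fun v => ⟨affineMap (n := n.unop.len) v.down⟩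
  naturality n k f := by
    ext v
    refine ULift.down_injective (TopCat.hom_ext (ContinuousMap.ext fun t => ?_))
    refine ULift.down_injective ?_
    exact (comb_map f.unop.toOrderHom t.down v.down).symm

lemma affineSimplices_comp {n m : ℕ} (u : Fin (n + 1) → RealSimplex (Fin (m + 1))) :
    affineSimplices.{u} n ≫ toSSet.map (affineMap u) =
      tuplesMap (comb · u) ≫ affineSimplices m := by
  ext k v
  refine ULift.down_injective (TopCat.hom_ext (ContinuousMap.ext fun t => ?_))
  refine ULift.down_injective ?_
  exact comb_comb t.down v.down u

/-- The universal singular simplex. -/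
def universalSingular (n : ℕ) :
    (toSSet.obj (SimplexCategory.toTop.{u}.obj ⦋n⦌)) _⦋n⦌ := ⟨𝟙 _⟩

lemma affineSimplices_vertex (n : ℕ) :
    (affineSimplices.{u} n).app (Opposite.op ⦋n⦌) (tuple (vertex : Fin (n + 1) → _)) =
      universalSingular n := by
  refine ULift.down_injective (TopCat.hom_ext (ContinuousMap.ext fun t => ?_))
  refine ULift.down_injective ?_
  exact comb_vertex_right t.down

variable {R : Type} [CommRing R]

variable (R) in
/-- Singular chains are free on the universal singular simplices. -/
def singularBasis (n : ℕ) : ModelBasis (term (singularChains.{u} R) n) :=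
  corepBasis toSSet n (SimplexCategory.toTop.obj ⦋n⦌) (universalSingular n) fun X => by
    constructor
    · intro f g h
      have := congr_arg ULift.down h
      exact this
    · intro σ
      exact ⟨σ.down, ULift.down_injective rfl⟩

variable (R) in
/-- The affine singular chains. -/
abbrev affineChains (n m : ℕ) : ((chains.{u} R).obj (tuples (RealSimplex (Fin (m + 1))))).X n →ₗ[R]
    ((singularChains R).obj (SimplexCategory.toTop.{u}.obj ⦋m⦌)).X n :=
  (((chains R).map (affineSimplices m)).f n).hom

variable (R) in
/-- The subdivision of the universal singular simplex. -/
def sdUniversal (n : ℕ) : ((singularChains R).obj (SimplexCategory.toTop.{u}.obj ⦋n⦌)).X n :=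
  affineChains R n n (linearSd R _ n (chainOf (tuple vertex)))

variable (R) in
/-- The barycentric subdivision of singular chains of a given degree. -/
def sdMap (n : ℕ) (X : TopCat.{u}) :
    ((singularChains R).obj X).X n →ₗ[R] ((singularChains R).obj X).X n :=
  chainLift fun σ : (toSSet.obj X) _⦋n⦌ =>
    (((singularChains R).map σ.down).f n).hom (sdUniversal R n)

lemma sdMap_chainOf {X : TopCat.{u}} {n : ℕ} (σ : SimplexCategory.toTop.{u}.obj ⦋n⦌ ⟶ X) :
    sdMap R n X (chainOf (X := toSSet.obj X) (n := n) ⟨σ⟩) =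
      (((singularChains R).map σ).f n).hom (sdUniversal R n) :=
  chainLift_chainOf _ _

lemma singularChains_map_chainOf {X Y : TopCat.{u}} (f : X ⟶ Y) {n : ℕ}
    (σ : SimplexCategory.toTop.{u}.obj ⦋n⦌ ⟶ X) :
    (((singularChains R).map f).f n).hom (chainOf (X := toSSet.obj X) (n := n) ⟨σ⟩) =
      chainOf (X := toSSet.obj Y) (n := n) ⟨σ ≫ f⟩ :=
  map_chainOf (toSSet.map f) _

lemma map_sdMap {X Y : TopCat.{u}} (f : X ⟶ Y) {n : ℕ} (c : ((singularChains R).obj X).X n) :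
    (((singularChains R).map f).f n).hom (sdMap R n X c) =
      sdMap R n Y ((((singularChains R).map f).f n).hom c) := by
  suffices h : (((singularChains R).map f).f n).hom ∘ₗ sdMap R n X =
      sdMap R n Y ∘ₗ (((singularChains R).map f).f n).hom from LinearMap.congr_fun h c
  refine chain_ext fun σ => ?_
  refine (congr_arg _ (sdMap_chainOf σ.down)).trans ?_
  refine Eq.trans ?_ (congr_arg (sdMap R n Y) (singularChains_map_chainOf f σ.down)).symm
  rw [sdMap_chainOf, Functor.map_comp]
  rfl

/-- An affine simplex is the image of the universal one under an affine map, and linear subdivision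
is natural for such maps. So the singular and linear subdivisions agree on affine simplices. -/
lemma sdMap_affineChains {n m : ℕ}
    (z : ((chains.{u} R).obj (tuples (RealSimplex (Fin (m + 1))))).X n) :
    sdMap R n (SimplexCategory.toTop.{u}.obj ⦋m⦌) (affineChains R n m z) =
      affineChains R n m (linearSd R _ n z) := by
  suffices h : sdMap R n (SimplexCategory.toTop.{u}.obj ⦋m⦌) ∘ₗ
      affineChains R n m = affineChains R n m ∘ₗ linearSd R _ n from LinearMap.congr_fun h z
  refine chain_ext fun v => ?_
  have h₁ : affineChains R n m (chainOf v) = chainOf (X := toSSet.obj _) (n := n)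
    ⟨affineMap (n := n) (m := m) v.down⟩ := map_chainOf (affineSimplices m) v
  refine (congr_arg (sdMap R n _) h₁).trans ?_
  refine (sdMap_chainOf _).trans ?_
  have h₂ : ∀ z, (((singularChains R).map (affineMap (n := n) (m := m) v.down)).f n).hom
      (affineChains R n n z) = affineChains R n m
        ((((chains.{u} R).map (tuplesMap (comb · v.down))).f n).hom z) := fun z => by
    have h := congr_arg (fun k => (((chains.{u} R).map k).f n).hom z)
      (affineSimplices_comp (n := n) (m := m) v.down)
    simp only [Functor.map_comp] at h
    exact h
  refine (h₂ _).trans (congr_arg (affineChains R n m) ?_)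
  refine (map_linearSd (ι := Fin (m + 1)) (κ := Fin (n + 1)) v.down _).trans
    (congr_arg (linearSd R _ n) ?_)
  refine (map_chainOf _ _).trans (congr_arg chainOf ?_)
  refine ULift.down_injective (funext fun i => ?_)
  exact comb_vertex (κ := Fin (n + 1)) i v.down

lemma affineChains_vertex (n : ℕ) :
    affineChains.{u} R n n (chainOf (tuple vertex)) = chainOf (universalSingular n) := by
  refine (map_chainOf _ _).trans ?_
  rw [affineSimplices_vertex]

/-- Naturality reduces the identity to the universal singular simplex; that simplex is affine, and
for affine chains the linear case applies. -/
lemma d_sdMap {X : TopCat.{u}} {n : ℕ} (c : ((singularChains R).obj X).X (n + 1)) :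
    (((singularChains R).obj X).d (n + 1) n).hom (sdMap R (n + 1) X c) =
      sdMap R n X ((((singularChains R).obj X).d (n + 1) n).hom c) := by
  suffices h : (((singularChains R).obj X).d (n + 1) n).hom ∘ₗ sdMap R (n + 1) X =
      sdMap R n X ∘ₗ (((singularChains R).obj X).d (n + 1) n).hom from LinearMap.congr_fun h c
  refine chain_ext fun σ => ?_
  let Δ := (singularChains R).obj (SimplexCategory.toTop.{u}.obj ⦋n + 1⦌)
  have hd : ∀ z, (Δ.d (n + 1) n).hom (affineChains R _ _ z) =
      affineChains R _ _ ((((chains.{u} R).obj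
        (tuples (RealSimplex (Fin (n + 2))))).d (n + 1) n).hom z) := fun z =>
    (ChainComplex.comm_apply ((chains R).map (affineSimplices (n + 1))) (n + 1) n z).symm
  have hι : (Δ.d (n + 1) n).hom (sdUniversal R (n + 1)) = sdMap R n _
      ((Δ.d (n + 1) n).hom (chainOf (universalSingular (n + 1)))) := by
    rw [← affineChains_vertex, hd, sdMap_affineChains, ← d_linearSd, ← hd]
    rfl
  have hσ : chainOf σ = (((singularChains R).map σ.down).f (n + 1)).hom
      (chainOf (universalSingular (n + 1))) :=
    ((singularChains_map_chainOf σ.down (𝟙 _)).trans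
      (congr_arg chainOf (ULift.down_injective (Category.id_comp _)))).symm
  refine (congr_arg (((singularChains R).obj X).d (n + 1) n).hom (sdMap_chainOf σ.down)).trans ?_
  refine Eq.trans ?_ (congr_arg (fun t => sdMap R n X
    ((((singularChains R).obj X).d (n + 1) n).hom t)) hσ).symm
  have h₁ := ChainComplex.comm_apply ((singularChains R).map σ.down) (n + 1) n
    (sdUniversal R (n + 1))
  have h₂ := ChainComplex.comm_apply ((singularChains R).map σ.down) (n + 1) n
    (chainOf (universalSingular (n + 1)))
  refine h₁.symm.trans ((congr_arg _ hι).trans ?_)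
  refine (map_sdMap _ _).trans (congr_arg (sdMap R n X) h₂)

variable (R) in
/-- The barycentric subdivision of singular chains. -/
def sd : singularChains.{u} R ⟶ singularChains R where
  app X :=
    { f n := ModuleCat.ofHom (sdMap R n X)
      comm' i j hij := by
        obtain rfl : j + 1 = i := hij
        exact ModuleCat.hom_ext (LinearMap.ext fun c => d_sdMap c) }
  naturality X Y f := by
    ext n : 1
    exact ModuleCat.hom_ext (LinearMap.ext fun c => (map_sdMap f c).symm)

lemma sd_zero (X : TopCat.{u}) : ((sd R).app X).f 0 = 𝟙 _ := by
  refine ModuleCat.hom_ext (chain_ext fun σ => ?_)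
  refine (sdMap_chainOf σ.down).trans ?_
  refine (congr_arg _ (affineChains_vertex 0)).trans ?_
  exact ((singularChains_map_chainOf σ.down (𝟙 _)).trans
      (congr_arg chainOf (ULift.down_injective (Category.id_comp _))))

instance (n : ℕ) : ContractibleSpace (SimplexCategory.toTop.{u}.obj ⦋n⦌) := by
  have : ContractibleSpace (_root_.stdSimplex ℝ (Fin (n + 1))) :=
    (convex_stdSimplex ℝ _).contractibleSpace ⟨_, single_mem_stdSimplex ℝ 0⟩
  exact (Homeomorph.ulift (X := _root_.stdSimplex ℝ (Fin (n + 1)))).contractibleSpace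

variable (R) in
/-- Subdivision is naturally homotopic to the identity. -/
lemma nonempty_homotopy_sd : Nonempty (_root_.Homotopy (flipMap (𝟙 (singularChains.{u} R)))
    (flipMap (sd.{u} R))) :=
  nonempty_homotopy (singularBasis R) (fun n _ => posAcyclic_of_contractible
    (SimplexCategory.toTop.{u}.obj ⦋n⦌)) _ _ fun X => (sd_zero X).symm

end TopCat

end

noncomputable section

/-! ### Small chains -/

namespace TopCat

open Simplicial _root_.stdSimplex SSet AcyclicModels

variable {R : Type} [CommRing R] {X : TopCat.{u}} (U V : Set X)

/-- The condition that a singular simplex lies in one of two subsets. -/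
def IsSmall {n : ℕ} (σ : SimplexCategory.toTop.{u}.obj ⦋n⦌ ⟶ X) : Prop :=
  Set.range σ.hom ⊆ U ∨ Set.range σ.hom ⊆ V

variable (R) in
/-- The singular chains on simplices lying in one of two subsets. -/
def smallChains (n : ℕ) : Submodule R (((singularChains R).obj X).X n) :=
  Submodule.span R {c | ∃ σ : SimplexCategory.toTop.{u}.obj ⦋n⦌ ⟶ X, IsSmall U V σ ∧
    c = chainOf (X := toSSet.obj X) (n := n) ⟨σ⟩}

variable {U V}

lemma map_mem_smallChains {m n : ℕ} {σ : SimplexCategory.toTop.{u}.obj ⦋m⦌ ⟶ X}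
    (hσ : IsSmall U V σ) (c : ((singularChains R).obj (SimplexCategory.toTop.{u}.obj ⦋m⦌)).X n) :
    (((singularChains R).map σ).f n).hom c ∈ smallChains R U V n := by
  induction c using chain_induction with
  | of τ =>
    refine Submodule.subset_span ⟨τ.down ≫ σ, ?_, singularChains_map_chainOf σ τ.down⟩
    have h : Set.range (τ.down ≫ σ).hom ⊆ Set.range σ.hom := by
      rintro _ ⟨t, rfl⟩
      exact ⟨(show SimplexCategory.toTop.{u}.obj ⦋n⦌ ⟶ SimplexCategory.toTop.{u}.obj ⦋m⦌ from
        τ.down) t, rfl⟩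
    exact hσ.imp h.trans h.trans
  | zero => rw [map_zero]; exact zero_mem _
  | add a b ha hb => rw [map_add]; exact add_mem ha hb
  | smul r a ha => rw [map_smul]; exact Submodule.smul_mem _ r ha

/-- Natural transformations preserve small chains. -/
lemma natTrans_mem_smallChains {m n : ℕ} (θ : term (singularChains.{u} R) m ⟶
    term (singularChains R) n) {c : ((singularChains R).obj X).X m}
    (hc : c ∈ smallChains R U V m) : (θ.app X).hom c ∈ smallChains R U V n := by
  let T : ((singularChains R).obj X).X m →ₗ[R] ((singularChains R).obj X).X n := (θ.app X).hom
  refine (Submodule.map_span_le T _ (smallChains R U V n)).2 ?_ (Submodule.mem_map_of_mem hc)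
  rintro _ ⟨σ, hσ, rfl⟩
  have h : chainOf (X := toSSet.obj X) (n := m) ⟨σ⟩ = (((singularChains R).map σ).f m).hom
      (chainOf (universalSingular m)) :=
    ((singularChains_map_chainOf σ (𝟙 _)).trans
      (congr_arg chainOf (ULift.down_injective (Category.id_comp _)))).symm
  have h' : T (chainOf (X := toSSet.obj X) (n := m) ⟨σ⟩) = _ := (congr_arg T h).trans
    (LinearMap.congr_fun (congr_arg ModuleCat.Hom.hom (θ.naturality σ))
      (chainOf (universalSingular m)))
  rw [h']
  exact map_mem_smallChains hσ _

lemma sdMap_mem_smallChains {n : ℕ} {c : ((singularChains R).obj X).X n}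
    (hc : c ∈ smallChains R U V n) : sdMap R n X c ∈ smallChains R U V n :=
  natTrans_mem_smallChains ((flipMap (sd.{u} R)).f n) hc

lemma d_mem_smallChains {m n : ℕ} {c : ((singularChains R).obj X).X m}
    (hc : c ∈ smallChains R U V m) :
    (((singularChains R).obj X).d m n).hom c ∈ smallChains R U V n :=
  natTrans_mem_smallChains (termD (singularChains.{u} R) m n) hc

lemma sdMap_iterate_mem_smallChains {n : ℕ} {c : ((singularChains R).obj X).X n}
    (hc : c ∈ smallChains R U V n) (k : ℕ) : (sdMap R n X)^[k] c ∈ smallChains R U V n := by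
  induction k with
  | zero => exact hc
  | succ k ih =>
    rw [Function.iterate_succ_apply']
    exact sdMap_mem_smallChains ih

/-- Take a Lebesgue number of the pulled back cover of the compact simplex. Convexity of balls keeps
a whole affine simplex near its vertex `w 0`. -/
lemma exists_isSmall_affineMap (hU : IsOpen U) (hV : IsOpen V) (hUV : U ∪ V = Set.univ) {n : ℕ}
    (σ : SimplexCategory.toTop.{u}.obj ⦋n⦌ ⟶ X) : ∃ ε > 0,
      ∀ w : Fin (n + 1) → RealSimplex (Fin (n + 1)), (∀ i j, dist (w i) (w j) ≤ ε) →
        IsSmall U V (affineMap w ≫ σ) := by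
  let f : RealSimplex (Fin (n + 1)) → X := fun t => σ (ULift.up t)
  have hf : Continuous f := σ.hom.continuous.comp continuous_uliftUp
  obtain ⟨δ, hδ, h⟩ := lebesgue_number_lemma_of_metric (s := Set.univ)
    (c := fun b : Bool => bif b then f ⁻¹' U else f ⁻¹' V) isCompact_univ
    (by rintro (_ | _); exacts [hV.preimage hf, hU.preimage hf]) (by
      intro t _
      have ht : f t ∈ U ∪ V := hUV ▸ Set.mem_univ _
      rw [Set.mem_iUnion]
      obtain ht | ht := ht
      · exact ⟨true, ht⟩
      · exact ⟨false, ht⟩)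
  -- Half the Lebesgue number turns the weak bound on distances into membership in an open ball.
  refine ⟨δ / 2, half_pos hδ, fun w hw => ?_⟩
  obtain ⟨b, hb⟩ := h (w 0) (Set.mem_univ _)
  have hmem : ∀ t : SimplexCategory.toTop.{u}.obj ⦋n⦌, comb (κ := Fin (n + 1)) t.down w ∈
      Metric.ball (w 0) δ := fun t =>
    lt_of_le_of_lt (dist_comb_le (κ := Fin (n + 1)) t.down w (w 0) fun i => hw i 0)
      (half_lt_self hδ)
  cases b with
  | false =>
    right
    rintro _ ⟨t, rfl⟩
    exact hb (hmem t)
  | true =>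
    left
    rintro _ ⟨t, rfl⟩
    exact hb (hmem t)

lemma exists_sdMap_iterate_mem_smallChains (hU : IsOpen U) (hV : IsOpen V)
    (hUV : U ∪ V = Set.univ) {n : ℕ} (c : ((singularChains R).obj X).X n) :
    ∃ k, (sdMap R n X)^[k] c ∈ smallChains R U V n := by
  induction c using chain_induction with
  | of σ =>
    obtain ⟨ε, hε, h⟩ := exists_isSmall_affineMap hU hV hUV σ.down
    obtain ⟨k, hk⟩ := exists_linearSd_iterate_mem_meshChains.{u} (R := R)
      (vertex : Fin (n + 1) → RealSimplex (Fin (n + 1))) hε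
    refine ⟨k, ?_⟩
    have h₁ : ∀ k, (sdMap R n X)^[k] (chainOf σ) = (((singularChains R).map σ.down).f n).hom
        (affineChains R n n ((linearSd R _ n)^[k] (chainOf (tuple vertex)))) := by
      intro k
      induction k with
      | zero =>
        refine Eq.trans ?_ (congr_arg (((singularChains R).map σ.down).f n).hom
          (affineChains_vertex n)).symm
        exact ((singularChains_map_chainOf σ.down (𝟙 _)).trans
          (congr_arg chainOf (ULift.down_injective (Category.id_comp _)))).symm
      | succ k ih =>
        rw [Function.iterate_succ_apply', Function.iterate_succ_apply', ih, ← sdMap_affineChains]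
        exact (map_sdMap _ _).symm
    rw [h₁]
    refine (Submodule.map_span_le ((((singularChains R).map σ.down).f n).hom ∘ₗ
      affineChains R n n) _ _).2 ?_ (Submodule.mem_map_of_mem hk)
    rintro _ ⟨w, rfl, hw⟩
    refine Submodule.subset_span ⟨affineMap w ≫ σ.down, h w hw, ?_⟩
    refine Eq.trans ?_ (singularChains_map_chainOf σ.down (affineMap w))
    exact congr_arg (((singularChains R).map σ.down).f n).hom
      (map_chainOf (affineSimplices n) (tuple w))
  | zero => exact ⟨0, zero_mem _⟩
  | add a b ha hb =>
    obtain ⟨k, hk⟩ := ha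
    obtain ⟨l, hl⟩ := hb
    -- Subdivision preserves small chains, so extra iterations do no harm and one exponent serves
    -- both summands.
    refine ⟨k + l, ?_⟩
    rw [← Module.End.coe_pow] at hk hl ⊢
    rw [map_add]
    refine add_mem ?_ ?_
    · rw [add_comm, pow_add, Module.End.mul_apply, Module.End.coe_pow]
      exact sdMap_iterate_mem_smallChains hk l
    · rw [pow_add, Module.End.mul_apply, Module.End.coe_pow]
      exact sdMap_iterate_mem_smallChains hl k
  | smul r a ha =>
    obtain ⟨k, hk⟩ := ha
    refine ⟨k, ?_⟩
    rw [← Module.End.coe_pow] at hk ⊢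
    rw [map_smul]
    exact Submodule.smul_mem _ r hk

/-- For a homotopy `h` from the identity to subdivision, `c = h d c + d h c + sd c`. As `h` is
natural it preserves small chains, so `h d c` is small. -/
lemma exists_sub_sdMap_eq {n : ℕ} (c : ((singularChains R).obj X).X n)
    (hc : (((singularChains R).obj X).d n (n - 1)).hom c ∈ smallChains R U V (n - 1)) :
    ∃ l ∈ smallChains R U V n, ∃ w, c = l + (((singularChains R).obj X).d (n + 1) n).hom w +
      sdMap R n X c := by
  obtain ⟨H⟩ := nonempty_homotopy_sd.{u} R
  have h := LinearMap.congr_fun (congr_arg ModuleCat.Hom.hom (congr_app (H.comm n) X)) c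
  rw [dNext_nat, _root_.Homotopy.prevD_chainComplex] at h
  exact ⟨_, natTrans_mem_smallChains (H.hom (n - 1) n) hc, _, h⟩

/-- A chain with small boundary is homologous to a small chain. -/
theorem exists_small_add_boundary (hU : IsOpen U) (hV : IsOpen V) (hUV : U ∪ V = Set.univ) {n : ℕ}
    (c : ((singularChains R).obj X).X n)
    (hc : (((singularChains R).obj X).d n (n - 1)).hom c ∈ smallChains R U V (n - 1)) :
    ∃ l ∈ smallChains R U V n, ∃ w, c = l + (((singularChains R).obj X).d (n + 1) n).hom w := by
  obtain ⟨k, hk⟩ := exists_sdMap_iterate_mem_smallChains hU hV hUV c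
  induction k generalizing c with
  | zero => exact ⟨c, hk, 0, by rw [map_zero, add_zero]⟩
  | succ k ih =>
    rw [Function.iterate_succ_apply] at hk
    have hd : (((singularChains R).obj X).d n (n - 1)).hom (sdMap R n X c) =
        sdMap R (n - 1) X ((((singularChains R).obj X).d n (n - 1)).hom c) :=
      (ChainComplex.comm_apply ((sd.{u} R).app X) n (n - 1) c).symm
    obtain ⟨l, hl, w, hw⟩ := ih (sdMap R n X c) (hd ▸ sdMap_mem_smallChains hc) hk
    obtain ⟨l', hl', w', hw'⟩ := exists_sub_sdMap_eq c hc
    refine ⟨l' + l, add_mem hl' hl, w' + w, ?_⟩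
    rw [map_add]
    refine hw'.trans ((congr_arg (_ + ·) hw).trans ?_)
    abel

end TopCat

end

noncomputable section

/-! ### The Mayer–Vietoris sequence -/

namespace TopCat

open Simplicial SSet ChainComplex

variable {R : Type} [CommRing R] {X : TopCat.{u}}

/-- The inclusion of a subset of a space. -/
def incl (A : Set X) : TopCat.of A ⟶ X := TopCat.ofHom ⟨Subtype.val, continuous_subtype_val⟩

/-- The inclusion of subsets of a space. -/
def inclOfLE {A B : Set X} (h : A ⊆ B) : TopCat.of A ⟶ TopCat.of B :=
  TopCat.ofHom ⟨Set.inclusion h, continuous_inclusion h⟩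

/-- The restriction of the target of a continuous map. -/
def liftTo (A : Set X) {Y : TopCat.{u}} (σ : Y ⟶ X) (h : Set.range σ.hom ⊆ A) :
    Y ⟶ TopCat.of A :=
  TopCat.ofHom ⟨fun t => ⟨σ t, h ⟨t, rfl⟩⟩, σ.hom.continuous.subtype_mk _⟩

lemma range_comp_incl (A : Set X) {Y : TopCat.{u}} (σ : Y ⟶ TopCat.of A) :
    Set.range (σ ≫ incl A).hom ⊆ A := by
  rintro _ ⟨t, rfl⟩
  exact (σ t).2

variable (R) in
/-- The map on chains induced by the inclusion of a subset. -/
abbrev inclChains (A : Set X) (n : ℕ) :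
    ((singularChains R).obj (TopCat.of A)).X n →ₗ[R] ((singularChains R).obj X).X n :=
  (((singularChains R).map (incl A)).f n).hom

open Classical in
variable (R) in
/-- The projection of singular chains to chains in a subset. -/
def restrictChains (A : Set X) (n : ℕ) :
    ((singularChains R).obj X).X n →ₗ[R] ((singularChains R).obj (TopCat.of A)).X n :=
  chainLift fun σ : (toSSet.obj X) _⦋n⦌ =>
    if h : Set.range (show SimplexCategory.toTop.{u}.obj ⦋n⦌ ⟶ X from σ.down).hom ⊆ A then
      chainOf (X := toSSet.obj (TopCat.of A)) (n := n) ⟨liftTo A _ h⟩ else 0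

lemma restrictChains_of_subset {A : Set X} {n : ℕ} (σ : SimplexCategory.toTop.{u}.obj ⦋n⦌ ⟶ X)
    (h : Set.range σ.hom ⊆ A) : restrictChains R A n (chainOf (X := toSSet.obj X) (n := n) ⟨σ⟩) =
      chainOf (X := toSSet.obj (TopCat.of A)) (n := n) ⟨liftTo A _ h⟩ :=
  (chainLift_chainOf _ _).trans (dif_pos h)

lemma restrictChains_of_not_subset {A : Set X} {n : ℕ}
    (σ : SimplexCategory.toTop.{u}.obj ⦋n⦌ ⟶ X) (h : ¬ Set.range σ.hom ⊆ A) :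
    restrictChains R A n (chainOf (X := toSSet.obj X) (n := n) ⟨σ⟩) = 0 :=
  (chainLift_chainOf _ _).trans (dif_neg h)

lemma restrictChains_inclChains (A : Set X) (n : ℕ)
    (c : ((singularChains R).obj (TopCat.of A)).X n) :
    restrictChains R A n (inclChains R A n c) = c := by
  suffices h : restrictChains R A n ∘ₗ inclChains R A n = LinearMap.id from
    LinearMap.congr_fun h c
  refine chain_ext fun σ => ?_
  refine (congr_arg (restrictChains R A n) (singularChains_map_chainOf (incl A) σ.down)).trans ?_
  exact restrictChains_of_subset _ (range_comp_incl A σ.down)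

lemma inclChains_injective (A : Set X) (n : ℕ) : Function.Injective (inclChains R A n) :=
  Function.LeftInverse.injective (restrictChains_inclChains A n)

variable (U V : Set X)

/-- A simplex of `V` lies in `U` exactly when it lies in `U ∩ V`. -/
lemma restrictChains_inclChains_of_inter {n : ℕ}
    (b : ((singularChains R).obj (TopCat.of V)).X n) :
    restrictChains R U n (inclChains R V n b) =
      (((singularChains R).map (inclOfLE (Set.inter_subset_left (s := U) (t := V)))).f n).hom
        (restrictChains R (U ∩ V) n (inclChains R V n b)) := by
  suffices h : restrictChains R U n ∘ₗ inclChains R V n =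
      (((singularChains R).map (inclOfLE (Set.inter_subset_left (s := U) (t := V)))).f n).hom ∘ₗ
        restrictChains R (U ∩ V) n ∘ₗ inclChains R V n from LinearMap.congr_fun h b
  refine chain_ext fun τ => ?_
  have h₁ := singularChains_map_chainOf (R := R) (incl V) τ.down
  refine (congr_arg (restrictChains R U n) h₁).trans ?_
  refine Eq.trans ?_ (congr_arg (fun t => (((singularChains R).map (inclOfLE
    (Set.inter_subset_left (s := U) (t := V)))).f n).hom (restrictChains R (U ∩ V) n t)) h₁).symm
  by_cases h : Set.range (show SimplexCategory.toTop.{u}.obj ⦋n⦌ ⟶ X from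
    τ.down ≫ incl V).hom ⊆ U
  · have h' := Set.subset_inter h (range_comp_incl V τ.down)
    rw [restrictChains_of_subset _ h, restrictChains_of_subset _ h']
    exact (singularChains_map_chainOf (R := R) (inclOfLE (Set.inter_subset_left (s := U) (t := V)))
      (liftTo (U ∩ V) _ h')).symm
  · rw [restrictChains_of_not_subset _ h, restrictChains_of_not_subset _
      fun h' => h (h'.trans Set.inter_subset_left)]
    exact (map_zero _).symm

/-- The chain `a = -b` is supported both in `U` and in `V`, so it comes from the intersection. The
witness is minus the part of `b` lying in `U ∩ V`. -/
lemma exists_of_inclChains_add_eq_zero {n : ℕ} (a : ((singularChains R).obj (TopCat.of U)).X n)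
    (b : ((singularChains R).obj (TopCat.of V)).X n)
    (h : inclChains R U n a + inclChains R V n b = 0) :
    ∃ w : ((singularChains R).obj (TopCat.of ↥(U ∩ V))).X n,
      (((singularChains R).map (inclOfLE (Set.inter_subset_left (s := U) (t := V)))).f n).hom w =
        a ∧
      (((singularChains R).map (inclOfLE (Set.inter_subset_right (s := U) (t := V)))).f n).hom w =
        -b := by
  have ha : a = - restrictChains R U n (inclChains R V n b) := by
    rw [← restrictChains_inclChains U n a, eq_neg_of_add_eq_zero_left h, map_neg]
  have h₁ : (((singularChains R).map (inclOfLE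
      (Set.inter_subset_left (s := U) (t := V)))).f n).hom
      (-restrictChains R (U ∩ V) n (inclChains R V n b)) = a := by
    rw [map_neg, ← restrictChains_inclChains_of_inter, ← ha]
  refine ⟨_, h₁, inclChains_injective V n ?_⟩
  have h₃ : inclChains R V n (-b) = inclChains R U n a :=
    (map_neg _ _).trans (eq_neg_of_add_eq_zero_left h).symm
  rw [h₃, ← h₁]
  have h₂ : (singularChains R).map (inclOfLE (Set.inter_subset_left (s := U) (t := V))) ≫
      (singularChains R).map (incl U) =
      (singularChains R).map (inclOfLE (Set.inter_subset_right (s := U) (t := V))) ≫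
      (singularChains R).map (incl V) := by
    rw [← Functor.map_comp, ← Functor.map_comp]
    rfl
  exact (congr_arg (fun k => (k.f n).hom (-restrictChains R (U ∩ V) n (inclChains R V n b)))
    h₂).symm

lemma inclChains_mem_smallChains_left {n : ℕ} (a : ((singularChains R).obj (TopCat.of U)).X n) :
    inclChains R U n a ∈ smallChains R U V n := by
  induction a using chain_induction with
  | of τ => exact Submodule.subset_span ⟨τ.down ≫ incl U, Or.inl (range_comp_incl U τ.down),
      singularChains_map_chainOf (incl U) τ.down⟩
  | zero => rw [map_zero]; exact zero_mem _
  | add a b ha hb => rw [map_add]; exact add_mem ha hb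
  | smul r a ha => rw [map_smul]; exact Submodule.smul_mem _ r ha

lemma inclChains_mem_smallChains_right {n : ℕ} (a : ((singularChains R).obj (TopCat.of V)).X n) :
    inclChains R V n a ∈ smallChains R U V n := by
  induction a using chain_induction with
  | of τ => exact Submodule.subset_span ⟨τ.down ≫ incl V, Or.inr (range_comp_incl V τ.down),
      singularChains_map_chainOf (incl V) τ.down⟩
  | zero => rw [map_zero]; exact zero_mem _
  | add a b ha hb => rw [map_add]; exact add_mem ha hb
  | smul r a ha => rw [map_smul]; exact Submodule.smul_mem _ r ha

lemma exists_eq_inclChains_add {n : ℕ} {c : ((singularChains R).obj X).X n}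
    (hc : c ∈ smallChains R U V n) : ∃ a b, c = inclChains R U n a + inclChains R V n b := by
  induction hc using Submodule.span_induction with
  | mem c hc =>
    obtain ⟨σ, hσ | hσ, rfl⟩ := hc
    · refine ⟨chainOf (X := toSSet.obj (TopCat.of U)) (n := n) ⟨liftTo U σ hσ⟩, 0, ?_⟩
      rw [map_zero, add_zero]
      exact (singularChains_map_chainOf (incl U) (liftTo U σ hσ)).symm
    · refine ⟨0, chainOf (X := toSSet.obj (TopCat.of V)) (n := n) ⟨liftTo V σ hσ⟩, ?_⟩
      rw [map_zero, zero_add]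
      exact (singularChains_map_chainOf (incl V) (liftTo V σ hσ)).symm
  | zero => exact ⟨0, 0, by simp⟩
  | add x y _ _ hx hy =>
    obtain ⟨a, b, rfl⟩ := hx
    obtain ⟨a', b', rfl⟩ := hy
    exact ⟨a + a', b + b', by rw [map_add, map_add]; abel⟩
  | smul r x _ hx =>
    obtain ⟨a, b, rfl⟩ := hx
    exact ⟨r • a, r • b, by rw [map_smul, map_smul, smul_add]⟩

variable (R) in
/-- The complex of small singular chains. -/
def smallComplex : ChainComplex (ModuleCat.{u} R) ℕ where
  X n := ModuleCat.of R (smallChains R U V n)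
  d i j := ModuleCat.ofHom ((((singularChains R).obj X).d i j).hom.restrict
    fun _ hc => d_mem_smallChains hc)
  shape i j hij := ModuleCat.hom_ext (LinearMap.ext fun c => Subtype.ext
    (LinearMap.congr_fun (congr_arg ModuleCat.Hom.hom
      (((singularChains R).obj X).shape i j hij)) c.1))
  d_comp_d' i j k _ _ := ModuleCat.hom_ext (LinearMap.ext fun c => Subtype.ext
    (ChainComplex.d_d_apply i j k c.1))

variable (R) in
/-- The inclusion of the complex of small singular chains. -/
def smallIncl : smallComplex R U V ⟶ (singularChains R).obj X where
  f n := ModuleCat.ofHom (smallChains R U V n).subtype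

variable {U V}

/-- Both halves apply `exists_small_add_boundary`: to a cycle, whose boundary is zero and hence
small, and to a chain `w` bounding a small cycle, which may then be replaced by a small chain with
the same boundary. -/
lemma smallIncl_homology_bijective (hU : IsOpen U) (hV : IsOpen V) (hUV : U ∪ V = Set.univ)
    (n : ℕ) : Function.Bijective (HomologicalComplex.homologyMap (smallIncl R U V) n).hom := by
  constructor
  · rw [injective_iff_map_eq_zero]
    intro x hx
    obtain ⟨z, rfl⟩ := cls_surjective n x
    rw [homologyMap_cls, cls_eq_zero_iff] at hx
    obtain ⟨w, hw⟩ := hx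
    have hw' : (((singularChains R).obj X).d (n + 1) n).hom w = z.1.1 := hw
    obtain ⟨l, hl, w', rfl⟩ := exists_small_add_boundary (n := n + 1) hU hV hUV w (by
      refine (congr_arg (· ∈ smallChains R U V n) hw').mpr ?_
      exact z.1.2)
    rw [cls_eq_zero_iff]
    refine ⟨⟨l, hl⟩, Subtype.ext ?_⟩
    rw [map_add, d_d_apply, add_zero] at hw'
    exact hw'
  · intro x
    obtain ⟨z, rfl⟩ := cls_surjective n x
    obtain ⟨l, hl, w, hw⟩ := exists_small_add_boundary (n := n) hU hV hUV z.1 (by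
      rw [LinearMap.mem_ker.1 z.2]; exact zero_mem _)
    have hd : (((singularChains R).obj X).d n (n - 1)).hom l = 0 := by
      have h := LinearMap.mem_ker.1 z.2
      rw [hw, map_add, d_d_apply, add_zero] at h
      exact h
    refine ⟨cls (smallComplex R U V) n ⟨⟨l, hl⟩, LinearMap.mem_ker.2 (Subtype.ext hd)⟩, ?_⟩
    rw [homologyMap_cls, ← sub_eq_zero, ← map_sub, cls_eq_zero_iff]
    refine ⟨-w, ?_⟩
    rw [map_neg, neg_eq_iff_add_eq_zero, add_comm]
    change l - z.1 + _ = 0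
    rw [hw]
    abel

end TopCat

end

/-! ### The short exact sequence of a two-set open cover and its connecting homomorphism. -/

noncomputable section

namespace ChainComplex

variable {R : Type} [CommRing R] {K L : ChainComplex (ModuleCat.{u} R) ℕ}

/-- The linear map in homology induced by a map of chain complexes. -/
abbrev homologyLin (f : K ⟶ L) (n : ℕ) : K.homology n →ₗ[R] L.homology n :=
  (HomologicalComplex.homologyMap f n).hom

lemma homologyLin_comp_apply {M : ChainComplex (ModuleCat.{u} R) ℕ} (f : K ⟶ L) (g : L ⟶ M)
    (n : ℕ) (x : K.homology n) : homologyLin g n (homologyLin f n x) = homologyLin (f ≫ g) n x := by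
  rw [homologyLin, homologyLin, homologyLin, HomologicalComplex.homologyMap_comp]
  rfl

lemma homologyLin_id_apply (n : ℕ) (x : K.homology n) : homologyLin (𝟙 K) n x = x := by
  rw [homologyLin, HomologicalComplex.homologyMap_id]
  rfl

lemma homologyLin_zero_apply (n : ℕ) (x : K.homology n) : homologyLin (0 : K ⟶ L) n x = 0 := by
  rw [homologyLin, HomologicalComplex.homologyMap_zero]
  rfl

lemma homologyLin_add_apply (f g : K ⟶ L) (n : ℕ) (x : K.homology n) :
    homologyLin (f + g) n x = homologyLin f n x + homologyLin g n x := by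
  rw [homologyLin, HomologicalComplex.homologyMap_add]
  rfl

lemma homologyLin_sub_apply (f g : K ⟶ L) (n : ℕ) (x : K.homology n) :
    homologyLin (f - g) n x = homologyLin f n x - homologyLin g n x := by
  rw [homologyLin, HomologicalComplex.homologyMap_sub]
  rfl

end ChainComplex

namespace TopCat

open Simplicial SSet ChainComplex

variable {R : Type} [CommRing R] {X : TopCat.{u}} (U V : Set X)

variable (R) in
/-- The map from the chains of the first set of a cover to small chains. -/
def toSmallLeft : (singularChains R).obj (TopCat.of U) ⟶ smallComplex R U V where
  f n := ModuleCat.ofHom ((inclChains R U n).codRestrict (smallChains R U V n)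
    (inclChains_mem_smallChains_left U V))
  comm' i j _ := ModuleCat.hom_ext (LinearMap.ext fun c => Subtype.ext
    (LinearMap.congr_fun (congr_arg ModuleCat.Hom.hom
      (((singularChains R).map (incl U)).comm i j)) c))

variable (R) in
/-- The map from the chains of the second set of a cover to small chains. -/
def toSmallRight : (singularChains R).obj (TopCat.of V) ⟶ smallComplex R U V where
  f n := ModuleCat.ofHom ((inclChains R V n).codRestrict (smallChains R U V n)
    (inclChains_mem_smallChains_right U V))
  comm' i j _ := ModuleCat.hom_ext (LinearMap.ext fun c => Subtype.ext
    (LinearMap.congr_fun (congr_arg ModuleCat.Hom.hom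
      (((singularChains R).map (incl V)).comm i j)) c))

variable (R) in
/-- The map of complexes induced by the inclusion of an intersection in the first set. -/
abbrev interLeft : (singularChains R).obj (TopCat.of ↥(U ∩ V)) ⟶
    (singularChains R).obj (TopCat.of U) :=
  (singularChains R).map (inclOfLE (Set.inter_subset_left (s := U) (t := V)))

variable (R) in
/-- The map of complexes induced by the inclusion of an intersection in the second set. -/
abbrev interRight : (singularChains R).obj (TopCat.of ↥(U ∩ V)) ⟶
    (singularChains R).obj (TopCat.of V) :=
  (singularChains R).map (inclOfLE (Set.inter_subset_right (s := U) (t := V)))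

lemma interLeft_toSmallLeft :
    interLeft R U V ≫ toSmallLeft R U V = interRight R U V ≫ toSmallRight R U V := by
  have h : interLeft R U V ≫ (singularChains R).map (incl U) =
      interRight R U V ≫ (singularChains R).map (incl V) := by
    rw [← Functor.map_comp, ← Functor.map_comp]
    rfl
  ext n c
  exact Subtype.ext (congr_arg (fun k => (k.f n).hom c) h)

variable (R) in
/-- The Mayer–Vietoris short complex of chain complexes. -/
def mayerVietoris : ShortComplex (ChainComplex (ModuleCat.{u} R) ℕ) where
  X₁ := (singularChains R).obj (TopCat.of ↥(U ∩ V))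
  X₂ := (singularChains R).obj (TopCat.of U) ⊞ (singularChains R).obj (TopCat.of V)
  X₃ := smallComplex R U V
  f := biprod.lift (interLeft R U V) (-interRight R U V)
  g := biprod.desc (toSmallLeft R U V) (toSmallRight R U V)
  zero := by
    rw [biprod.lift_desc, Preadditive.neg_comp, interLeft_toSmallLeft, add_neg_cancel]

lemma mayerVietoris_shortExact : (mayerVietoris R U V).ShortExact := by
  refine HomologicalComplex.shortExact_of_degreewise_shortExact _ fun n => ?_
  set K := (singularChains R).obj (TopCat.of U)
  set L := (singularChains R).obj (TopCat.of V)
  -- Elements of the biproduct of complexes are accessible only through its projections and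
  -- inclusions, so exactness is checked in terms of these four maps.
  let p₁ : ((K ⊞ L : ChainComplex (ModuleCat.{u} R) ℕ)).X n →ₗ[R] K.X n :=
    ((biprod.fst : K ⊞ L ⟶ K).f n).hom
  let p₂ : ((K ⊞ L : ChainComplex (ModuleCat.{u} R) ℕ)).X n →ₗ[R] L.X n :=
    ((biprod.snd : K ⊞ L ⟶ L).f n).hom
  let i₁ : K.X n →ₗ[R] ((K ⊞ L : ChainComplex (ModuleCat.{u} R) ℕ)).X n :=
    ((biprod.inl : K ⟶ K ⊞ L).f n).hom
  let i₂ : L.X n →ₗ[R] ((K ⊞ L : ChainComplex (ModuleCat.{u} R) ℕ)).X n :=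
    ((biprod.inr : L ⟶ K ⊞ L).f n).hom
  have htot : ∀ x, i₁ (p₁ x) + i₂ (p₂ x) = x := fun x =>
    congr_arg (fun k : K ⊞ L ⟶ K ⊞ L => (k.f n).hom x) biprod.total
  have hf₁ : ∀ w, p₁ (((mayerVietoris R U V).f.f n).hom w) = ((interLeft R U V).f n).hom w :=
    fun w => congr_arg (fun k : (singularChains R).obj (TopCat.of ↥(U ∩ V)) ⟶ K =>
      (k.f n).hom w)
      (biprod.lift_fst (interLeft R U V) (-interRight R U V))
  have hf₂ : ∀ w, p₂ (((mayerVietoris R U V).f.f n).hom w) = -((interRight R U V).f n).hom w :=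
    fun w => congr_arg (fun k : (singularChains R).obj (TopCat.of ↥(U ∩ V)) ⟶ L =>
      (k.f n).hom w)
      (biprod.lift_snd (interLeft R U V) (-interRight R U V))
  have hg₁ : ∀ a, ((mayerVietoris R U V).g.f n).hom (i₁ a) = ((toSmallLeft R U V).f n).hom a :=
    fun a => congr_arg (fun k : K ⟶ smallComplex R U V =>
      (k.f n).hom a)
      (biprod.inl_desc (toSmallLeft R U V) (toSmallRight R U V))
  have hg₂ : ∀ a, ((mayerVietoris R U V).g.f n).hom (i₂ a) = ((toSmallRight R U V).f n).hom a :=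
    fun a => congr_arg (fun k : L ⟶ smallComplex R U V =>
      (k.f n).hom a)
      (biprod.inr_desc (toSmallLeft R U V) (toSmallRight R U V))
  have hg : ∀ x, (((mayerVietoris R U V).g.f n).hom x).1 =
      inclChains R U n (p₁ x) + inclChains R V n (p₂ x) := by
    intro x
    refine (congr_arg (fun y => (((mayerVietoris R U V).g.f n).hom y).1) (htot x).symm).trans ?_
    refine (congr_arg Subtype.val (map_add ((mayerVietoris R U V).g.f n).hom _ _)).trans ?_
    rw [hg₁, hg₂]
    rfl
  have hinj : Function.Injective ((mayerVietoris R U V).f.f n).hom := by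
    rw [injective_iff_map_eq_zero]
    intro w hw
    have h₁ := hf₁ w
    have h₁ := (h₁.symm.trans (congr_arg p₁ hw)).trans (map_zero p₁)
    refine inclChains_injective (U ∩ V) n ?_
    refine Eq.trans ?_ (map_zero (inclChains R (U ∩ V) n)).symm
    refine Eq.trans ?_ ((congr_arg (inclChains R U n) h₁).trans (map_zero _))
    exact congr_arg (fun k : (singularChains R).obj (TopCat.of ↥(U ∩ V)) ⟶
      (singularChains R).obj X => (k.f n).hom w)
      ((singularChains R).map_comp (inclOfLE (Set.inter_subset_left (s := U) (t := V))) (incl U))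
  have hsurj : Function.Surjective ((mayerVietoris R U V).g.f n).hom := by
    rintro ⟨c, hc⟩
    obtain ⟨a, b, rfl⟩ := exists_eq_inclChains_add U V hc
    refine ⟨i₁ a + i₂ b, ?_⟩
    refine (map_add ((mayerVietoris R U V).g.f n).hom _ _).trans ?_
    rw [hg₁, hg₂]
    rfl
  refine @ShortComplex.ShortExact.mk _ _ _ _ ?_ ((ModuleCat.mono_iff_injective _).2 hinj)
    ((ModuleCat.epi_iff_surjective _).2 hsurj)
  · rw [ShortComplex.moduleCat_exact_iff]
    intro x hx
    have hx' := hg x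
    rw [show ((mayerVietoris R U V).g.f n).hom x = 0 from hx] at hx'
    obtain ⟨w, h₁, h₂⟩ := exists_of_inclChains_add_eq_zero U V (p₁ x) (p₂ x) hx'.symm
    refine ⟨w, ?_⟩
    refine (htot _).symm.trans (Eq.trans ?_ (htot x))
    refine congr_arg₂ (· + ·) (congr_arg i₁ ((hf₁ w).trans h₁)) (congr_arg i₂ ((hf₂ w).trans ?_))
    exact (congr_arg (- ·) h₂).trans (neg_neg _)

variable {U V}

/-- The part of the Mayer–Vietoris sequence around a surjection
`H_{n+1}(U ∩ V) → H_{n+1}(U) ⊕ H_{n+1}(V)`. -/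
theorem nonempty_homology_equiv_ker (hU : IsOpen U) (hV : IsOpen V) (hUV : U ∪ V = Set.univ)
    (n : ℕ) (h : ∀ (a : (homologyFunctor R (n + 1)).obj (TopCat.of U))
      (b : (homologyFunctor R (n + 1)).obj (TopCat.of V)),
      ∃ w : (homologyFunctor R (n + 1)).obj (TopCat.of ↥(U ∩ V)),
        ((homologyFunctor R (n + 1)).map (inclOfLE Set.inter_subset_left)).hom w = a ∧
        ((homologyFunctor R (n + 1)).map (inclOfLE Set.inter_subset_right)).hom w = b) :
    Nonempty ((homologyFunctor R (n + 1)).obj X ≃ₗ[R]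
      ↥(LinearMap.ker ((homologyFunctor R n).map
          (inclOfLE (Set.inter_subset_left (s := U) (t := V)))).hom ⊓
        LinearMap.ker ((homologyFunctor R n).map
          (inclOfLE (Set.inter_subset_right (s := U) (t := V)))).hom)) := by
  have hS := mayerVietoris_shortExact (R := R) U V
  set K := (singularChains R).obj (TopCat.of U)
  set L := (singularChains R).obj (TopCat.of V)
  let δ : (smallComplex R U V).homology (n + 1) →ₗ[R]
      ((singularChains R).obj (TopCat.of ↥(U ∩ V))).homology n := (hS.δ (n + 1) n rfl).hom
  let φ : (singularChains R).obj (TopCat.of ↥(U ∩ V)) ⟶ K ⊞ L :=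
    biprod.lift (interLeft R U V) (-interRight R U V)
  have he : φ = interLeft R U V ≫ (biprod.inl : K ⟶ K ⊞ L) - interRight R U V ≫ biprod.inr := by
    refine (biprod.lift_eq).trans ?_
    rw [Preadditive.neg_comp, ← sub_eq_add_neg]
  have hlift : ∀ m w, homologyLin φ m w =
      homologyLin (biprod.inl : K ⟶ K ⊞ L) m (homologyLin (interLeft R U V) m w) -
        homologyLin (biprod.inr : L ⟶ K ⊞ L) m (homologyLin (interRight R U V) m w) := by
    intro m w
    rw [he, homologyLin_comp_apply, homologyLin_comp_apply, homologyLin_sub_apply]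
  have htot : ∀ m (x : (K ⊞ L).homology m),
      homologyLin (biprod.inl : K ⟶ K ⊞ L) m (homologyLin biprod.fst m x) +
        homologyLin (biprod.inr : L ⟶ K ⊞ L) m (homologyLin biprod.snd m x) = x := by
    intro m x
    rw [homologyLin_comp_apply, homologyLin_comp_apply, ← homologyLin_add_apply, biprod.total,
      homologyLin_id_apply]
  -- By `h` every class of `K ⊞ L` in degree `n + 1` comes from the intersection, so the next map of
  -- the long exact sequence is zero and `δ` is injective. The sign in the second component matches
  -- the one in `φ`.
  have hδ : Function.Injective δ := by
    rw [injective_iff_map_eq_zero]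
    intro y hy
    obtain ⟨x, rfl⟩ := (ShortComplex.moduleCat_exact_iff _).1
      (hS.homology_exact₃ (n + 1) n rfl) y hy
    obtain ⟨w, h₁, h₂⟩ := h (homologyLin (biprod.fst : K ⊞ L ⟶ K) (n + 1) x)
      (-homologyLin (biprod.snd : K ⊞ L ⟶ L) (n + 1) x)
    have hx : homologyLin φ (n + 1) w = x := by
      refine (hlift (n + 1) w).trans (Eq.trans ?_ (htot (n + 1) x))
      refine (congr_arg₂ (fun a b => homologyLin (biprod.inl : K ⟶ K ⊞ L) (n + 1) a -
        homologyLin (biprod.inr : L ⟶ K ⊞ L) (n + 1) b) h₁ h₂).trans ?_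
      rw [map_neg, sub_neg_eq_add]
    rw [← hx]
    refine (homologyLin_comp_apply (mayerVietoris R U V).f (mayerVietoris R U V).g _ w).trans ?_
    exact (congr_arg (fun k => homologyLin k (n + 1) w) (mayerVietoris R U V).zero).trans
      (homologyLin_zero_apply _ w)
  have hrange : LinearMap.range δ = LinearMap.ker ((homologyFunctor R n).map
          (inclOfLE (Set.inter_subset_left (s := U) (t := V)))).hom ⊓
        LinearMap.ker ((homologyFunctor R n).map
          (inclOfLE (Set.inter_subset_right (s := U) (t := V)))).hom := by
    have hker : LinearMap.range δ = LinearMap.ker (homologyLin φ n) :=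
      (hS.homology_exact₁ (n + 1) n rfl).moduleCat_range_eq_ker
    rw [hker]
    ext (w : ((singularChains R).obj (TopCat.of ↥(U ∩ V))).homology n)
    refine Iff.trans (Eq.congr_left (hlift n w)) ⟨fun h0 => ⟨?_, ?_⟩, fun ⟨h₁, h₂⟩ => ?_⟩
    · have := congr_arg (homologyLin (biprod.fst : K ⊞ L ⟶ K) n) h0
      rw [map_sub, map_zero, homologyLin_comp_apply biprod.inl biprod.fst,
        homologyLin_comp_apply biprod.inr biprod.fst, biprod.inl_fst, biprod.inr_fst,
        homologyLin_id_apply, homologyLin_zero_apply, sub_zero] at this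
      exact this
    · have := congr_arg (homologyLin (biprod.snd : K ⊞ L ⟶ L) n) h0
      rw [map_sub, map_zero, homologyLin_comp_apply biprod.inl biprod.snd,
        homologyLin_comp_apply biprod.inr biprod.snd, biprod.inl_snd, biprod.inr_snd,
        homologyLin_id_apply, homologyLin_zero_apply, zero_sub,
        neg_eq_zero] at this
      exact this
    · refine (congr_arg₂ (fun a b => homologyLin (biprod.inl : K ⟶ K ⊞ L) n a -
        homologyLin (biprod.inr : L ⟶ K ⊞ L) n b) h₁ h₂).trans ?_
      exact (congr_arg₂ (· - ·) (map_zero (homologyLin (biprod.inl : K ⟶ K ⊞ L) n))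
        (map_zero (homologyLin (biprod.inr : L ⟶ K ⊞ L) n))).trans (sub_zero _)
  exact ⟨(LinearEquiv.ofBijective _ (smallIncl_homology_bijective hU hV hUV (n + 1))).symm ≪≫ₗ
    LinearEquiv.ofInjective δ hδ ≪≫ₗ LinearEquiv.ofEq _ _ hrange⟩

end TopCat

end

noncomputable section

/-! ### Deformations of joins and cones -/

namespace ContinuousMap

open Topology

/-- A retraction of a space descends to a homotopy equivalence of a quotient of that space if the
deformation descends. -/
lemma exists_homotopyInverse_of_isQuotientMap {A B W : Type u} [TopologicalSpace A]
    [TopologicalSpace B] [TopologicalSpace W] {q : A → W} (hq : IsQuotientMap q) (r : C(A, B))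
    (s : C(B, A)) (h : C(A × unitInterval, A)) (hr : ∀ a b, q a = q b → r a = r b)
    (hrs : ∀ b, r (s b) = b) (hh : ∀ a b t, q a = q b → q (h (a, t)) = q (h (b, t)))
    (h₀ : ∀ a, q (h (a, 0)) = q (s (r a))) (h₁ : ∀ a, q (h (a, 1)) = q a) :
    ∃ (ρ : C(W, B)) (τ : C(B, W)), (∀ a, ρ (q a) = r a) ∧ (τ.comp ρ).Homotopic (.id W) ∧
      (ρ.comp τ).Homotopic (.id B) := by
  let g := Function.surjInv hq.surjective
  have hg : ∀ w, q (g w) = w := Function.surjInv_eq hq.surjective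
  have hρ : ∀ a, r (g (q a)) = r a := fun a => hr _ _ (hg _)
  let ρ : C(W, B) := ⟨fun w => r (g w), hq.continuous_iff.2 (by
    convert r.continuous using 1; exact funext hρ)⟩
  let τ : C(B, W) := ⟨fun b => q (s b), hq.continuous.comp s.continuous⟩
  let k : W × unitInterval → W := fun p => q (h (g p.1, p.2))
  -- The product of a quotient map with the locally compact unit interval is again a quotient map,
  -- so the descended homotopy is continuous on `W × [0,1]`.
  have hk : Continuous k := by
    refine hq.continuous_lift_prod_left ?_
    convert hq.continuous.comp h.continuous using 1
    exact funext fun p => hh _ _ _ (hg _)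
  refine ⟨ρ, τ, hρ, ⟨⟨⟨fun p => k (p.2, p.1), hk.comp continuous_swap⟩, fun w => ?_,
    fun w => ?_⟩⟩, ?_⟩
  · exact h₀ _
  · exact (h₁ _).trans (hg w)
  · have : ρ.comp τ = .id B := ContinuousMap.ext fun b => (hρ _).trans (hrs b)
    rw [this]

end ContinuousMap

namespace unitInterval

/-- The point `(1 - s) c + s t` of the unit interval. -/
def mix (c t s : unitInterval) : unitInterval :=
  ⟨(1 - s) * c + s * t, by
    have := convex_Icc (0 : ℝ) 1 c.2 t.2 (one_minus_nonneg s) (nonneg s) (by ring)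
    simpa using this⟩

lemma continuous_mix (c : unitInterval) :
    Continuous fun p : unitInterval × unitInterval => mix c p.1 p.2 :=
  Continuous.subtype_mk (by fun_prop) _

@[simp]
lemma mix_zero (c t : unitInterval) : mix c t 0 = c := Subtype.ext (by simp [mix])

@[simp]
lemma mix_one (c t : unitInterval) : mix c t 1 = t := Subtype.ext (by simp [mix])

@[simp]
lemma mix_self (c s : unitInterval) : mix c c s = c := Subtype.ext (by simp only [mix]; ring)

lemma mix_mem_of_convex {S : Set ℝ} (hS : Convex ℝ S) {c t : unitInterval} (hc : (c : ℝ) ∈ S)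
    (ht : (t : ℝ) ∈ S) (s : unitInterval) : (mix c t s : ℝ) ∈ S := by
  have := hS hc ht (one_minus_nonneg s) (nonneg s) (by ring)
  simpa [mix] using this

end unitInterval

open unitInterval

namespace ConeSpace

lemma mk_eq_iff {Z : Type u} {p q : Z × unitInterval} :
    (Quot.mk _ p : ConeSpace Z) = Quot.mk _ q ↔ p = q ∨ p.2 = 0 ∧ q.2 = 0 := by
  refine ⟨fun h => ?_, ?_⟩
  · replace h := Quot.eqvGen_exact h
    induction h with
    | rel x y h => exact Or.inr h
    | refl x => exact Or.inl rfl
    | symm x y _ ih => exact ih.imp Eq.symm And.symm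
    | trans x y z _ _ ih₁ ih₂ =>
      obtain rfl | h := ih₁
      · exact ih₂
      · obtain rfl | h' := ih₂
        exacts [Or.inr h, Or.inr ⟨h.1, h'.2⟩]
  · rintro (rfl | h)
    exacts [rfl, Quot.sound h]

instance {Z : Type u} [TopologicalSpace Z] [Nonempty Z] : ContractibleSpace (ConeSpace Z) := by
  obtain ⟨z₀⟩ := ‹Nonempty Z›
  obtain ⟨ρ, τ, -, h, h'⟩ := ContinuousMap.exists_homotopyInverse_of_isQuotientMap
    (isQuotientMap_quot_mk (r := coneRel Z)) (.const _ PUnit.unit.{u + 1}) (.const _ (z₀, 0))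
    ⟨fun p => (p.1.1, mix 0 p.1.2 p.2), by
      exact (continuous_fst.comp continuous_fst).prodMk ((continuous_mix 0).comp
        ((continuous_snd.comp continuous_fst).prodMk continuous_snd))⟩
    (fun _ _ _ => rfl) (fun _ => rfl) (fun a b t hab => by
      rw [mk_eq_iff] at hab ⊢
      obtain rfl | ⟨ha, hb⟩ := hab
      · exact Or.inl rfl
      · refine Or.inr ⟨?_, ?_⟩
        · change mix 0 a.2 t = 0
          rw [ha, mix_self]
        · change mix 0 b.2 t = 0
          rw [hb, mix_self])
    (fun a => mk_eq_iff.2 (Or.inr ⟨mix_zero _ _, rfl⟩)) (fun a => by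
      change Quot.mk _ (a.1, mix 0 a.2 1) = _
      rw [mix_one])
  exact ContinuousMap.HomotopyEquiv.contractibleSpace (Y := PUnit.{u + 1}) ⟨ρ, τ, h, h'⟩

end ConeSpace

namespace JoinSpace

/-- The identifications at the two ends never compose, because `0 ≠ 1`; this explicit relation is
therefore already transitive. -/
lemma mk_eq_iff {X Y : Type u} {p q : X × Y × unitInterval} :
    (Quot.mk _ p : JoinSpace X Y) = Quot.mk _ q ↔ p = q ∨
      (p.2.1 = q.2.1 ∧ p.2.2 = 0 ∧ q.2.2 = 0) ∨ (p.1 = q.1 ∧ p.2.2 = 1 ∧ q.2.2 = 1) := by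
  refine ⟨fun h => ?_, ?_⟩
  · replace h := Quot.eqvGen_exact h
    induction h with
    | rel x y h =>
      cases h with
      | zero => exact Or.inr (Or.inl ⟨rfl, rfl, rfl⟩)
      | one => exact Or.inr (Or.inr ⟨rfl, rfl, rfl⟩)
    | refl x => exact Or.inl rfl
    | symm x y _ ih =>
      exact ih.imp Eq.symm (Or.imp (fun h => ⟨h.1.symm, h.2.symm⟩)
        fun h => ⟨h.1.symm, h.2.symm⟩)
    | trans x y z _ _ ih₁ ih₂ =>
      obtain rfl | ⟨h, h₀, h₀'⟩ | ⟨h, h₀, h₀'⟩ := ih₁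
      · exact ih₂
      · obtain rfl | ⟨k, -, k₀⟩ | ⟨k, k₀, -⟩ := ih₂
        · exact Or.inr (Or.inl ⟨h, h₀, h₀'⟩)
        · exact Or.inr (Or.inl ⟨h.trans k, h₀, k₀⟩)
        · exact absurd (h₀'.symm.trans k₀) zero_ne_one
      · obtain rfl | ⟨k, k₀, -⟩ | ⟨k, -, k₀⟩ := ih₂
        · exact Or.inr (Or.inr ⟨h, h₀, h₀'⟩)
        · exact absurd (k₀.symm.trans h₀') zero_ne_one
        · exact Or.inr (Or.inr ⟨h.trans k, h₀, k₀⟩)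
  · obtain ⟨x, y, t⟩ := p
    obtain ⟨x', y', t'⟩ := q
    rintro (h | ⟨rfl, rfl, rfl⟩ | ⟨rfl, rfl, rfl⟩)
    exacts [congr_arg _ h, Quot.sound (.zero _ _ _), Quot.sound (.one _ _ _)]

variable {X Y : Type u} [TopologicalSpace X] [TopologicalSpace Y]

/-- The coordinate `[x, y, t] ↦ t` on a join. -/
def height : C(JoinSpace X Y, unitInterval) where
  toFun := Quot.lift (fun p => p.2.2) fun _ _ h => by cases h <;> rfl
  continuous_toFun := continuous_quot_lift _ (by fun_prop)

/-- A part of a join over an interval retracts to the common value of a retraction of the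
fibres. -/
lemma exists_homotopyInverse {B : Type u} [TopologicalSpace B] {S : Set ℝ} (hS : Convex ℝ S)
    (hS' : IsOpen S) (c : unitInterval) (hc : (c : ℝ) ∈ S) (r : C(X × Y, B)) (s : C(B, X × Y))
    (hrs : ∀ b, r (s b) = b)
    (hr : ∀ (a b : X × Y × unitInterval), (a.2.2 : ℝ) ∈ S → (b.2.2 : ℝ) ∈ S →
      (Quot.mk _ a : JoinSpace X Y) = Quot.mk _ b → r (a.1, a.2.1) = r (b.1, b.2.1))
    (hh : ∀ (a b : X × Y × unitInterval) (t : unitInterval), (a.2.2 : ℝ) ∈ S → (b.2.2 : ℝ) ∈ S →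
      (Quot.mk _ a : JoinSpace X Y) = Quot.mk _ b →
      (Quot.mk _ (a.1, a.2.1, mix c a.2.2 t) : JoinSpace X Y) =
        Quot.mk _ (b.1, b.2.1, mix c b.2.2 t))
    (h₀ : ∀ a : X × Y, (Quot.mk _ (a.1, a.2, c) : JoinSpace X Y) =
      Quot.mk _ ((s (r a)).1, (s (r a)).2, c)) :
    ∃ (ρ : C({j : JoinSpace X Y | (height j : ℝ) ∈ S}, B))
      (τ : C(B, {j : JoinSpace X Y | (height j : ℝ) ∈ S})),
      (∀ x y t h, ρ ⟨Quot.mk _ (x, y, t), h⟩ = r (x, y)) ∧ (τ.comp ρ).Homotopic (.id _) ∧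
      (ρ.comp τ).Homotopic (.id B) := by
  -- Openness of the part is needed for the restricted projection to remain a quotient map.
  have hq := (isQuotientMap_quot_mk (r := joinRel X Y)).restrictPreimage_isOpen
    (s := {j | (height j : ℝ) ∈ S}) (hS'.preimage (by fun_prop))
  let A : Set (X × Y × unitInterval) := {a | (a.2.2 : ℝ) ∈ S}
  obtain ⟨ρ, τ, h₁, h₂, h₃⟩ := ContinuousMap.exists_homotopyInverse_of_isQuotientMap (A := A) hq
    ⟨fun a => r (a.1.1, a.1.2.1), by fun_prop⟩
    ⟨fun b => ⟨((s b).1, (s b).2, c), hc⟩, by fun_prop⟩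
    ⟨fun p => ⟨(p.1.1.1, p.1.1.2.1, mix c p.1.1.2.2 p.2), mix_mem_of_convex hS hc p.1.2 _⟩,
      Continuous.subtype_mk (Continuous.prodMk (by fun_prop) (Continuous.prodMk (by fun_prop)
        ((continuous_mix c).comp (f := fun p : A × unitInterval => (p.1.1.2.2, p.2))
          (by fun_prop)))) _⟩
    (fun a b hab => hr _ _ a.2 b.2 (congr_arg Subtype.val hab)) hrs
    (fun a b t hab => Subtype.ext (hh _ _ t a.2 b.2 (congr_arg Subtype.val hab)))
    (fun a => Subtype.ext (by
      change Quot.mk _ (a.1.1, a.1.2.1, mix c a.1.2.2 0) = _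
      rw [mix_zero]
      exact h₀ (a.1.1, a.1.2.1)))
    (fun a => Subtype.ext (by
      change Quot.mk _ (a.1.1, a.1.2.1, mix c a.1.2.2 1) = _
      rw [mix_one]
      rfl))
  exact ⟨ρ, τ, fun x y t h => h₁ ⟨(x, y, t), h⟩, h₂, h₃⟩

end JoinSpace

end

/-! ### The open cover of a join, and its homology as a common kernel of projections. -/

noncomputable section

open unitInterval

namespace JoinSpace

variable (X Y : Type u) [TopologicalSpace X] [TopologicalSpace Y]

/-- The part of a join away from the end `t = 1`. -/
abbrev leftPart : Set (TopCat.of (JoinSpace X Y)) := {j | (height j : ℝ) ∈ Set.Iio 1}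

/-- The part of a join away from the end `t = 0`. -/
abbrev rightPart : Set (TopCat.of (JoinSpace X Y)) := {j | (height j : ℝ) ∈ Set.Ioi 0}

lemma isOpen_leftPart : IsOpen (leftPart X Y) :=
  (isOpen_Iio (a := (1 : ℝ))).preimage (f := fun j : JoinSpace X Y => (height j : ℝ)) (by fun_prop)

lemma isOpen_rightPart : IsOpen (rightPart X Y) :=
  (isOpen_Ioi (a := (0 : ℝ))).preimage (f := fun j : JoinSpace X Y => (height j : ℝ)) (by fun_prop)

lemma leftPart_union_rightPart : leftPart X Y ∪ rightPart X Y = Set.univ := by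
  refine Set.eq_univ_of_forall fun j => ?_
  obtain h | h := lt_or_ge (height j : ℝ) 1
  · exact Or.inl h
  · exact Or.inr (zero_lt_one.trans_le h)

variable {X Y}

/-- Sliding `t` to `0`, where the coordinate in `X` is forgotten, leaves a copy of `Y`. A point of
`X` is needed to map back. -/
lemma exists_homotopyInverse_leftPart [Nonempty X] :
    ∃ (ρ : C(leftPart X Y, Y)) (τ : C(Y, leftPart X Y)),
      (∀ x y t h, ρ ⟨Quot.mk _ (x, y, t), h⟩ = y) ∧ (τ.comp ρ).Homotopic (.id _) ∧
      (ρ.comp τ).Homotopic (.id Y) := by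
  obtain ⟨x₀⟩ := ‹Nonempty X›
  refine exists_homotopyInverse (convex_Iio 1) isOpen_Iio 0 (by simp) .snd
    (.prodMk (.const _ x₀) (.id Y)) (fun _ => rfl) (fun a b ha hb hab => ?_)
    (fun a b t ha hb hab => ?_) fun a => mk_eq_iff.2 (Or.inr (Or.inl ⟨rfl, rfl, rfl⟩))
  · obtain rfl | h | h := mk_eq_iff.1 hab
    · rfl
    · exact h.1
    · simp [h.2.1] at ha
  · obtain rfl | h | h := mk_eq_iff.1 hab
    · rfl
    · rw [h.1, h.2.1, h.2.2, mix_self]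
      exact mk_eq_iff.2 (Or.inr (Or.inl ⟨rfl, rfl, rfl⟩))
    · simp [h.2.1] at ha

lemma exists_homotopyInverse_rightPart [Nonempty Y] :
    ∃ (ρ : C(rightPart X Y, X)) (τ : C(X, rightPart X Y)),
      (∀ x y t h, ρ ⟨Quot.mk _ (x, y, t), h⟩ = x) ∧ (τ.comp ρ).Homotopic (.id _) ∧
      (ρ.comp τ).Homotopic (.id X) := by
  obtain ⟨y₀⟩ := ‹Nonempty Y›
  refine exists_homotopyInverse (convex_Ioi 0) isOpen_Ioi 1 (by simp) .fst
    (.prodMk (.id X) (.const _ y₀)) (fun _ => rfl) (fun a b ha hb hab => ?_)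
    (fun a b t ha hb hab => ?_) fun a => mk_eq_iff.2 (Or.inr (Or.inr ⟨rfl, rfl, rfl⟩))
  · obtain rfl | h | h := mk_eq_iff.1 hab
    · rfl
    · simp [h.2.1] at ha
    · exact h.1
  · obtain rfl | h | h := mk_eq_iff.1 hab
    · rfl
    · simp [h.2.1] at ha
    · rw [h.1, h.2.1, h.2.2, mix_self]
      exact mk_eq_iff.2 (Or.inr (Or.inr ⟨rfl, rfl, rfl⟩))

/-- Away from both ends nothing is identified, and `t` slides to `1 / 2`. -/
lemma exists_homotopyInverse_inter :
    ∃ (ρ : C(↥(leftPart X Y ∩ rightPart X Y), X × Y))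
      (τ : C(X × Y, ↥(leftPart X Y ∩ rightPart X Y))),
      (∀ x y t h, ρ ⟨Quot.mk _ (x, y, t), h⟩ = (x, y)) ∧ (τ.comp ρ).Homotopic (.id _) ∧
      (ρ.comp τ).Homotopic (.id (X × Y)) := by
  have key : ∀ a b : X × Y × unitInterval, (a.2.2 : ℝ) ∈ Set.Iio (1 : ℝ) ∩ Set.Ioi (0 : ℝ) →
      (Quot.mk _ a : JoinSpace X Y) = Quot.mk _ b → a = b := fun a b ha hab => by
    obtain rfl | h | h := mk_eq_iff.1 hab
    · rfl
    · simp [h.2.1] at ha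
    · simp [h.2.1] at ha
  exact exists_homotopyInverse (S := Set.Iio (1 : ℝ) ∩ Set.Ioi (0 : ℝ))
    ((convex_Iio 1).inter (convex_Ioi 0)) (isOpen_Iio.inter isOpen_Ioi) ⟨1 / 2, by norm_num⟩
    (by constructor <;> norm_num) (.id _) (.id _) (fun _ => rfl)
    (fun a b ha _ hab => by rw [key a b ha hab])
    (fun a b t ha _ hab => by rw [key a b ha hab]) fun _ => rfl

end JoinSpace

namespace TopCat

variable {R : Type} [CommRing R]

lemma homology_map_const {A B : Type u} [TopologicalSpace A] [TopologicalSpace B] (b : B) (n : ℕ)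
    (x : (homologyFunctor R (n + 1)).obj (TopCat.of A)) :
    ((homologyFunctor R (n + 1)).map (ofHom (.const A b))).hom x = 0 := by
  have h : ofHom (.const A b) = ofHom (.const A PUnit.unit) ≫ ofHom (.const PUnit.{u + 1} b) := rfl
  have hz := isZero_homologyFunctor_of_contractible (R := R) (TopCat.of PUnit.{u + 1}) n
  rw [h, Functor.map_comp, hz.eq_zero_of_tgt ((homologyFunctor R (n + 1)).map _), zero_comp]
  rfl

lemma homology_map_comp_apply {A B C : TopCat.{u}} (f : A ⟶ B) (g : B ⟶ C) (n : ℕ)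
    (x : (homologyFunctor R n).obj A) :
    ((homologyFunctor R n).map (f ≫ g)).hom x =
      ((homologyFunctor R n).map g).hom (((homologyFunctor R n).map f).hom x) := by
  rw [Functor.map_comp]
  rfl

end TopCat

namespace JoinSpace

open TopCat

variable (R : Type) [CommRing R] (X Y : Type u) [TopologicalSpace X] [TopologicalSpace Y]

/-- The homology of the join of two nonempty spaces. -/
theorem nonempty_homology_equiv [Nonempty X] [Nonempty Y] (n : ℕ) :
    Nonempty ((homologyFunctor R (n + 1)).obj (TopCat.of (JoinSpace X Y)) ≃ₗ[R]
      ↥(LinearMap.ker ((homologyFunctor R n).map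
          (ofHom ContinuousMap.fst : TopCat.of (X × Y) ⟶ TopCat.of X)).hom ⊓
        LinearMap.ker ((homologyFunctor R n).map
          (ofHom ContinuousMap.snd : TopCat.of (X × Y) ⟶ TopCat.of Y)).hom)) := by
  obtain ⟨ρU, τU, hU, hU₁, hU₂⟩ := exists_homotopyInverse_leftPart (X := X) (Y := Y)
  obtain ⟨ρV, τV, hV, hV₁, hV₂⟩ := exists_homotopyInverse_rightPart (X := X) (Y := Y)
  obtain ⟨ρ, τ, h, h₁, h₂⟩ := exists_homotopyInverse_inter (X := X) (Y := Y)
  have iU := isIso_homologyFunctor_map (R := R) (ofHom ρU) (ofHom τU) hU₁ hU₂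
  have iV := isIso_homologyFunctor_map (R := R) (ofHom ρV) (ofHom τV) hV₁ hV₂
  have i := isIso_homologyFunctor_map (R := R) (ofHom ρ) (ofHom τ) h₁ h₂
  let jU := inclOfLE (Set.inter_subset_left (s := leftPart X Y) (t := rightPart X Y))
  let jV := inclOfLE (Set.inter_subset_right (s := leftPart X Y) (t := rightPart X Y))
  have eU : jU ≫ ofHom ρU = ofHom ρ ≫ ofHom ContinuousMap.snd := by
    ext ⟨⟨x, y, t⟩, hj⟩
    exact (hU x y t hj.1).trans (congr_arg Prod.snd (h x y t hj)).symm
  have eV : jV ≫ ofHom ρV = ofHom ρ ≫ ofHom ContinuousMap.fst := by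
    ext ⟨⟨x, y, t⟩, hj⟩
    exact (hV x y t hj.2).trans (congr_arg Prod.fst (h x y t hj)).symm
  have cU : ∀ m w, ((homologyFunctor R m).map (ofHom ρU)).hom
      (((homologyFunctor R m).map jU).hom w) = ((homologyFunctor R m).map
      (ofHom ContinuousMap.snd)).hom (((homologyFunctor R m).map (ofHom ρ)).hom w) := by
    intro m w
    rw [← homology_map_comp_apply, eU, homology_map_comp_apply]
  have cV : ∀ m w, ((homologyFunctor R m).map (ofHom ρV)).hom
      (((homologyFunctor R m).map jV).hom w) = ((homologyFunctor R m).map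
      (ofHom ContinuousMap.fst)).hom (((homologyFunctor R m).map (ofHom ρ)).hom w) := by
    intro m w
    rw [← homology_map_comp_apply, eV, homology_map_comp_apply]
  have bU : ∀ m, Function.Injective ((homologyFunctor R m).map (ofHom ρU)).hom := fun m =>
    ((ConcreteCategory.isIso_iff_bijective _).1 (iU m)).1
  have bV : ∀ m, Function.Injective ((homologyFunctor R m).map (ofHom ρV)).hom := fun m =>
    ((ConcreteCategory.isIso_iff_bijective _).1 (iV m)).1
  have b : ∀ m, Function.Bijective ((homologyFunctor R m).map (ofHom ρ)).hom := fun m =>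
    (ConcreteCategory.isIso_iff_bijective _).1 (i m)
  obtain ⟨e⟩ := nonempty_homology_equiv_ker (R := R) (isOpen_leftPart X Y) (isOpen_rightPart X Y)
    (leftPart_union_rightPart X Y) n fun a c => by
      obtain ⟨x₀⟩ := ‹Nonempty X›
      obtain ⟨y₀⟩ := ‹Nonempty Y›
      -- The slices through base points are sections of one projection and constant under the other.
      -- Constant maps vanish in the positive degree `n + 1`, so the sum of the two images has
      -- prescribed projections.
      let s : TopCat.of X ⟶ TopCat.of (X × Y) := ofHom (.prodMk (.id X) (.const _ y₀))
      let t : TopCat.of Y ⟶ TopCat.of (X × Y) := ofHom (.prodMk (.const _ x₀) (.id Y))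
      obtain ⟨w, hw⟩ := (b (n + 1)).2 (((homologyFunctor R (n + 1)).map s).hom
        (((homologyFunctor R (n + 1)).map (ofHom ρV)).hom c) +
        ((homologyFunctor R (n + 1)).map t).hom
        (((homologyFunctor R (n + 1)).map (ofHom ρU)).hom a))
      refine ⟨w, bU _ ((cU _ w).trans ?_), bV _ ((cV _ w).trans ?_)⟩
      · rw [hw, map_add, ← homology_map_comp_apply s (ofHom .snd),
          ← homology_map_comp_apply t (ofHom .snd),
          show s ≫ ofHom ContinuousMap.snd = ofHom (.const _ y₀) from rfl,
          show t ≫ ofHom ContinuousMap.snd = 𝟙 _ from rfl, homology_map_const, zero_add,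
          CategoryTheory.Functor.map_id]
        rfl
      · rw [hw, map_add, ← homology_map_comp_apply s (ofHom .fst),
          ← homology_map_comp_apply t (ofHom .fst),
          show t ≫ ofHom ContinuousMap.fst = ofHom (.const _ x₀) from rfl,
          show s ≫ ofHom ContinuousMap.fst = 𝟙 _ from rfl, homology_map_const, add_zero,
          CategoryTheory.Functor.map_id]
        rfl
  refine ⟨e ≪≫ₗ LinearEquiv.ofSubmodules (LinearEquiv.ofBijective _ (b n)) _ _ ?_⟩
  ext z
  constructor
  · rintro ⟨w, ⟨hw₁, hw₂⟩, rfl⟩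
    refine ⟨((cV n w).symm.trans ?_), ((cU n w).symm.trans ?_)⟩
    · exact (congr_arg _ hw₂).trans (map_zero _)
    · exact (congr_arg _ hw₁).trans (map_zero _)
  · rintro ⟨hz₁, hz₂⟩
    obtain ⟨w, rfl⟩ := (b n).2 z
    refine ⟨w, ⟨bU n ?_, bV n ?_⟩, rfl⟩
    · exact ((cU n w).trans hz₂).trans (map_zero _).symm
    · exact ((cV n w).trans hz₁).trans (map_zero _).symm

end JoinSpace

end

noncomputable section

/-! ### Kernels of tensor products of split maps -/

namespace LinearMap

variable {R : Type*} [CommRing R] {A A' B B' : Type*} [AddCommGroup A] [Module R A]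
  [AddCommGroup A'] [Module R A'] [AddCommGroup B] [Module R B] [AddCommGroup B'] [Module R B']

/-- The projection on the kernel of a split surjection. -/
def kerProj (f : A →ₗ[R] A') (s : A' →ₗ[R] A) (h : f ∘ₗ s = .id) : A →ₗ[R] ker f :=
  (LinearMap.id - s ∘ₗ f).codRestrict (ker f) fun x => by
    have := LinearMap.congr_fun h (f x)
    simp only [coe_comp, Function.comp_apply, id_coe, id_eq] at this
    simp [this]

lemma kerProj_comp_subtype (f : A →ₗ[R] A') (s : A' →ₗ[R] A) (h : f ∘ₗ s = .id) :
    kerProj f s h ∘ₗ (ker f).subtype = .id := by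
  ext x
  simp [kerProj]

lemma subtype_comp_kerProj (f : A →ₗ[R] A') (s : A' →ₗ[R] A) (h : f ∘ₗ s = .id) :
    (ker f).subtype ∘ₗ kerProj f s h = .id - s ∘ₗ f := rfl

/-- The tensor product of the inclusions of two kernels. -/
def kerTensorIncl (f : A →ₗ[R] A') (g : B →ₗ[R] B') : ker f ⊗[R] ker g →ₗ[R] A ⊗[R] B :=
  TensorProduct.map (ker f).subtype (ker g).subtype

variable {f : A →ₗ[R] A'} {g : B →ₗ[R] B'} {s : A' →ₗ[R] A} {t : B' →ₗ[R] B}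

lemma kerTensorIncl_injective (hf : f ∘ₗ s = .id) (hg : g ∘ₗ t = .id) :
    Function.Injective (kerTensorIncl f g) := by
  refine Function.LeftInverse.injective (g := TensorProduct.map (kerProj f s hf) (kerProj g t hg))
    fun x => ?_
  rw [kerTensorIncl, ← comp_apply, ← TensorProduct.map_comp, kerProj_comp_subtype,
    kerProj_comp_subtype, TensorProduct.map_id]
  rfl

lemma map_id_kerTensorIncl (x : ker f ⊗[R] ker g) :
    TensorProduct.map (.id : A →ₗ[R] A) g (kerTensorIncl f g x) = 0 := by
  have h : g ∘ₗ (ker g).subtype = 0 := comp_ker_subtype g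
  rw [kerTensorIncl, ← comp_apply, ← TensorProduct.map_comp, h, TensorProduct.map_zero_right]
  rfl

lemma map_kerTensorIncl_id (x : ker f ⊗[R] ker g) :
    TensorProduct.map f (.id : B →ₗ[R] B) (kerTensorIncl f g x) = 0 := by
  have h : f ∘ₗ (ker f).subtype = 0 := comp_ker_subtype f
  rw [kerTensorIncl, ← comp_apply, ← TensorProduct.map_comp, h, TensorProduct.map_zero_left]
  rfl

/-- The projection `(1 - s f) ⊗ (1 - t g)` onto the tensor product of the kernels fixes `x`: in its
expansion every term but the identity factors through `f ⊗ id` or `id ⊗ g`. -/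
lemma exists_kerTensorIncl_eq (hf : f ∘ₗ s = .id) (hg : g ∘ₗ t = .id) {x : A ⊗[R] B}
    (h₁ : TensorProduct.map f (.id : B →ₗ[R] B) x = 0)
    (h₂ : TensorProduct.map (.id : A →ₗ[R] A) g x = 0) : ∃ w, kerTensorIncl f g w = x := by
  refine ⟨TensorProduct.map (kerProj f s hf) (kerProj g t hg) x, ?_⟩
  have e₁ : TensorProduct.map f g x = 0 := by
    have : TensorProduct.map f g = TensorProduct.map f .id ∘ₗ TensorProduct.map .id g := by
      rw [← TensorProduct.map_comp]; rfl
    rw [this, comp_apply, h₂, map_zero]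
  rw [kerTensorIncl, ← comp_apply, ← TensorProduct.map_comp, subtype_comp_kerProj,
    subtype_comp_kerProj]
  have e : TensorProduct.map (.id - s ∘ₗ f) (.id - t ∘ₗ g) = .id -
      TensorProduct.map s .id ∘ₗ TensorProduct.map f .id -
      TensorProduct.map .id t ∘ₗ TensorProduct.map .id g +
      TensorProduct.map s t ∘ₗ TensorProduct.map f g := by
    refine TensorProduct.ext' fun a b => ?_
    simp only [TensorProduct.map_tmul, sub_apply, add_apply, comp_apply, id_apply,
      TensorProduct.sub_tmul, TensorProduct.tmul_sub]
    abel
  rw [e]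
  simp [h₁, h₂, e₁]

end LinearMap

lemma DirectSum.mem_range_lmap {R ι : Type*} [Semiring R] {M N : ι → Type*}
    [∀ i, AddCommMonoid (M i)] [∀ i, Module R (M i)] [∀ i, AddCommMonoid (N i)]
    [∀ i, Module R (N i)] (f : ∀ i, M i →ₗ[R] N i) (x : ⨁ i, N i) :
    x ∈ LinearMap.range (DirectSum.lmap f) ↔ ∀ i, x i ∈ LinearMap.range (f i) := by
  simp [DirectSum.range_lmap]

/-! ### The homology of joins -/

namespace TopCat

open MonoidalCategory ChainComplex SSet

variable {R : Type} [CommRing R]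

/-- A map from a nonempty space to a contractible space induces split surjections in homology. -/
lemma exists_section_homology {A B : TopCat.{u}} [Nonempty A] [ContractibleSpace B] (f : A ⟶ B)
    (n : ℕ) : ∃ s : (homologyFunctor R n).obj B →ₗ[R] (homologyFunctor R n).obj A,
      ((homologyFunctor R n).map f).hom ∘ₗ s = .id := by
  obtain ⟨a⟩ := ‹Nonempty A›
  obtain ⟨b, hb⟩ := id_nullhomotopic B
  have hab : ContinuousMap.Homotopic (.id B) (.const B (f a)) :=
    hb.trans (hb.comp (.refl (.const B (f a)))).symm
  -- The constant map at `a` followed by `f` is again constant, hence homotopic to the identity of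
  -- the contractible space `B`.
  refine ⟨((homologyFunctor R n).map (ofHom (.const B a))).hom, ?_⟩
  rw [← ModuleCat.hom_comp, ← Functor.map_comp,
    homologyFunctor_map_eq (f := ofHom (.const B a) ≫ f) (g := 𝟙 B) hab.symm,
    CategoryTheory.Functor.map_id]
  rfl

variable {X Y : Type u} [TopologicalSpace X] [TopologicalSpace Y]

lemma isIso_homologyFunctor_map_snd {A : Type u} [TopologicalSpace A] [ContractibleSpace A]
    (n : ℕ) : IsIso ((homologyFunctor R n).map (ofHom ContinuousMap.snd :
      TopCat.of (A × Y) ⟶ TopCat.of Y)) := by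
  obtain ⟨a, ha⟩ := id_nullhomotopic A
  refine isIso_homologyFunctor_map _ (ofHom (.prodMk (.const Y a) (.id Y))) ?_ ?_ n
  · exact (ContinuousMap.Homotopic.prodMap ha (.refl (.id Y))).symm
  · exact .refl _

lemma isIso_homologyFunctor_map_fst {A : Type u} [TopologicalSpace A] [ContractibleSpace A]
    (n : ℕ) : IsIso ((homologyFunctor R n).map (ofHom ContinuousMap.fst :
      TopCat.of (X × A) ⟶ TopCat.of X)) := by
  obtain ⟨a, ha⟩ := id_nullhomotopic A
  refine isIso_homologyFunctor_map _ (ofHom (.prodMk (.id X) (.const X a))) ?_ ?_ n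
  · exact (ContinuousMap.Homotopic.prodMap (.refl (.id X)) ha).symm
  · exact .refl _

variable (R X Y) in
/-- The tensor product of the kernels of the maps in homology induced by two maps. -/
abbrev KerTensor {X' Y' : TopCat.{u}} (f : TopCat.of X ⟶ X') (g : TopCat.of Y ⟶ Y') (n : ℕ) :
    Type u :=
  ⨁ p : {p : ℕ × ℕ // p.1 + p.2 = n},
    kerObj ((homologyFunctor R p.1.1).map f) ⊗[R] kerObj ((homologyFunctor R p.1.2).map g)

/-- Replacing a factor by a contractible space turns a projection into a product map, to which
naturality of the Künneth map applies. The cones are the intended `X'` and `Y'`; only their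
contractibility is used. -/
lemma nonempty_kerTensor_equiv [IsHereditaryRing.{u} R] [Nonempty X] [Nonempty Y]
    {X' Y' : Type u} [TopologicalSpace X'] [TopologicalSpace Y'] [ContractibleSpace X']
    [ContractibleSpace Y'] (f : TopCat.of X ⟶ TopCat.of X') (g : TopCat.of Y ⟶ TopCat.of Y')
    (hTor : ∀ i j, IsZero (torOne ((homologyFunctor R i).obj (TopCat.of X))
      ((homologyFunctor R j).obj (TopCat.of Y)))) (n : ℕ) :
    Nonempty (KerTensor R X Y f g n ≃ₗ[R]
      ↥(LinearMap.ker ((homologyFunctor R n).map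
          (ofHom ContinuousMap.fst : TopCat.of (X × Y) ⟶ TopCat.of X)).hom ⊓
        LinearMap.ker ((homologyFunctor R n).map
          (ofHom ContinuousMap.snd : TopCat.of (X × Y) ⟶ TopCat.of Y)).hom)) := by
  obtain ⟨κ, hinj, hsurj, hnat⟩ := TopCat.exists_kunneth.{u} R
  choose s hs using exists_section_homology (R := R) f
  choose t ht using exists_section_homology (R := R) g
  let J : KerTensor R X Y f g n →ₗ[R] HomologyTensor ((singularChains R).obj (TopCat.of X))
      ((singularChains R).obj (TopCat.of Y)) n :=
    DirectSum.lmap fun p => LinearMap.kerTensorIncl ((homologyFunctor R p.1.1).map f).hom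
      ((homologyFunctor R p.1.2).map g).hom
  have hJ : Function.Injective J :=
    (DirectSum.lmap_injective _).2 fun p => LinearMap.kerTensorIncl_injective (hs _) (ht _)
  have hid : ∀ (Z : TopCat.{u}) (m : ℕ),
      (HomologicalComplex.homologyMap ((singularChains R).map (𝟙 Z)) m).hom = .id := by
    intro Z m
    rw [CategoryTheory.Functor.map_id, HomologicalComplex.homologyMap_id]
    rfl
  -- The projection factors as `X × Y → X × Y' → X`, whose second map is an isomorphism in homology.
  -- Injectivity of the Künneth map for `X × Y'` then lets the condition be read in each bidegree.
  have hfst : ∀ x, κ (TopCat.of X) (TopCat.of Y) n x ∈ LinearMap.ker ((homologyFunctor R n).map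
      (ofHom ContinuousMap.fst : TopCat.of (X × Y) ⟶ TopCat.of X)).hom ↔
      ∀ p, TensorProduct.map .id ((homologyFunctor R p.1.2).map g).hom (x p) = 0 := by
    intro x
    have h₁ := hnat _ _ _ _ (𝟙 (TopCat.of X)) g n x
    have h₂ := homology_map_comp_apply (R := R)
      (𝟙 (TopCat.of X) ⊗ₘ g : TopCat.of (X × Y) ⟶ TopCat.of (X × Y'))
      (ofHom ContinuousMap.fst) n (κ _ _ n x)
    have h₃ := ((ConcreteCategory.isIso_iff_bijective _).1
      (isIso_homologyFunctor_map_fst (R := R) (X := X) (A := Y') n)).1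
    refine Iff.trans (Eq.congr_left (h₂.trans (congr_arg _ h₁))) ?_
    refine (map_eq_zero_iff _ h₃).trans ((map_eq_zero_iff _ (hinj _ _ n)).trans ?_)
    refine DFinsupp.ext_iff.trans (forall_congr' fun p => ?_)
    rw [← hid]
    rfl
  have hsnd : ∀ x, κ (TopCat.of X) (TopCat.of Y) n x ∈ LinearMap.ker ((homologyFunctor R n).map
      (ofHom ContinuousMap.snd : TopCat.of (X × Y) ⟶ TopCat.of Y)).hom ↔
      ∀ p, TensorProduct.map ((homologyFunctor R p.1.1).map f).hom .id (x p) = 0 := by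
    intro x
    have h₁ := hnat _ _ _ _ f (𝟙 (TopCat.of Y)) n x
    have h₂ := homology_map_comp_apply (R := R)
      (f ⊗ₘ 𝟙 (TopCat.of Y) : TopCat.of (X × Y) ⟶ TopCat.of (X' × Y))
      (ofHom ContinuousMap.snd) n (κ _ _ n x)
    have h₃ := ((ConcreteCategory.isIso_iff_bijective _).1
      (isIso_homologyFunctor_map_snd (R := R) (Y := Y) (A := X') n)).1
    refine Iff.trans (Eq.congr_left (h₂.trans (congr_arg _ h₁))) ?_
    refine (map_eq_zero_iff _ h₃).trans ((map_eq_zero_iff _ (hinj _ _ n)).trans ?_)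
    refine DFinsupp.ext_iff.trans (forall_congr' fun p => ?_)
    rw [← hid]
    rfl
  let T : KerTensor R X Y f g n →ₗ[R] (homologyFunctor R n).obj (TopCat.of (X × Y)) :=
    κ (TopCat.of X) (TopCat.of Y) n ∘ₗ J
  have hT : ∀ w, T w ∈ LinearMap.ker ((homologyFunctor R n).map
      (ofHom ContinuousMap.fst : TopCat.of (X × Y) ⟶ TopCat.of X)).hom ⊓
      LinearMap.ker ((homologyFunctor R n).map
        (ofHom ContinuousMap.snd : TopCat.of (X × Y) ⟶ TopCat.of Y)).hom := fun w =>
    ⟨(hfst _).2 fun p => LinearMap.map_id_kerTensorIncl _,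
      (hsnd _).2 fun p => LinearMap.map_kerTensorIncl_id _⟩
  refine ⟨LinearEquiv.ofBijective (T.codRestrict _ hT) ⟨fun v w h => ?_, fun ⟨z, hz₁, hz₂⟩ => ?_⟩⟩
  · exact hJ (hinj _ _ n (congr_arg Subtype.val h))
  -- The torsion hypothesis is used only here.
  · obtain ⟨x, rfl⟩ := hsurj _ _ n hTor z
    have hx : x ∈ LinearMap.range J := (DirectSum.mem_range_lmap _ x).2 fun p =>
      LinearMap.exists_kerTensorIncl_eq (hs p.1.1) (ht p.1.2)
        ((hsnd x).1 hz₂ p) ((hfst x).1 hz₁ p)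
    obtain ⟨w, rfl⟩ := hx
    exact ⟨w, rfl⟩

variable (R X Y) in
/-- The homology of the join of two nonempty spaces with vanishing torsion products. -/
theorem nonempty_join_homology_equiv [IsHereditaryRing.{u} R] [Nonempty X] [Nonempty Y]
    (hTor : ∀ i j, IsZero (torOne ((homologyFunctor R i).obj (TopCat.of X))
      ((homologyFunctor R j).obj (TopCat.of Y)))) (n : ℕ) :
    Nonempty ((homologyFunctor R (n + 1)).obj (TopCat.of (JoinSpace X Y)) ≃+
      KerTensor R X Y (ofHom (coneInclusion X)) (ofHom (coneInclusion Y)) n) := by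
  obtain ⟨e₁⟩ := JoinSpace.nonempty_homology_equiv R X Y n
  obtain ⟨e₂⟩ := nonempty_kerTensor_equiv (ofHom (coneInclusion X)) (ofHom (coneInclusion Y)) hTor n
  exact ⟨(e₁ ≪≫ₗ e₂.symm).toAddEquiv⟩

end TopCat

end

noncomputable section

/-! ### Splitting off the extreme summands of a graded tensor product -/

namespace DirectSum

variable {R : Type*} [CommRing R] {A A' B B' : ℕ → Type*} [∀ k, AddCommGroup (A k)]
  [∀ k, Module R (A k)] [∀ k, AddCommGroup (A' k)] [∀ k, Module R (A' k)]
  [∀ k, AddCommGroup (B k)] [∀ k, Module R (B k)] [∀ k, AddCommGroup (B' k)]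
  [∀ k, Module R (B' k)]

/-- A graded tensor product whose factors are changed by isomorphisms in positive degrees is the
sum of the part of positive bidegrees and the two extreme summands. -/
lemma exists_gradedTensor_equiv (α : ∀ k, A k →ₗ[R] A' k) (β : ∀ k, B k →ₗ[R] B' k)
    (hα : ∀ k, 0 < k → Function.Bijective (α k)) (hβ : ∀ k, 0 < k → Function.Bijective (β k))
    {d : ℕ} (hd : 0 < d) :
    ∃ e : (⨁ p : {p : ℕ × ℕ // p.1 + p.2 = d}, A p.1.1 ⊗[R] B p.1.2) ≃+
        (⨁ p : {p : ℕ × ℕ // p.1 + p.2 = d ∧ 0 < p.1 ∧ 0 < p.2}, A' p.1.1 ⊗[R] B' p.1.2) ×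
          (A 0 ⊗[R] B' d) × (A' d ⊗[R] B 0),
      (∀ k m (hkm : k + m = d) (hk : 0 < k) (hm : 0 < m) (t : A k ⊗[R] B m),
        e (lof R {p : ℕ × ℕ // p.1 + p.2 = d} (fun p => A p.1.1 ⊗[R] B p.1.2) ⟨(k, m), hkm⟩ t) =
          (lof R {p : ℕ × ℕ // p.1 + p.2 = d ∧ 0 < p.1 ∧ 0 < p.2}
            (fun p => A' p.1.1 ⊗[R] B' p.1.2) ⟨(k, m), hkm, hk, hm⟩
            (TensorProduct.map (α k) (β m) t), 0, 0)) ∧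
      (∀ t : A 0 ⊗[R] B d,
        e (lof R {p : ℕ × ℕ // p.1 + p.2 = d} (fun p => A p.1.1 ⊗[R] B p.1.2)
          ⟨(0, d), Nat.zero_add _⟩ t) = (0, TensorProduct.map .id (β d) t, 0)) ∧
      (∀ t : A d ⊗[R] B 0,
        e (lof R {p : ℕ × ℕ // p.1 + p.2 = d} (fun p => A p.1.1 ⊗[R] B p.1.2)
          ⟨(d, 0), Nat.add_zero _⟩ t) = (0, 0, TensorProduct.map (α d) .id t)) := by
  let I := {p : ℕ × ℕ // p.1 + p.2 = d}
  let P := {p : ℕ × ℕ // p.1 + p.2 = d ∧ 0 < p.1 ∧ 0 < p.2}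
  let F : I → Type _ := fun p => A p.1.1 ⊗[R] B p.1.2
  let α' := fun k hk => LinearEquiv.ofBijective (α k) (hα k hk)
  let β' := fun k hk => LinearEquiv.ofBijective (β k) (hβ k hk)
  let ψ₁ : (⨁ p : P, A' p.1.1 ⊗[R] B' p.1.2) →ₗ[R] ⨁ p, F p :=
    toModule R P _ fun p => lof R I F ⟨p.1, p.2.1⟩ ∘ₗ
      (TensorProduct.congr (α' _ p.2.2.1) (β' _ p.2.2.2)).symm.toLinearMap
  let e₂ : A 0 ⊗[R] B d ≃ₗ[R] A 0 ⊗[R] B' d := TensorProduct.congr (.refl R _) (β' d hd)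
  let e₃ : A d ⊗[R] B 0 ≃ₗ[R] A' d ⊗[R] B 0 := TensorProduct.congr (α' d hd) (.refl R _)
  let i₂ : I := ⟨(0, d), Nat.zero_add _⟩
  let i₃ : I := ⟨(d, 0), Nat.add_zero _⟩
  -- The inverse is constructed, since a map out of the three pieces needs no case distinction on
  -- indices.
  let ψ : ((⨁ p : P, A' p.1.1 ⊗[R] B' p.1.2) × (A 0 ⊗[R] B' d) × (A' d ⊗[R] B 0)) →ₗ[R]
      ⨁ p, F p :=
    ψ₁.coprod ((lof R I F i₂ ∘ₗ e₂.symm.toLinearMap).coprod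
      (lof R I F i₃ ∘ₗ e₃.symm.toLinearMap))
  have hψ : ∀ x a b, ψ (x, a, b) = ψ₁ x + (lof R I F i₂ (e₂.symm a) +
    lof R I F i₃ (e₃.symm b)) := fun _ _ _ => rfl
  have hψ₁ : ∀ (p : P) t, ψ₁ (lof R P (fun p => A' p.1.1 ⊗[R] B' p.1.2) p
      (TensorProduct.map (α _) (β _) t)) = lof R I F ⟨p.1, p.2.1⟩ t := fun p t => by
    refine (toModule_lof R p _).trans (congr_arg (lof R I F ⟨p.1, p.2.1⟩) ?_)
    exact (TensorProduct.congr (α' _ p.2.2.1) (β' _ p.2.2.2)).symm_apply_apply t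
  have g₁ : ∀ k m (hkm : k + m = d) (hk : 0 < k) (hm : 0 < m) (t : A k ⊗[R] B m),
      ψ (lof R P (fun p => A' p.1.1 ⊗[R] B' p.1.2) ⟨(k, m), hkm, hk, hm⟩
        (TensorProduct.map (α k) (β m) t), 0, 0) = lof R I F ⟨(k, m), hkm⟩ t := by
    intro k m hkm hk hm t
    rw [hψ, map_zero, map_zero, map_zero, map_zero, add_zero, add_zero]
    exact hψ₁ ⟨(k, m), hkm, hk, hm⟩ t
  have g₂ : ∀ t : A 0 ⊗[R] B d, ψ (0, TensorProduct.map .id (β d) t, 0) = lof R I F i₂ t := by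
    intro t
    rw [hψ, map_zero, map_zero, map_zero, zero_add, add_zero]
    exact congr_arg (lof R I F i₂) (e₂.symm_apply_apply t)
  have g₃ : ∀ t : A d ⊗[R] B 0, ψ (0, 0, TensorProduct.map (α d) .id t) = lof R I F i₃ t := by
    intro t
    rw [hψ, map_zero, map_zero, map_zero, zero_add, zero_add]
    exact congr_arg (lof R I F i₃) (e₃.symm_apply_apply t)
  have hinj : Function.Injective ψ := by
    -- The extreme summands are distinct because `d > 0`; for `d = 0` they would coincide.
    have h₂₃ : i₂ ≠ i₃ := fun h => hd.ne (congr_arg (fun p : I => p.1.1) h)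
    have c₂ : component R I F i₂ ∘ₗ ψ₁ = 0 := by
      refine linearMap_ext R fun p => LinearMap.ext fun t => ?_
      simp only [ψ₁, LinearMap.comp_apply, toModule_lof]
      rw [component.of, dif_neg]
      · rfl
      · exact fun h => p.2.2.1.ne' (congr_arg (fun p : I => p.1.1) h)
    have c₃ : component R I F i₃ ∘ₗ ψ₁ = 0 := by
      refine linearMap_ext R fun p => LinearMap.ext fun t => ?_
      simp only [ψ₁, LinearMap.comp_apply, toModule_lof]
      rw [component.of, dif_neg]
      · rfl
      · exact fun h => p.2.2.2.ne' (congr_arg (fun p : I => p.1.2) h)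
    have c₁ : ∀ p : P, component R I F ⟨p.1, p.2.1⟩ ∘ₗ ψ₁ =
        (TensorProduct.congr (α' _ p.2.2.1) (β' _ p.2.2.2)).symm.toLinearMap ∘ₗ
          component R P (fun p => A' p.1.1 ⊗[R] B' p.1.2) p := by
      intro p
      refine linearMap_ext R fun q => LinearMap.ext fun t => ?_
      simp only [ψ₁, LinearMap.comp_apply, toModule_lof]
      rw [component.of, component.of]
      by_cases h : q = p
      · subst h
        rw [dif_pos rfl, dif_pos rfl]
      · have h' : (⟨q.1, q.2.1⟩ : I) ≠ ⟨p.1, p.2.1⟩ := fun h' =>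
          h (Subtype.ext (congr_arg (fun p : I => p.1) h'))
        rw [dif_neg h', dif_neg h, map_zero]
    rw [injective_iff_map_eq_zero]
    rintro ⟨x, a, b⟩ h
    rw [hψ] at h
    have ha : a = 0 := by
      have := congr_arg (component R I F i₂) h
      rw [map_add, map_add, ← LinearMap.comp_apply, c₂, component.lof_self, component.of,
        dif_neg h₂₃.symm, map_zero] at this
      simpa using this
    have hb : b = 0 := by
      have := congr_arg (component R I F i₃) h
      rw [map_add, map_add, ← LinearMap.comp_apply, c₃, component.lof_self, component.of,
        dif_neg h₂₃, map_zero] at this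
      simpa using this
    subst ha hb
    rw [map_zero, map_zero, map_zero, map_zero, add_zero, add_zero] at h
    have hx : x = 0 := DFinsupp.ext fun p => by
      have := (LinearMap.congr_fun (c₁ p) x).symm.trans
        ((congr_arg (component R I F ⟨p.1, p.2.1⟩) h).trans (map_zero _))
      exact ((TensorProduct.congr (α' _ p.2.2.1) (β' _ p.2.2.2)).symm.map_eq_zero_iff).1 this
    rw [hx]
    rfl
  have hsurj : Function.Surjective ψ := by
    rw [← LinearMap.range_eq_top, eq_top_iff]
    rintro y -
    induction y using DirectSum.induction_on with
    | zero => exact zero_mem _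
    | add x y hx hy => exact add_mem hx hy
    | of p t =>
      obtain ⟨⟨k, m⟩, h⟩ := p
      rcases Nat.eq_zero_or_pos k with rfl | hk
      · obtain rfl : m = d := (Nat.zero_add m).symm.trans h
        exact ⟨_, g₂ t⟩
      · rcases Nat.eq_zero_or_pos m with rfl | hm
        · obtain rfl : k = d := h
          exact ⟨_, g₃ t⟩
        · exact ⟨_, g₁ k m h hk hm t⟩
  refine ⟨(LinearEquiv.ofBijective ψ ⟨hinj, hsurj⟩).symm.toAddEquiv, fun k m hkm hk hm t => ?_,
    fun t => ?_, fun t => ?_⟩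
  · exact (LinearEquiv.symm_apply_eq _).2 (g₁ k m hkm hk hm t).symm
  · exact (LinearEquiv.symm_apply_eq _).2 (g₂ t).symm
  · exact (LinearEquiv.symm_apply_eq _).2 (g₃ t).symm

end DirectSum

end

noncomputable section

/-! ### Integral homology of joins -/

-- Standard simplices are nonempty, so an empty space has no singular simplices.
open TopCat ChainComplex SSet in
lemma subsingleton_homology_of_isEmpty {R : Type} [CommRing R] (X : Type u) [TopologicalSpace X]
    [IsEmpty X] (n : ℕ) : Subsingleton ((homologyFunctor R n).obj (TopCat.of X)) := by
  have h : Subsingleton (((singularChains R).obj (TopCat.of X)).X n) := by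
    refine subsingleton_of_forall_eq 0 fun c => ?_
    induction c using chain_induction with
    | of σ =>
      have : Nonempty (SimplexCategory.toTop.{u}.obj (SimplexCategory.mk n)) := inferInstance
      obtain ⟨t⟩ := this
      exact isEmptyElim ((show SimplexCategory.toTop.{u}.obj (SimplexCategory.mk n) ⟶
        TopCat.of X from σ.down) t : X)
    | zero => rfl
    | add a b ha hb => rw [ha, hb, add_zero]
    | smul r a ha => rw [ha, smul_zero]
  refine subsingleton_of_forall_eq 0 fun x => ?_
  obtain ⟨z, rfl⟩ := cls_surjective (K := (singularChains R).obj (TopCat.of X)) n x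
  rw [Subsingleton.elim z 0, map_zero]
  rfl

instance ConeSpace.instIsEmpty {X : Type u} [IsEmpty X] : IsEmpty (ConeSpace X) :=
  ⟨fun c => by obtain ⟨p⟩ := c; exact isEmptyElim p.1⟩

lemma subsingleton_homology_coneSpace (X : Type u) [TopologicalSpace X] {k : ℕ} (hk : 0 < k) :
    Subsingleton (intHomology k (ConeSpace X)) := by
  obtain ⟨k, rfl⟩ := Nat.exists_eq_succ_of_ne_zero hk.ne'
  cases isEmpty_or_nonempty X
  · exact subsingleton_homology_of_isEmpty _ _
  · exact ModuleCat.subsingleton_of_isZero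
      (TopCat.isZero_homologyFunctor_of_contractible (R := ℤ) (TopCat.of (ConeSpace X)) k)

/-- The cone has no homology in positive degrees, so the kernel is everything. The empty cone is
covered as well. -/
lemma coneKerIncl_bijective (X : Type u) [TopologicalSpace X] {k : ℕ} (hk : 0 < k) :
    Function.Bijective (coneKerIncl k X).hom := by
  have := subsingleton_homology_coneSpace X hk
  exact ⟨Subtype.val_injective, fun a => ⟨⟨a, LinearMap.mem_ker.2 (Subsingleton.elim _ _)⟩, rfl⟩⟩

lemma subsingleton_kerTensor_of_isEmpty (X Y : Type u) [TopologicalSpace X] [TopologicalSpace Y]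
    (h : IsEmpty X ∨ IsEmpty Y) (n : ℕ) : Subsingleton (kerTensor X Y n) := by
  have (p : {p : ℕ × ℕ // p.1 + p.2 = n}) :
      Subsingleton (coneKer p.1.1 X ⊗[ℤ] coneKer p.1.2 Y) := by
    obtain h | h := h
    · have := subsingleton_homology_of_isEmpty (R := ℤ) X p.1.1
      have : Subsingleton (coneKer p.1.1 X) := Subtype.val_injective.subsingleton
      infer_instance
    · have := subsingleton_homology_of_isEmpty (R := ℤ) Y p.1.2
      have : Subsingleton (coneKer p.1.2 Y) := Subtype.val_injective.subsingleton
      infer_instance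
  exact ⟨fun x y => DFinsupp.ext fun p => Subsingleton.elim _ _⟩

lemma isEmpty_joinSpace {X Y : Type u} (h : IsEmpty X ∨ IsEmpty Y) : IsEmpty (JoinSpace X Y) :=
  ⟨fun c => by obtain ⟨p⟩ := c; exact h.elim (fun h => h.elim p.1) fun h => h.elim p.2.1⟩

/-- An empty factor has to be treated apart, since the argument by sections needs base points. As a
quotient of `X × Y × [0,1]` the join is then empty, and a kernel in each summand is zero. -/
lemma nonempty_join_homology_equiv (X Y : Type u) [TopologicalSpace X] [TopologicalSpace Y]
    (hTor : ∀ i j : ℕ, IsZero (torOne (intHomology i X) (intHomology j Y))) (n : ℕ) :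
    Nonempty (intHomology (n + 1) (JoinSpace X Y) ≃+ kerTensor X Y n) := by
  by_cases h : IsEmpty X ∨ IsEmpty Y
  · have := isEmpty_joinSpace h
    have := subsingleton_homology_of_isEmpty (R := ℤ) (JoinSpace X Y) (n + 1)
    have := subsingleton_kerTensor_of_isEmpty X Y h n
    exact ⟨⟨⟨fun _ => 0, fun _ => 0, fun _ => Subsingleton.elim _ _,
      fun _ => Subsingleton.elim _ _⟩, fun _ _ => Subsingleton.elim _ _⟩⟩
  · rw [not_or, not_isEmpty_iff, not_isEmpty_iff] at h
    obtain ⟨hX, hY⟩ := h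
    exact TopCat.nonempty_join_homology_equiv ℤ X Y hTor n

lemma exists_kerTensor_zero_equiv (X Y : Type u) [TopologicalSpace X] [TopologicalSpace Y] :
    ∃ e : kerTensor X Y 0 ≃+ coneKer 0 X ⊗[ℤ] coneKer 0 Y,
      ∀ (a : coneKer 0 X) (b : coneKer 0 Y), e (kerTmul 0 0 rfl a b) = a ⊗ₜ[ℤ] b := by
  -- The only bidegree of total degree zero is `(0, 0)`, so its summand is the whole sum.
  have hsurj : Function.Surjective (DirectSum.of (fun p : {p : ℕ × ℕ // p.1 + p.2 = 0} =>
      coneKer p.1.1 X ⊗[ℤ] coneKer p.1.2 Y) ⟨(0, 0), rfl⟩) := by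
    intro y
    rw [← AddMonoidHom.mem_mrange]
    induction y using DirectSum.induction_on with
    | zero => exact zero_mem _
    | add x y hx hy => exact add_mem hx hy
    | of p t =>
      obtain ⟨⟨k, m⟩, h⟩ := p
      obtain ⟨rfl, rfl⟩ := Nat.add_eq_zero_iff.1 h
      exact ⟨t, rfl⟩
  let e := (AddEquiv.ofBijective _ ⟨DirectSum.of_injective (β := fun p :
    {p : ℕ × ℕ // p.1 + p.2 = 0} => coneKer p.1.1 X ⊗[ℤ] coneKer p.1.2 Y) ⟨(0, 0), rfl⟩, hsurj⟩)
  exact ⟨e.symm, fun a b => e.symm_apply_apply (a ⊗ₜ[ℤ] b)⟩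

lemma exists_kerTensor_equiv (X Y : Type u) [TopologicalSpace X] [TopologicalSpace Y] {d : ℕ}
    (hd : 0 < d) : ∃ e : kerTensor X Y d ≃+
          posTensor X Y d × (coneKer 0 X ⊗[ℤ] intHomology d Y) ×
            (intHomology d X ⊗[ℤ] coneKer 0 Y),
        (∀ (k m : ℕ) (hkm : k + m = d) (hk : 0 < k) (hm : 0 < m)
            (a : coneKer k X) (b : coneKer m Y),
          e (kerTmul k m hkm a b) =
            (posTmul k m ⟨hkm, hk, hm⟩ (coneKerIncl k X a) (coneKerIncl m Y b), 0, 0)) ∧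
        (∀ (a : coneKer 0 X) (b : coneKer d Y),
          e (kerTmul 0 d (Nat.zero_add _) a b) = (0, a ⊗ₜ[ℤ] coneKerIncl d Y b, 0)) ∧
        (∀ (a : coneKer d X) (b : coneKer 0 Y),
          e (kerTmul d 0 (Nat.add_zero _) a b) = (0, 0, coneKerIncl d X a ⊗ₜ[ℤ] b)) := by
  obtain ⟨e, h₁, h₂, h₃⟩ := DirectSum.exists_gradedTensor_equiv (R := ℤ)
    (A := fun k => coneKer k X) (A' := fun k => intHomology k X) (B := fun k => coneKer k Y)
    (B' := fun k => intHomology k Y) (fun k => (coneKerIncl k X).hom)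
    (fun k => (coneKerIncl k Y).hom) (fun _ => coneKerIncl_bijective X)
    (fun _ => coneKerIncl_bijective Y) hd
  exact ⟨e, fun k m hkm hk hm a b => h₁ k m hkm hk hm (a ⊗ₜ b),
    fun a b => h₂ (a ⊗ₜ b), fun a b => h₃ (a ⊗ₜ b)⟩

end

/-- Integral homology of a join. The isomorphisms in the second and third parts are the canonical
ones, induced by the inclusions `Ker((i_X)_k) ⊆ H_k(X)` and `Ker((i_Y)_m) ⊆ H_m(Y)`. -/
theorem theorem1p2 (X Y : Type u) [TopologicalSpace X] [TopologicalSpace Y]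
    (hTor : ∀ i j : ℕ, IsZero (torOne (intHomology i X) (intHomology j Y))) :
    (∀ n : ℕ, 1 ≤ n → Nonempty (intHomology n (JoinSpace X Y) ≃+ kerTensor X Y (n - 1))) ∧
    (∀ n : ℕ, 1 < n →
      ∃ e : kerTensor X Y (n - 1) ≃+
          posTensor X Y (n - 1) × (coneKer 0 X ⊗[ℤ] intHomology (n - 1) Y) ×
            (intHomology (n - 1) X ⊗[ℤ] coneKer 0 Y),
        (∀ (k m : ℕ) (hkm : k + m = n - 1) (hk : 0 < k) (hm : 0 < m)
            (a : coneKer k X) (b : coneKer m Y),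
          e (kerTmul k m hkm a b) =
            (posTmul k m ⟨hkm, hk, hm⟩ (coneKerIncl k X a) (coneKerIncl m Y b), 0, 0)) ∧
        (∀ (a : coneKer 0 X) (b : coneKer (n - 1) Y),
          e (kerTmul 0 (n - 1) (Nat.zero_add _) a b) = (0, a ⊗ₜ[ℤ] coneKerIncl (n - 1) Y b, 0)) ∧
        (∀ (a : coneKer (n - 1) X) (b : coneKer 0 Y),
          e (kerTmul (n - 1) 0 (Nat.add_zero _) a b) = (0, 0, coneKerIncl (n - 1) X a ⊗ₜ[ℤ] b))) ∧
    (∃ e : kerTensor X Y 0 ≃+ coneKer 0 X ⊗[ℤ] coneKer 0 Y,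
      ∀ (a : coneKer 0 X) (b : coneKer 0 Y), e (kerTmul 0 0 rfl a b) = a ⊗ₜ[ℤ] b) := by
  refine ⟨fun n hn => ?_, fun n hn => exists_kerTensor_equiv X Y (Nat.sub_pos_of_lt hn),
    exists_kerTensor_zero_equiv X Y⟩
  obtain ⟨n, rfl⟩ := Nat.exists_eq_succ_of_ne_zero (Nat.one_le_iff_ne_zero.1 hn)
  exact nonempty_join_homology_equiv X Y hTor n
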